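/- Let $k$ be a perfect field. A local field over $k$ is a field $K\supset k$ that is complete for a (normalized) discrete valuation and has residue field $k$. Let $F$ be a local field over $k$ with ring of integers $\mathcal O_F$, let $I$ be a finite non-empty set, and for each $i\in I$ let $E_i$ be a finite separable totally ramified extension of $F$ with ring of integers $\mathcal O_{E_i}$ and maximal ideal $\mathfrak p_{E_i}$. For each $i$ let $\gamma_i\in\mathfrak p_{E_i}$ be an element with $E_i=F[\gamma_i]$, and suppose that the minimal polynomials of the $\gamma_i$ over $F$ are pairwise distinct. Put $\gamma_I=(\gamma_i)_{i\in I}$ and $$A_I=\mathcal O_F[\gamma_I]\subset\widetilde A_I=\prod_{i\in I}\mathcal O_{E_i}.$$ Assume $|k|\ge |I|$. Then there is a geometrically integral projective curve $C_I$ over $k$ with a $k$-rational point $c_I$ such that: (1) $C_I$ is smooth over $k$ away from $c_I$; (2) the completed local ring of $C_I$ at $c_I$ is isomorphic to $A_I$ as a $k$-algebra; (3) the normalization of $C_I$ is isomorphic over $k$ to $\mathbb P^1_k$. Moreover $C_I$ can be chosen as follows. There are an injection $\iota:I\hookrightarrow k$ and uniformizers $\varpi_i$ of the $\mathcal O_{E_i}$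 such that, with $$B_I=\{p\in k[x] : (p(\iota(i)+\varpi_i))_{i\in I}\in A_I\}$$ (the fibre product of $k[x]$ and $A_I$ over $\widetilde A_I$, so that $\mathrm{Spec}(B_I)$ is the amalgamated sum of $\mathbb A^1_k$ and $\mathrm{Spf}(A_I)$ along $\mathrm{Spf}(\widetilde A_I)$), the curve $C_I$ is the gluing of $\mathrm{Spec}(B_I)$ and $\mathbb P^1_k\setminus\iota(I)$ along their common open subscheme $\mathbb A^1_k\setminus\iota(I)$. The resulting morphism $\mathbb P^1_k\to C_I$, which on $\mathbb A^1_k$ is given by $B_I\subset k[x]$, is the normalization, and the inverse image of $c_I$ is $\iota(I)$. -/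

import Mathlib

open CategoryTheory AlgebraicGeometry Polynomial
open scoped WithZero

universe u v w x

noncomputable section

namespace SingularCurve

/-! ### Local fields and the plane curve germ -/

section Germ

/-- `K`, with its normalized discrete valuation `vK` (written multiplicatively), is a local field
over `k`: it contains `k`, it is complete, and its residue field is `k`. -/
structure IsLocalField (k : Type u) {K : Type v} [Field k] [Field K] [Algebra k K]
    (vK : Valuation K ℤᵐ⁰) : Prop where
  surjective : Function.Surjective vK
  complete : IsAdicComplete (IsLocalRing.maximalIdeal vK.valuationSubring) vK.valuationSubring
  algebraMap_le_one : ∀ a : k, vK (algebraMap k K a) ≤ 1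
  residue : ∀ y : K, vK y ≤ 1 → ∃ a : k, vK (y - algebraMap k K a) < 1

/-- `E / F` is totally ramified, and `vE` is the normalized discrete valuation of `E` (written
multiplicatively): the ramification index of `vE` over the normalized valuation `vF` of `F` is the
degree `[E : F]`. -/
structure IsTotallyRamified {F : Type v} {E : Type w} [Field F] [Field E] [Algebra F E]
    (vF : Valuation F ℤᵐ⁰) (vE : Valuation E ℤᵐ⁰) : Prop where
  surjective : Function.Surjective vE
  map_algebraMap : ∀ y : F, vE (algebraMap F E y) = vF y ^ Module.finrank F E

variable (k : Type u) {F : Type v} {I : Type x} {E : I → Type w} [Field k] [Field F]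
  [∀ i, Field (E i)] [∀ i, Algebra k (E i)] [∀ i, Algebra F (E i)]

/-- The ring `A_I = 𝒪_F[γ_I]` inside `E_I = ∏ E_i`, as a `k`-algebra: it is generated over `k` by
the image of `𝒪_F` and by the family `γ_I = (γ_i)`. -/
def ringA (vF : Valuation F ℤᵐ⁰) (γ : ∀ i, E i) : Subalgebra k (∀ i, E i) :=
  Algebra.adjoin k ({z | ∃ y : F, vF y ≤ 1 ∧ z = algebraMap F (∀ i, E i) y} ∪ {γ})

variable {k}

/-- The `k`-algebra map `k[x] → E_I = ∏ E_i` sending `x` to the family `ι(i) + ϖ_i`. -/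
def expansion (ι : I → k) (ϖ : ∀ i, E i) : k[X] →ₐ[k] (∀ i, E i) :=
  Polynomial.aeval (fun i => algebraMap k (E i) (ι i) + ϖ i)

/-- The fibre product `B_I` of `A_I` and `k[x]` over `E_I`, that is, the subalgebra of `k[x]` of
all polynomials whose expansion lies in `A_I`. -/
def ringB (vF : Valuation F ℤᵐ⁰) (γ : ∀ i, E i) (ι : I → k) (ϖ : ∀ i, E i) :
    Subalgebra k k[X] :=
  (ringA k vF γ).comap (expansion ι ϖ)

end Germ

/-! ### Projective space over a field -/

section Projective

attribute [local instance] MvPolynomial.gradedAlgebra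

variable (k : Type u) [Field k]

/-- Projective space `ℙⁿ` over `k`. -/
abbrev projSpace (n : ℕ) : Scheme.{u} := Proj (MvPolynomial.homogeneousSubmodule (Fin (n + 1)) k)

/-- The structure morphism of `ℙⁿ` over `k`. -/
def projSpaceStr (n : ℕ) : projSpace k n ⟶ Spec (.of k) :=
  Proj.toSpecZero (MvPolynomial.homogeneousSubmodule (Fin (n + 1)) k) ≫
    Spec.map (CommRingCat.ofHom
      (algebraMap k (MvPolynomial.homogeneousSubmodule (Fin (n + 1)) k 0)))

/-- A morphism to `Spec k` is projective if it factors through a closed immersion into some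
`ℙⁿ`. -/
def IsProjective {k : Type u} [Field k] {C : Scheme.{u}} (f : C ⟶ Spec (.of k)) : Prop :=
  ∃ (n : ℕ) (j : C ⟶ projSpace k n), IsClosedImmersion j ∧ j ≫ projSpaceStr k n = f

/-- Dehomogenization `k[X₀, X₁] → k[x]`, `X₀ ↦ 1`, `X₁ ↦ x`. -/
def dehomogenize : MvPolynomial (Fin (1 + 1)) k →+* k[X] :=
  (MvPolynomial.aeval ![1, (X : k[X])]).toRingHom

/-- Dehomogenization on the degree zero part of `k[X₀, X₁][1 / X₀]`, that is, the isomorphism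
`k[X₁ / X₀] → k[x]`. -/
def chartRingHom :
    HomogeneousLocalization.Away (MvPolynomial.homogeneousSubmodule (Fin (1 + 1)) k)
      (MvPolynomial.X 0) →+* k[X] :=
  (IsLocalization.Away.lift (S := Localization.Away (MvPolynomial.X 0 : MvPolynomial (Fin (1 + 1)) k))
    (MvPolynomial.X 0) (g := dehomogenize k) (by simp [dehomogenize])).comp
  (algebraMap _ _)

/-- The standard open immersion `𝔸¹ = Spec k[x] → ℙ¹`, `x = X₁ / X₀`. -/
def affineChart : Spec (.of k[X]) ⟶ projSpace k 1 :=
  Spec.map (CommRingCat.ofHom (chartRingHom k)) ≫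
    Proj.awayι (MvPolynomial.homogeneousSubmodule (Fin (1 + 1)) k) (MvPolynomial.X 0)
      ((MvPolynomial.mem_homogeneousSubmodule _ _).2 (MvPolynomial.isHomogeneous_X k 0)) Nat.one_pos

/-- The point of `ℙ¹` with affine coordinate `a ∈ k`. -/
def affinePoint {k : Type u} [Field k] (a : k) : projSpace k 1 :=
  (Spec.map (CommRingCat.ofHom (Polynomial.evalRingHom a)) ≫ affineChart k)
    (IsLocalRing.closedPoint k)

end Projective

/-! ### Curves -/

section Curves

variable {k : Type u} [Field k] {C : Scheme.{u}}

/-- The point of `C` underlying a `k`-point. -/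
def underlyingPoint (c : Spec (.of k) ⟶ C) : C := c (IsLocalRing.closedPoint k)

/-- The map `k → 𝒪_{C, z}` that makes the local rings of a `k`-scheme into `k`-algebras. -/
def scalarsToStalk (f : C ⟶ Spec (.of k)) (z : C) : k →+* C.presheaf.stalk z :=
  ((Scheme.ΓSpecIso (.of k)).inv ≫ f.appTop ≫ C.presheaf.germ ⊤ z trivial).hom

/-- The completed local ring of the `k`-scheme `C` at `z` is isomorphic to `A` as a
`k`-algebra. -/
def CompletedLocalRingIso (f : C ⟶ Spec (.of k)) (z : C) (A : Type*) [CommRing A] [Algebra k A] :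
    Prop :=
  ∃ e : AdicCompletion (IsLocalRing.maximalIdeal (C.presheaf.stalk z)) (C.presheaf.stalk z) ≃+* A,
    ∀ a : k, e (algebraMap (C.presheaf.stalk z) _ (scalarsToStalk f z a)) = algebraMap k A a

/-- `π : Y ⟶ X` is the normalization of the integral scheme `X`: up to an isomorphism, it is the
relative normalization of `X` in the spectrum of its function field. -/
def IsNormalization {X Y : Scheme.{u}} (π : Y ⟶ X) : Prop :=
  ∃ (_ : IsIntegral X) (_ : QuasiCompact (X.fromSpecStalk (genericPoint X)))
    (_ : QuasiSeparated (X.fromSpecStalk (genericPoint X)))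
    (e : Y ≅ (X.fromSpecStalk (genericPoint X)).normalization),
    e.hom ≫ (X.fromSpecStalk (genericPoint X)).fromNormalization = π

/-- Via `π : ℙ¹ ⟶ C` and `b : Spec B ⟶ C`, the `k`-scheme `C` is obtained by gluing `Spec B` and
the open complement `ℙ¹ ∖ Z` along the open subscheme `𝔸¹ ∖ Z` of both, where `Z` is a set of
points of `𝔸¹` and `B` is a subalgebra of `k[x]`. The restriction of `π` to `𝔸¹` is then the
morphism `𝔸¹ → Spec B` given by the inclusion of `B`. -/
structure IsGluing (f : C ⟶ Spec (.of k)) (π : projSpace k 1 ⟶ C) (B : Subalgebra k k[X])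
    (b : Spec (.of B) ⟶ C) (V : (projSpace k 1).Opens) : Prop where
  comp_str : b ≫ f = Spec.map (CommRingCat.ofHom (algebraMap k B))
  chart : affineChart k ≫ π = Spec.map (CommRingCat.ofHom B.val.toRingHom) ≫ b
  isOpenImmersion_left : IsOpenImmersion b
  isOpenImmersion_right : IsOpenImmersion (V.ι ≫ π)
  cover : Set.range b ∪ Set.range (V.ι ≫ π) = Set.univ
  isPullback : IsPullback
    ((affineChart k ⁻¹ᵁ V).ι ≫ Spec.map (CommRingCat.ofHom B.val.toRingHom)) (affineChart k ∣_ V)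
    b (V.ι ≫ π)

end Curves

end SingularCurve

end

/-! Below, the order of an element means its additive valuation, the exponent of `exp (-1)`.

Only two properties of the order $A=\mathcal O_F[\gamma_I]$ matter, and they form
`IsUnibranchOrder`. First, $A$ contains every family of order at least some $N$. The minimal
polynomials of the $\gamma_i$ are distinct irreducibles, so the Chinese remainder theorem gives
$F[\gamma_I]=\prod E_i$ (`exists_aeval_eq`). Clearing denominators for the finitely many basis
vectors $\varpi_i^j$ then gives $N$ (`exists_isUnibranchOrder_ringA`). Second, every element of $A$
is a constant of $k$ up to positive order, because this holds for $\mathcal O_F$ and for $\gamma_I$.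
Completeness of the $E_i$ comes from that of $F$, coefficient by coefficient in the basis
$1,\varpi_i,\varpi_i^2,\dots$.

Consequently $B$ contains the ideal $g\,k[x]$ with $g=\prod(x-\iota(i))^N$, and each of its elements
takes one common value on $\iota(I)$. Thus $k[x]$ is integral over $B$, $B[1/g]=k[x][1/g]$, and
$\mathrm{Spec}\,B$ is the affine line with $\iota(I)$ pinched to one point. To compactify it, let
$M=\deg g$ and use a spanning family of the elements of $B$ of degree at most $3M$ as homogeneous
coordinates of a morphism $\mathbb P^1\to\mathbb P^n$; the curve is its scheme-theoretic image. The
coordinate $1$ cuts out $\mathrm{Spec}\,B$, and the coordinate $g^2x^M$ cuts out a neighbourhood of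
infinity over which $\mathbb P^1$ maps isomorphically (`nonempty_curveModel`). Normalization,
dimension, smoothness and the gluing are read off these two charts; geometric integrality follows
from dominance of the affine line.

For the completed local ring, the expansion map $B\to A$ has dense image by successive interpolation
at the $\iota(i)$. On $B$, the powers of the maximal ideal of the singular point and the filtration
by order define the same topology, and $A$ is separated and complete for the latter
(`IsUnibranchOrder.completedLocalRingIso`). -/

noncomputable section

namespace SingularCurve

/-! ### Morphisms from affine schemes to projective space -/

section ProjMap

attribute [local instance] MvPolynomial.gradedAlgebra

open MvPolynomial (homogeneousSubmodule)

variable {k : Type u} [Field k] {n : ℕ} {T T' : Type u} [CommRing T] [CommRing T']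

/-- The map on degree zero fractions induced by a ring map that inverts the denominator. -/
def awayLift (g : MvPolynomial (Fin (n + 1)) k →+* T) (s : MvPolynomial (Fin (n + 1)) k)
    (hs : IsUnit (g s)) :
    HomogeneousLocalization.Away (homogeneousSubmodule (Fin (n + 1)) k) s →+* T :=
  (IsLocalization.Away.lift (S := Localization.Away s) s (g := g) hs).comp (algebraMap _ _)

/-- The computation rule for `awayLift`, cleared of denominators so that no inverse of `g s`
appears. -/
lemma awayLift_mk (g : MvPolynomial (Fin (n + 1)) k →+* T) {s : MvPolynomial (Fin (n + 1)) k}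
    (hs : IsUnit (g s)) {d : ℕ} (hd : s ∈ homogeneousSubmodule (Fin (n + 1)) k d) (m : ℕ)
    (a : MvPolynomial (Fin (n + 1)) k) (ha : a ∈ homogeneousSubmodule (Fin (n + 1)) k (m • d)) :
    awayLift g s hs (HomogeneousLocalization.Away.mk _ hd m a ha) * g s ^ m = g a := by
  have h := congrArg (IsLocalization.Away.lift (S := Localization.Away s) s (g := g) hs)
    (IsLocalization.mk'_spec (Localization.Away s) a (⟨s ^ m, m, rfl⟩ : Submonoid.powers s))
  rw [map_mul, IsLocalization.Away.lift_eq, IsLocalization.Away.lift_eq, map_pow] at h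
  rw [← h]
  simp only [awayLift, RingHom.comp_apply, HomogeneousLocalization.algebraMap_apply,
    HomogeneousLocalization.Away.val_mk, Localization.mk_eq_mk']

lemma comp_awayLift (g : MvPolynomial (Fin (n + 1)) k →+* T) (s : MvPolynomial (Fin (n + 1)) k)
    (hs : IsUnit (g s)) (r : T →+* T') :
    r.comp (awayLift g s hs) = awayLift (r.comp g) s (hs.map r) := by
  have : r.comp (IsLocalization.Away.lift (S := Localization.Away s) s (g := g) hs) =
      IsLocalization.Away.lift (S := Localization.Away s) s (g := r.comp g) (hs.map r) := by
    refine IsLocalization.ringHom_ext (Submonoid.powers s) ?_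
    ext x <;> simp
  rw [awayLift, awayLift, ← RingHom.comp_assoc, this]

lemma awayLift_comp_awayMap (g : MvPolynomial (Fin (n + 1)) k →+* T)
    {s t x : MvPolynomial (Fin (n + 1)) k} (hx : x = s * t)
    (hs : IsUnit (g s)) (hxu : IsUnit (g x)) {e : ℕ}
    (ht : t ∈ homogeneousSubmodule (Fin (n + 1)) k e) :
    (awayLift g x hxu).comp (HomogeneousLocalization.awayMap _ ht hx) = awayLift g s hs := by
  ext a
  simp only [awayLift, RingHom.comp_apply, HomogeneousLocalization.algebraMap_apply,
    HomogeneousLocalization.val_awayMap]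
  rw [← RingHom.comp_apply]
  congr 1
  refine IsLocalization.ringHom_ext (Submonoid.powers s) ?_
  ext x <;> simp [Localization.awayLift]

/-- Numerator and denominator of a degree zero fraction acquire the same power of `c`. -/
lemma awayLift_congr_of_scale (g g' : MvPolynomial (Fin (n + 1)) k →+* T) {c : T}
    (hg : ∀ d, ∀ a ∈ homogeneousSubmodule (Fin (n + 1)) k d, g' a = c ^ d * g a)
    {s : MvPolynomial (Fin (n + 1)) k} {d : ℕ}
    (hd : s ∈ homogeneousSubmodule (Fin (n + 1)) k d)
    (hs : IsUnit (g s)) (hs' : IsUnit (g' s)) :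
    awayLift g s hs = awayLift g' s hs' := by
  ext z
  obtain ⟨m, a, ha, rfl⟩ := HomogeneousLocalization.Away.mk_surjective _ hd z
  have h1 := awayLift_mk g hs hd m a ha
  have h2 := awayLift_mk g' hs' hd m a ha
  rw [hg _ _ ha, hg _ _ hd, mul_pow, ← pow_mul, ← h1, smul_eq_mul, mul_comm d m] at h2
  refine (hs'.pow m).mul_right_cancel ?_
  rw [hg _ _ hd, mul_pow, ← pow_mul, mul_comm d m, h2]
  ring

/-- The morphism to `ℙⁿ` with homogeneous coordinates `g X₀, …, g Xₙ`, where `g s` is a unit for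
a form `s`. -/
def projMap (g : MvPolynomial (Fin (n + 1)) k →+* T) {s : MvPolynomial (Fin (n + 1)) k} {d : ℕ}
    (hd : s ∈ homogeneousSubmodule (Fin (n + 1)) k d) (hd0 : 0 < d) (hs : IsUnit (g s)) :
    Spec (.of T) ⟶ projSpace k n :=
  Spec.map (CommRingCat.ofHom (awayLift g s hs)) ≫
    Proj.awayι (homogeneousSubmodule (Fin (n + 1)) k) s hd hd0

lemma projMap_eq_mul (g : MvPolynomial (Fin (n + 1)) k →+* T)
    {s t : MvPolynomial (Fin (n + 1)) k} {d e : ℕ}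
    (hd : s ∈ homogeneousSubmodule (Fin (n + 1)) k d) (hd0 : 0 < d) (hs : IsUnit (g s))
    (he : t ∈ homogeneousSubmodule (Fin (n + 1)) k e) (hxu : IsUnit (g (s * t))) :
    projMap g hd hd0 hs = projMap g (SetLike.mul_mem_graded hd he)
      (hd0.trans_le (d.le_add_right e)) hxu := by
  rw [projMap, projMap, ← awayLift_comp_awayMap g rfl hs hxu he, CommRingCat.ofHom_comp,
    Spec.map_comp, Category.assoc]
  congr 1
  exact Proj.SpecMap_awayMap_awayι _ hd hd0 he rfl

/-- Both morphisms land in the locus where `s * t` is invertible, and they agree there. So the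
morphism depends on the coordinates only, not on the form chosen to define it. -/
lemma projMap_congr_left (g : MvPolynomial (Fin (n + 1)) k →+* T)
    {s t : MvPolynomial (Fin (n + 1)) k} {d e : ℕ}
    (hd : s ∈ homogeneousSubmodule (Fin (n + 1)) k d) (hd0 : 0 < d) (hs : IsUnit (g s))
    (he : t ∈ homogeneousSubmodule (Fin (n + 1)) k e) (he0 : 0 < e) (ht : IsUnit (g t)) :
    projMap g hd hd0 hs = projMap g he he0 ht := by
  have hxu : IsUnit (g (s * t)) := by rw [map_mul]; exact hs.mul ht
  have hxu' : IsUnit (g (t * s)) := by rw [map_mul]; exact ht.mul hs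
  rw [projMap_eq_mul g hd hd0 hs he hxu, projMap_eq_mul g he he0 ht hd hxu']
  congr 1 
  · exact mul_comm s t
  · exact add_comm d e

/-- Rescaling homogeneous coordinates by a unit does not change the morphism. -/
lemma projMap_eq_of_scale (g g' : MvPolynomial (Fin (n + 1)) k →+* T) {c : T}
    (hg : ∀ d, ∀ a ∈ homogeneousSubmodule (Fin (n + 1)) k d, g' a = c ^ d * g a)
    (hc : IsUnit c) {s t : MvPolynomial (Fin (n + 1)) k} {d e : ℕ}
    (hd : s ∈ homogeneousSubmodule (Fin (n + 1)) k d) (hd0 : 0 < d) (hs : IsUnit (g s))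
    (he : t ∈ homogeneousSubmodule (Fin (n + 1)) k e) (he0 : 0 < e) (ht : IsUnit (g' t)) :
    projMap g hd hd0 hs = projMap g' he he0 ht := by
  have hs' : IsUnit (g' s) := by rw [hg _ _ hd]; exact (hc.pow d).mul hs
  rw [projMap_congr_left g' he he0 ht hd hd0 hs', projMap, projMap,
    awayLift_congr_of_scale g g' hg hd hs hs']

lemma SpecMap_comp_projMap (g : MvPolynomial (Fin (n + 1)) k →+* T)
    {s : MvPolynomial (Fin (n + 1)) k} {d : ℕ}
    (hd : s ∈ homogeneousSubmodule (Fin (n + 1)) k d) (hd0 : 0 < d) (hs : IsUnit (g s))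
    (r : T →+* T') :
    Spec.map (CommRingCat.ofHom r) ≫ projMap g hd hd0 hs =
      projMap (r.comp g) hd hd0 (hs.map r) := by
  rw [projMap, projMap, ← comp_awayLift g s hs, CommRingCat.ofHom_comp, Spec.map_comp,
    Category.assoc]

lemma projMap_comp_projSpaceStr (g : MvPolynomial (Fin (n + 1)) k →+* T)
    {s : MvPolynomial (Fin (n + 1)) k} {d : ℕ}
    (hd : s ∈ homogeneousSubmodule (Fin (n + 1)) k d) (hd0 : 0 < d) (hs : IsUnit (g s)) :
    projMap g hd hd0 hs ≫ projSpaceStr k n = Spec.map (CommRingCat.ofHom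
      (g.comp MvPolynomial.C)) := by
  rw [projMap, projSpaceStr, Category.assoc, Proj.awayι_toSpecZero_assoc, ← Spec.map_comp,
    ← Spec.map_comp]
  congr 1
  ext a
  have : (HomogeneousLocalization.fromZeroRingHom
      (homogeneousSubmodule (Fin (n + 1)) k) (Submonoid.powers s)
      (algebraMap k (homogeneousSubmodule (Fin (n + 1)) k 0) a)).val =
      algebraMap (MvPolynomial (Fin (n + 1)) k) (Localization.Away s) (MvPolynomial.C a) := by
    simp [HomogeneousLocalization.fromZeroRingHom]
    rfl
  simp [awayLift, this]

/-- On the chart of `s`, the locus of `t` is where `t ^ d / s ^ e` is invertible; its image differs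
from `g t ^ d` by the unit `g s ^ e`. -/
lemma projMap_preimage_basicOpen (g : MvPolynomial (Fin (n + 1)) k →+* T)
    {s t : MvPolynomial (Fin (n + 1)) k} {d e : ℕ}
    (hd : s ∈ homogeneousSubmodule (Fin (n + 1)) k d) (hd0 : 0 < d) (hs : IsUnit (g s))
    (he : t ∈ homogeneousSubmodule (Fin (n + 1)) k e) (he0 : 0 < e) :
    projMap g hd hd0 hs ⁻¹ᵁ Proj.basicOpen (homogeneousSubmodule (Fin (n + 1)) k) t =
      PrimeSpectrum.basicOpen (g t) := by
  rw [projMap, Scheme.Hom.comp_preimage, Proj.awayι_preimage_basicOpen _ hd hd0 he he0]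
  have h := awayLift_mk g hs hd e (t ^ d) (by
    simpa [mul_comm, smul_eq_mul] using SetLike.pow_mem_graded d he)
  have h2 : PrimeSpectrum.basicOpen (g t) = PrimeSpectrum.basicOpen
      (awayLift g s hs (HomogeneousLocalization.Away.isLocalizationElem hd he)) := by
    rw [← PrimeSpectrum.basicOpen_pow (g t) d hd0, ← map_pow, ← h, PrimeSpectrum.basicOpen_mul]
    have : PrimeSpectrum.basicOpen (g s ^ e) = ⊤ :=
      eq_top_iff.mpr fun x _ h ↦ x.2.ne_top (Ideal.eq_top_of_isUnit_mem _ h (hs.pow e))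
    rw [this, inf_top_eq]
  rw [h2]
  rfl

end ProjMap

end SingularCurve

end

noncomputable section

namespace SingularCurve

/-! ### Schemes covered by two opens -/

section TwoCover

open Limits

/-- The open cover of a scheme by the ranges of two open immersions. -/
def pairCover {X U V : Scheme.{u}} (a : U ⟶ X) (b : V ⟶ X) [ha : IsOpenImmersion a]
    [hb : IsOpenImmersion b] (h : a.opensRange ⊔ b.opensRange = ⊤) : X.OpenCover :=
  Scheme.Cover.mkOfCovers (P := @IsOpenImmersion) Bool (fun i ↦ cond i V U)
    (fun i ↦ match i with | true => b | false => a)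
    (fun x ↦ by
      have hx : x ∈ a.opensRange ⊔ b.opensRange := h ▸ trivial
      rcases hx with ⟨y, hy⟩ | ⟨y, hy⟩
      · exact ⟨false, y, hy⟩
      · exact ⟨true, y, hy⟩)
    (fun i ↦ match i with | true => hb | false => ha)

lemma hom_ext_of_pair {X U V Y : Scheme.{u}} (a : U ⟶ X) (b : V ⟶ X) [IsOpenImmersion a]
    [IsOpenImmersion b] (h : a.opensRange ⊔ b.opensRange = ⊤) {f g : X ⟶ Y}
    (ha : a ≫ f = a ≫ g) (hb : b ≫ f = b ≫ g) : f = g :=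
  (pairCover a b h).hom_ext f g fun i ↦ match i with | true => hb | false => ha

lemma exists_glue_of_pair {X U V W Y : Scheme.{u}} (a : U ⟶ X) (b : V ⟶ X) [IsOpenImmersion a]
    [IsOpenImmersion b] (h : a.opensRange ⊔ b.opensRange = ⊤) {p : W ⟶ U} {q : W ⟶ V}
    (hpq : IsPullback p q a b) (f : U ⟶ Y) (g : V ⟶ Y) (hfg : p ≫ f = q ≫ g) :
    ∃ φ : X ⟶ Y, a ≫ φ = f ∧ b ≫ φ = g := by
  let F : ∀ i, (pairCover a b h).X i ⟶ Y := fun i ↦ match i with | true => g | false => f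
  have key : pullback.fst a b ≫ f = pullback.snd a b ≫ g := by
    rw [← cancel_epi hpq.isoPullback.hom]
    simpa using hfg
  -- On the diagonal the two projections agree because open immersions are monomorphisms; off it the
  -- condition is `hfg` or its mirror image.
  have hF : ∀ i j, pullback.fst ((pairCover a b h).f i) ((pairCover a b h).f j) ≫ F i =
      pullback.snd _ _ ≫ F j := by
    intro i j
    match i, j with
    | true, true => 
      exact congrArg (· ≫ g) ((cancel_mono b).mp (pullback.condition (f := b) (g := b)))
    | false, false =>
      exact congrArg (· ≫ f) ((cancel_mono a).mp (pullback.condition (f := a) (g := a)))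
    | false, true => exact key
    | true, false =>
      change pullback.fst b a ≫ g = pullback.snd b a ≫ f
      rw [← cancel_epi (pullbackSymmetry a b).hom]
      simpa using key.symm
  exact ⟨(pairCover a b h).glueMorphisms F hF,
    (pairCover a b h).ι_glueMorphisms F hF false, (pairCover a b h).ι_glueMorphisms F hF true⟩

end TwoCover

/-! ### The two standard charts of the projective line -/

section Charts

attribute [local instance] MvPolynomial.gradedAlgebra

open MvPolynomial (homogeneousSubmodule)

variable (k : Type u) [Field k]

lemma aeval_mul_left_of_mem_homogeneousSubmodule {k : Type u} [Field k] {σ : Type*} {T : Type*}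
    [CommRing T] [Algebra k T] (c : T) (v : σ → T) {d : ℕ} {a : MvPolynomial σ k}
    (ha : a ∈ homogeneousSubmodule σ k d) :
    MvPolynomial.aeval (fun i ↦ c * v i) a = c ^ d * MvPolynomial.aeval v a := by
  rw [MvPolynomial.aeval_def, MvPolynomial.aeval_def, MvPolynomial.eval₂_eq, MvPolynomial.eval₂_eq,
    Finset.mul_sum]
  refine Finset.sum_congr rfl fun m hm ↦ ?_
  have hdeg : m.sum (fun _ e ↦ e) = d := by
    have := (MvPolynomial.mem_homogeneousSubmodule _ _).mp ha (MvPolynomial.mem_support_iff.mp hm)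
    simpa [Finsupp.weight_apply, Finsupp.sum] using this
  simp only [mul_pow, Finset.prod_mul_distrib, Finset.prod_pow_eq_pow_sum]
  rw [← hdeg, Finsupp.sum]
  ring

/-- Injectivity: substituting `X_j / X_i` for `x` in the dehomogenization of a form `a` of degree
`m` returns `a / X_i ^ m`, so a form with zero dehomogenization is zero. Surjectivity: the constants
and `x` are attained. Indexing by `i ≠ j` treats both charts at once. -/
lemma bijective_awayLift {v : Fin (1 + 1) → k[X]} {i j : Fin (1 + 1)} (hij : i ≠ j) (hi : v i = 1)
    (hj : v j = X) (hs) :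
    Function.Bijective (awayLift (MvPolynomial.aeval v : _ →ₐ[k] k[X]).toRingHom
      (MvPolynomial.X i) hs) := by
  have hX : ∀ l : Fin (1 + 1), MvPolynomial.X l ∈ homogeneousSubmodule (Fin (1 + 1)) k 1 :=
    fun l ↦ (MvPolynomial.mem_homogeneousSubmodule _ _).2 (MvPolynomial.isHomogeneous_X k l)
  have hsurj : ∀ l, l = i ∨ l = j := by
    intro l
    fin_cases l <;> fin_cases i <;> fin_cases j <;> simp_all
  constructor
  · rw [injective_iff_map_eq_zero]
    intro z hz
    obtain ⟨m, a, ha, rfl⟩ := HomogeneousLocalization.Away.mk_surjective _ (hX i) z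
    have h := awayLift_mk (MvPolynomial.aeval v : _ →ₐ[k] k[X]).toRingHom hs (hX i) m a ha
    rw [hz, zero_mul] at h
    let L := Localization.Away (MvPolynomial.X i : MvPolynomial (Fin (1 + 1)) k)
    let u : L := IsLocalization.Away.invSelf (MvPolynomial.X i : MvPolynomial (Fin (1 + 1)) k)
    have hu : u * algebraMap (MvPolynomial (Fin (1 + 1)) k) L (MvPolynomial.X i) = 1 := by
      rw [mul_comm]; exact IsLocalization.Away.mul_invSelf _
    let ρ : k[X] →ₐ[k] L := Polynomial.aeval
      (u * algebraMap (MvPolynomial (Fin (1 + 1)) k) L (MvPolynomial.X j))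
    have h1 : ρ (MvPolynomial.aeval v a) =
        u ^ (m • 1) * algebraMap (MvPolynomial (Fin (1 + 1)) k) L a := by
      have e1 : ρ (MvPolynomial.aeval v a) =
          MvPolynomial.aeval (fun l ↦ u * algebraMap (MvPolynomial (Fin (1 + 1)) k) L
            (MvPolynomial.X l)) a := by
        rw [← AlgHom.comp_apply]
        congr 1
        ext l
        rcases hsurj l with rfl | rfl
        · simp [hi, hu]
        · simp [hj, ρ]
      rw [e1, aeval_mul_left_of_mem_homogeneousSubmodule u _ ha]
      congr 1
      have : (MvPolynomial.aeval (fun l ↦ algebraMap (MvPolynomial (Fin (1 + 1)) k) L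
          (MvPolynomial.X l)) : MvPolynomial (Fin (1 + 1)) k →ₐ[k] L) = IsScalarTower.toAlgHom k (MvPolynomial (Fin (1 + 1)) k) L := by
        ext l; simp
      rw [this]; rfl
    have h2 : (MvPolynomial.aeval v a : k[X]) = 0 := h.symm
    rw [h2, map_zero] at h1
    have hu' : IsUnit u := IsUnit.of_mul_eq_one _ hu
    have h3 := ((hu'.pow (m • 1)).mul_right_eq_zero).mp h1.symm
    have h4 : a = 0 := by
      refine (map_eq_zero_iff _ (IsLocalization.injective (M := Submonoid.powers
        (MvPolynomial.X i : MvPolynomial (Fin (1 + 1)) k)) L ?_)).mp h3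
      exact powers_le_nonZeroDivisors_of_noZeroDivisors (MvPolynomial.X_ne_zero i)
    subst h4
    apply HomogeneousLocalization.val_injective
    simp [Localization.mk_zero]
  · intro p
    rw [← RingHom.mem_range]
    induction p using Polynomial.induction_on' with
    | add p q hp hq => exact add_mem hp hq
    | monomial m c =>
      rw [← Polynomial.C_mul_X_pow_eq_monomial]
      refine mul_mem ?_ (pow_mem ?_ m)
      · refine ⟨HomogeneousLocalization.Away.mk _ (hX i) 0 (MvPolynomial.C c) (by simp), ?_⟩
        · have h := awayLift_mk (MvPolynomial.aeval v : _ →ₐ[k] k[X]).toRingHom hs (hX i) 0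
            (MvPolynomial.C c) (by simp)
          simpa using h
      · refine ⟨HomogeneousLocalization.Away.mk _ (hX i) 1 (MvPolynomial.X j) (by simpa using hX j),
          ?_⟩
        have h := awayLift_mk (MvPolynomial.aeval v : _ →ₐ[k] k[X]).toRingHom hs (hX i) 1
            (MvPolynomial.X j) (by simpa using hX j)
        simpa [hi, hj] using h

lemma X_mem_homogeneousSubmodule {σ : Type*} (l : σ) :
    (MvPolynomial.X l : MvPolynomial σ k) ∈ homogeneousSubmodule σ k 1 :=
  (MvPolynomial.mem_homogeneousSubmodule _ _).2 (MvPolynomial.isHomogeneous_X k l)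

/-- Dehomogenization `k[X₀, X₁] → k[x]`, `X₀ ↦ x`, `X₁ ↦ 1`. -/
def dehomogenizeInf : MvPolynomial (Fin (1 + 1)) k →+* k[X] :=
  (MvPolynomial.aeval ![(X : k[X]), 1]).toRingHom

lemma isUnit_dehomogenize_X_zero : IsUnit (dehomogenize k (MvPolynomial.X 0)) := by
  simp [dehomogenize]

lemma isUnit_dehomogenizeInf_X_one : IsUnit (dehomogenizeInf k (MvPolynomial.X 1)) := by
  simp [dehomogenizeInf]

/-- The standard open immersion `Spec k[x] → ℙ¹`, `x = X₀ / X₁`. -/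
def infChart : Spec (.of k[X]) ⟶ projSpace k 1 :=
  projMap (dehomogenizeInf k) (X_mem_homogeneousSubmodule k 1) one_pos
    (isUnit_dehomogenizeInf_X_one k)

lemma affineChart_eq_projMap : affineChart k = projMap (dehomogenize k)
    (X_mem_homogeneousSubmodule k 0) one_pos (isUnit_dehomogenize_X_zero k) := rfl

lemma isIso_SpecMap_of_bijective {R S : Type u} [CommRing R] [CommRing S] (f : R →+* S)
    (hf : Function.Bijective f) : IsIso (Spec.map (CommRingCat.ofHom f)) := by
  have : IsIso (CommRingCat.ofHom f) := (ConcreteCategory.isIso_iff_bijective _).mpr hf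
  infer_instance

instance isIso_SpecMap_awayLift_dehomogenize : IsIso (Spec.map (CommRingCat.ofHom
    (awayLift (dehomogenize k) (MvPolynomial.X 0) (isUnit_dehomogenize_X_zero k)))) :=
  isIso_SpecMap_of_bijective _ (bijective_awayLift k (v := ![1, X]) (i := 0) (j := 1)
    (by decide) rfl rfl (isUnit_dehomogenize_X_zero k))

instance isIso_SpecMap_awayLift_dehomogenizeInf : IsIso (Spec.map (CommRingCat.ofHom
    (awayLift (dehomogenizeInf k) (MvPolynomial.X 1) (isUnit_dehomogenizeInf_X_one k)))) :=
  isIso_SpecMap_of_bijective _ (bijective_awayLift k (v := ![X, 1]) (i := 1) (j := 0)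
    (by decide) rfl rfl (isUnit_dehomogenizeInf_X_one k))

instance isOpenImmersion_affineChart : IsOpenImmersion (affineChart k) := by
  rw [affineChart_eq_projMap, projMap]
  exact IsOpenImmersion.comp _ _

instance isOpenImmersion_infChart : IsOpenImmersion (infChart k) := by
  rw [infChart, projMap]
  exact IsOpenImmersion.comp _ _

lemma opensRange_affineChart : (affineChart k).opensRange =
    Proj.basicOpen (homogeneousSubmodule (Fin (1 + 1)) k) (MvPolynomial.X 0) := by
  simp only [affineChart_eq_projMap, projMap]
  exact (Scheme.Hom.opensRange_comp_of_isIso _ _).trans (Proj.opensRange_awayι ..)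

lemma opensRange_infChart : (infChart k).opensRange =
    Proj.basicOpen (homogeneousSubmodule (Fin (1 + 1)) k) (MvPolynomial.X 1) := by
  simp only [infChart, projMap]
  exact (Scheme.Hom.opensRange_comp_of_isIso _ _).trans (Proj.opensRange_awayι ..)

lemma opensRange_affineChart_sup_infChart :
    (affineChart k).opensRange ⊔ (infChart k).opensRange = ⊤ := by
  rw [opensRange_affineChart, opensRange_infChart]
  have h := Proj.iSup_basicOpen_eq_top' (homogeneousSubmodule (Fin (1 + 1)) k)
    (fun i : Fin (1 + 1) ↦ (MvPolynomial.X i : MvPolynomial (Fin (1 + 1)) k))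
    (fun i ↦ ⟨1, X_mem_homogeneousSubmodule k i⟩) (by
      rw [eq_top_iff]
      rintro p -
      induction p using MvPolynomial.induction_on with
      | C a => exact Subalgebra.algebraMap_mem _ (⟨MvPolynomial.C a, by simp⟩ :
          homogeneousSubmodule (Fin (1 + 1)) k 0)
      | add p q hp hq => exact add_mem hp hq
      | mul_X p i hp => exact mul_mem hp (Algebra.subset_adjoin ⟨i, rfl⟩))
  rw [← h]
  refine le_antisymm (sup_le (le_iSup_of_le 0 le_rfl) (le_iSup_of_le 1 le_rfl))
    (iSup_le fun i ↦ ?_)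
  fin_cases i
  · exact le_sup_left
  · exact le_sup_right

/-- The coordinate change `k[y] → k[x, x⁻¹]`, `y ↦ x⁻¹`. -/
def invCoord : k[X] →ₐ[k] Localization.Away (X : k[X]) :=
  Polynomial.aeval (IsLocalization.Away.invSelf (X : k[X]))

lemma isPullback_charts : IsPullback (Spec.map (CommRingCat.ofHom (invCoord k).toRingHom))
    (Spec.map (CommRingCat.ofHom (algebraMap k[X] (Localization.Away (X : k[X])))))
    (infChart k) (affineChart k) := by
  refine IsOpenImmersion.isPullback _ _ _ _ ?_ ?_
  · rw [affineChart_eq_projMap, infChart, SpecMap_comp_projMap, SpecMap_comp_projMap]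
    have hinv : algebraMap k[X] (Localization.Away (X : k[X])) X *
      IsLocalization.Away.invSelf (X : k[X]) = 1 := IsLocalization.Away.mul_invSelf _
    -- On the overlap the coordinates satisfy `(x⁻¹, 1) = x⁻¹ • (1, x)`.
    refine projMap_eq_of_scale _ _ (c := IsLocalization.Away.invSelf (X : k[X])) ?_ 
      (IsUnit.of_mul_eq_one_right _ hinv) _ _ _ _ _ _
    intro d a ha
    have e1 : (invCoord k).toRingHom.comp (dehomogenizeInf k) = (MvPolynomial.aeval fun i ↦
        IsLocalization.Away.invSelf (X : k[X]) *
          algebraMap k[X] (Localization.Away (X : k[X])) (![1, X] i)).toRingHom := by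
      ext i
      · simp [dehomogenizeInf, invCoord]
      · fin_cases i
        · simp [dehomogenizeInf, invCoord]
        · simp [dehomogenizeInf, invCoord, mul_comm _ (algebraMap _ _ _), hinv]
    have e2 : (algebraMap k[X] (Localization.Away (X : k[X]))).comp (dehomogenize k) =
        (MvPolynomial.aeval fun i ↦
          algebraMap k[X] (Localization.Away (X : k[X])) (![1, X] i)).toRingHom := by
      ext i
      · simp [dehomogenize]
        rfl
      · fin_cases i <;> simp [dehomogenize]
    rw [e1, e2]
    exact aeval_mul_left_of_mem_homogeneousSubmodule _ _ ha
  · rw [opensRange_infChart, affineChart_eq_projMap,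
      projMap_preimage_basicOpen _ _ _ _ (X_mem_homogeneousSubmodule k 1) one_pos]
    have h : dehomogenize k (MvPolynomial.X 1) = X := by simp [dehomogenize]
    rw [h]
    exact TopologicalSpace.Opens.ext (PrimeSpectrum.localization_away_comap_range
      (Localization.Away (X : k[X])) (X : k[X])).symm

end Charts

end SingularCurve

end

noncomputable section

namespace SingularCurve

/-! ### Morphisms from the projective line to projective space -/

section LineMap

attribute [local instance] MvPolynomial.gradedAlgebra

variable {k : Type u} [Field k]

lemma algebraMap_X_mul_invSelf : algebraMap k[X] (Localization.Away (X : k[X])) X *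
    IsLocalization.Away.invSelf (X : k[X]) = 1 :=
  IsLocalization.Away.mul_invSelf _

/-- With `y = x⁻¹`, reflection in degree `D` is homogenization in degree `D` followed by
dehomogenization at infinity; `x ^ (-D)` is the transition factor. -/
lemma invCoord_reflect {D : ℕ} {p : k[X]} (hp : p.natDegree ≤ D) :
    invCoord k (p.reflect D) = IsLocalization.Away.invSelf (X : k[X]) ^ D *
      algebraMap k[X] (Localization.Away (X : k[X])) p := by
  let : Invertible (algebraMap k[X] (Localization.Away (X : k[X])) X) :=
    ⟨IsLocalization.Away.invSelf (X : k[X]), by rw [mul_comm, algebraMap_X_mul_invSelf],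
      algebraMap_X_mul_invSelf⟩
  have h := Polynomial.eval₂_reflect_mul_pow (algebraMap k (Localization.Away (X : k[X])))
    (algebraMap k[X] (Localization.Away (X : k[X])) X) D p hp
  have h1 : p.eval₂ (algebraMap k (Localization.Away (X : k[X])))
      (algebraMap k[X] (Localization.Away (X : k[X])) X) = algebraMap k[X] _ p := by
    rw [← Polynomial.aeval_def, Polynomial.aeval_algebraMap_apply, Polynomial.aeval_X_left_apply]
  have h2 : (p.reflect D).eval₂ (algebraMap k (Localization.Away (X : k[X])))
      (⅟(algebraMap k[X] (Localization.Away (X : k[X])) X)) = invCoord k (p.reflect D) := rfl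
  rw [h1, h2] at h
  rw [← h, mul_comm, mul_assoc, ← mul_pow, algebraMap_X_mul_invSelf, one_pow, mul_one]

/-- The open immersion `Spec k[y][1 / h] → ℙ¹`, `y = X₀ / X₁`. -/
def infChartAway (h : k[X]) : Spec (.of (Localization.Away h)) ⟶ projSpace k 1 :=
  Spec.map (CommRingCat.ofHom (algebraMap k[X] (Localization.Away h))) ≫ infChart k

instance isOpenImmersion_infChartAway (h : k[X]) : IsOpenImmersion (infChartAway h) :=
  IsOpenImmersion.comp _ _

/-- The only point missed by the affine chart is `y = 0`, where `h` is `1`. Algebraically, `1 = h -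
y * h.divX`, so `h` and `y` have no common zero. -/
lemma opensRange_affineChart_sup_infChartAway {h : k[X]} (h0 : h.coeff 0 = 1) :
    (affineChart k).opensRange ⊔ (infChartAway h).opensRange = ⊤ := by
  rw [eq_top_iff, ← opensRange_affineChart_sup_infChart]
  refine sup_le le_sup_left ?_
  rintro _ ⟨w, rfl⟩
  by_cases hw : w ∈ PrimeSpectrum.basicOpen h
  · rw [← Scheme.Hom.opensRange_localizationAway (R := .of k[X]) h] at hw
    obtain ⟨w', rfl⟩ := hw
    exact Or.inr ⟨w', rfl⟩
  · refine Or.inl ?_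
    have hX : w ∈ PrimeSpectrum.basicOpen (X : k[X]) := by
      have hw' : h ∈ w.asIdeal := not_not.mp hw
      intro hX
      refine w.2.ne_top ((Ideal.eq_top_iff_one _).mpr ?_)
      have h1 : (1 : k[X]) = h - X * h.divX := by
        have := Polynomial.X_mul_divX_add h
        rw [h0, map_one] at this
        rw [eq_sub_iff_add_eq, add_comm, this]
      rw [h1]
      exact sub_mem hw' (Ideal.mul_mem_right _ _ hX)
    have h2 := projMap_preimage_basicOpen (dehomogenizeInf k) (X_mem_homogeneousSubmodule k 1)
      one_pos (isUnit_dehomogenizeInf_X_one k) (X_mem_homogeneousSubmodule k 0) one_pos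
    have h3 : dehomogenizeInf k (MvPolynomial.X 0) = X := by simp [dehomogenizeInf]
    rw [h3, ← opensRange_affineChart] at h2
    exact h2.ge hX

lemma isPullback_infChartAway (h : k[X]) :
    IsPullback (Spec.map (CommRingCat.ofHom (IsLocalization.Away.map (Localization.Away h)
        (Localization.Away (invCoord k h)) (invCoord k).toRingHom h)))
      (Spec.map (CommRingCat.ofHom (algebraMap (Localization.Away (X : k[X]))
        (Localization.Away (invCoord k h)))) ≫
          Spec.map (CommRingCat.ofHom (algebraMap k[X] (Localization.Away (X : k[X])))))
      (infChartAway h) (affineChart k) := by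
  refine IsPullback.paste_vert (h₂₁ := Spec.map (CommRingCat.ofHom (invCoord k).toRingHom))
    ?_ (isPullback_charts k)
  refine IsOpenImmersion.isPullback _ _ _ _ ?_ ?_
  · rw [← Spec.map_comp, ← Spec.map_comp, ← CommRingCat.ofHom_comp, ← CommRingCat.ofHom_comp]
    congr 2
    ext x <;> simp [IsLocalization.Away.map]
  · rw [Scheme.Hom.opensRange_localizationAway (R := .of k[X]) h,
      Scheme.Hom.opensRange_localizationAway (R := .of (Localization.Away (X : k[X])))]
    rfl

open MvPolynomial (homogeneousSubmodule)

/-- Polynomials `p₀, …, pₙ` of degree at most `D`, one of which is `1`, define a morphism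
`ℙ¹ → ℙⁿ`, provided that they have no common zero at infinity. -/
lemma exists_lineMap {n D : ℕ} {p : Fin (n + 1) → k[X]} (hp : ∀ i, (p i).natDegree ≤ D)
    {h : k[X]} (h0 : h.coeff 0 = 1) (i₀ i₁ : Fin (n + 1))
    (hi₀ : IsUnit ((MvPolynomial.aeval p : _ →ₐ[k] k[X]).toRingHom (MvPolynomial.X i₀)))
    (hi₁ : IsUnit ((MvPolynomial.aeval (fun i ↦
      algebraMap k[X] (Localization.Away h) ((p i).reflect D)) : _ →ₐ[k] _).toRingHom
        (MvPolynomial.X i₁))) :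
    ∃ φ : projSpace k 1 ⟶ projSpace k n,
      affineChart k ≫ φ = projMap _ (X_mem_homogeneousSubmodule k i₀) one_pos hi₀ ∧
      infChartAway h ≫ φ = projMap _ (X_mem_homogeneousSubmodule k i₁) one_pos hi₁ := by
  refine exists_glue_of_pair _ _ (opensRange_affineChart_sup_infChartAway h0)
    (isPullback_infChartAway h).flip _ _ ?_
  rw [← Spec.map_comp, ← CommRingCat.ofHom_comp, SpecMap_comp_projMap, SpecMap_comp_projMap]
  have hu : IsUnit (IsLocalization.Away.invSelf (X : k[X]) : Localization.Away (X : k[X])) :=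
    IsUnit.of_mul_eq_one_right _ algebraMap_X_mul_invSelf
  -- By `invCoord_reflect` the coordinates at infinity are `x ^ (-D)` times those at finite
  -- distance.
  refine projMap_eq_of_scale _ _ (c := algebraMap (Localization.Away (X : k[X]))
    (Localization.Away (invCoord k h)) (IsLocalization.Away.invSelf (X : k[X]) ^ D))
    ?_ ((hu.pow D).map _) _ _ _ _ _ _
  intro d a ha
  have e1 : (IsLocalization.Away.map (Localization.Away h) (Localization.Away (invCoord k h))
      (invCoord k).toRingHom h).comp (MvPolynomial.aeval (fun i ↦
      algebraMap k[X] (Localization.Away h) ((p i).reflect D)) : _ →ₐ[k] _).toRingHom =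
      (MvPolynomial.aeval fun i ↦ algebraMap (Localization.Away (X : k[X]))
        (Localization.Away (invCoord k h)) (IsLocalization.Away.invSelf (X : k[X]) ^ D) *
        algebraMap (Localization.Away (X : k[X])) (Localization.Away (invCoord k h))
          (algebraMap k[X] _ (p i))).toRingHom := by
    ext i
    · simp [IsLocalization.Away.map, IsScalarTower.algebraMap_apply k k[X] (Localization.Away h)]
      rw [invCoord, Polynomial.aeval_C]
      exact (IsScalarTower.algebraMap_apply k (Localization.Away (X : k[X])) _ i).symm
    · simp [IsLocalization.Away.map, invCoord_reflect (hp i)]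
  have e2 : ((algebraMap (Localization.Away (X : k[X])) (Localization.Away (invCoord k h))).comp
      (algebraMap k[X] (Localization.Away (X : k[X])))).comp
        (MvPolynomial.aeval p : _ →ₐ[k] k[X]).toRingHom =
      (MvPolynomial.aeval fun i ↦
        algebraMap (Localization.Away (X : k[X])) (Localization.Away (invCoord k h))
          (algebraMap k[X] _ (p i))).toRingHom := by
    ext i
    · simp
      rw [IsScalarTower.algebraMap_apply k (Localization.Away (X : k[X])) _ i,
        IsScalarTower.algebraMap_apply k k[X] (Localization.Away (X : k[X])) i]
      rfl
    · simp
  rw [e1, e2]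
  exact aeval_mul_left_of_mem_homogeneousSubmodule _ _ ha

end LineMap

end SingularCurve

end

noncomputable section

namespace SingularCurve

/-! ### Scheme-theoretic images -/

section Image

lemma isSchemeTheoreticallyDominant_toImage {X Y : Scheme.{u}} (φ : X ⟶ Y) [QuasiCompact φ] :
    IsSchemeTheoreticallyDominant φ.toImage := by
  refine ⟨Scheme.IdealSheafData.ext_of_iSup_eq_top
    (fun U : Y.affineOpens ↦ ⟨φ.imageι ⁻¹ᵁ U.1, U.2.preimage _⟩)
    (TopologicalSpace.IsOpenCover.comap (iSup_affineOpens_eq_top _) _) fun U ↦ ?_⟩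
  simp only [Scheme.Hom.ker_apply, Scheme.IdealSheafData.ideal_bot, Pi.bot_apply]
  exact (RingHom.injective_iff_ker_eq_bot _).mp (φ.toImage_app_injective U)

lemma irreducibleSpace_of_isDominant {X Y : Scheme.{u}} (f : X ⟶ Y) [IsDominant f]
    [IrreducibleSpace X] : IrreducibleSpace Y := by
  rw [irreducibleSpace_def]
  convert ((IrreducibleSpace.isIrreducible_univ X).image _ f.continuous.continuousOn).closure
  simpa using f.denseRange.closure_range.symm

lemma isIntegral_of_isSchemeTheoreticallyDominant {X Y : Scheme.{u}} (f : X ⟶ Y)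
    [IsSchemeTheoreticallyDominant f] [QuasiCompact f] [IsIntegral X] : IsIntegral Y := by
  have := irreducibleSpace_of_isDominant f
  have := IsSchemeTheoreticallyDominant.isReduced f
  exact isIntegral_of_irreducibleSpace_of_isReduced Y

lemma isSchemeTheoreticallyDominant_SpecMap {R S : Type u} [CommRing R] [CommRing S] (f : R →+* S)
    (hf : Function.Injective f) :
    IsSchemeTheoreticallyDominant (Spec.map (CommRingCat.ofHom f)) := by
  refine ⟨Scheme.IdealSheafData.ext_of_isAffine ?_⟩
  rw [Scheme.Hom.ker_apply, Scheme.IdealSheafData.ideal_bot, Pi.bot_apply,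
    ← RingHom.injective_iff_ker_eq_bot]
  have h := Scheme.ΓSpecIso_naturality (CommRingCat.ofHom f)
  intro a a' ha
  have hR := (ConcreteCategory.bijective_of_isIso (Scheme.ΓSpecIso (.of R)).hom).1
  refine hR (hf ?_)
  have e := fun a ↦ congrArg (fun φ ↦ φ.hom a) h
  simp only [CommRingCat.hom_comp, RingHom.comp_apply, CommRingCat.hom_ofHom] at e
  exact ((e a).symm.trans (congrArg (Scheme.ΓSpecIso (.of S)).hom.hom ha)).trans (e a')

/-- Over an affine open `Spec A` of `P` whose preimage in `X` is `Spec R`, the scheme-theoretic image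
of `X` is the spectrum of the image of `A` in `R`. -/
lemma exists_imageChart {X P : Scheme.{u}} (φ : X ⟶ P) [QuasiCompact φ] [IsIntegral X]
    {A B R : Type u} [CommRing A] [CommRing B] [CommRing R] (w : Spec (.of A) ⟶ P)
    [IsOpenImmersion w] (ρ : Spec (.of R) ⟶ X) [IsOpenImmersion ρ] (θ : A →+* B)
    (hθ : Function.Surjective θ) (j : B →+* R) (hj : Function.Injective j)
    (h : ρ ≫ φ = Spec.map (CommRingCat.ofHom j) ≫ Spec.map (CommRingCat.ofHom θ) ≫ w)
    (hr : φ ⁻¹ᵁ w.opensRange = ρ.opensRange) :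
    ∃ (b : Spec (.of B) ⟶ φ.image) (_ : IsOpenImmersion b),
      b ≫ φ.imageι = Spec.map (CommRingCat.ofHom θ) ≫ w ∧
      b.opensRange = φ.imageι ⁻¹ᵁ w.opensRange ∧
      IsPullback (Spec.map (CommRingCat.ofHom j)) ρ b φ.toImage := by
  have := isSchemeTheoreticallyDominant_toImage φ
  have := isIntegral_of_isSchemeTheoreticallyDominant φ.toImage
  have hdom := isSchemeTheoreticallyDominant_SpecMap j hj
  have hcl : IsClosedImmersion (Spec.map (CommRingCat.ofHom θ)) :=
    IsClosedImmersion.spec_of_surjective _ hθ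
  set g := Spec.map (CommRingCat.ofHom θ) ≫ w with hg
  -- Since `j` is injective, `Spec j` is scheme-theoretically dominant, so `g` has the same kernel
  -- as `ρ ≫ φ` and factors through the image.
  have hker : φ.imageι.ker ≤ g.ker := by
    rw [Scheme.IdealSheafData.ker_subschemeι]
    refine (ρ.le_ker_comp φ).trans ?_
    rw [h, Scheme.Hom.ker_comp, hdom.ker_eq_bot, Scheme.IdealSheafData.map_bot]
  let b := IsClosedImmersion.lift φ.imageι g hker
  have hb : b ≫ φ.imageι = g := IsClosedImmersion.lift_fac _ _ _
  have hjb : Spec.map (CommRingCat.ofHom j) ≫ b = ρ ≫ φ.toImage := by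
    rw [← cancel_mono φ.imageι, Category.assoc, hb, Category.assoc, Scheme.Hom.toImage_imageι, h]
  let Z := Limits.pullback φ.imageι w
  let b' : Spec (.of B) ⟶ Z := Limits.pullback.lift b (Spec.map (CommRingCat.ofHom θ)) hb
  have hb'1 : b' ≫ Limits.pullback.fst φ.imageι w = b := Limits.pullback.lift_fst _ _ _
  have hb'2 : b' ≫ Limits.pullback.snd φ.imageι w = Spec.map (CommRingCat.ofHom θ) :=
    Limits.pullback.lift_snd _ _ _
  have hb'cl : IsClosedImmersion b' := by
    have : IsClosedImmersion (b' ≫ Limits.pullback.snd φ.imageι w) := by rw [hb'2]; exact hcl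
    exact IsClosedImmersion.of_comp b' (Limits.pullback.snd φ.imageι w)
  have hZred : IsReduced Z := isReduced_of_isOpenImmersion (Limits.pullback.fst φ.imageι w)
  have hrange : (Limits.pullback.fst φ.imageι w).opensRange = φ.imageι ⁻¹ᵁ w.opensRange := by
    exact Scheme.Hom.opensRange_pullbackFst ..
  -- `b'` has closed range, and the range is dense: a point of `X` mapping into this part of the
  -- image lies in `ρ` by `hr`, hence comes from `Spec R` and maps through `Spec B`.
  have hsurj : Surjective b' := by
    refine ⟨?_⟩
    rw [← Set.range_eq_univ, ← b'.isClosedEmbedding.isClosed_range.closure_eq, 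
      Set.eq_univ_iff_forall]
    intro z
    rw [mem_closure_iff]
    intro o ho hz
    have ho' := (Limits.pullback.fst φ.imageι w).isOpenEmbedding.isOpenMap o ho
    obtain ⟨_, ⟨z', hz'o, hz'⟩, x, rfl⟩ := φ.toImage.denseRange.inter_open_nonempty _ ho'
      ⟨_, z, hz, rfl⟩
    have hx : x ∈ φ ⁻¹ᵁ w.opensRange := by
      have : (Limits.pullback.fst φ.imageι w) z' ∈ φ.imageι ⁻¹ᵁ w.opensRange :=
        hrange ▸ ⟨z', rfl⟩
      rw [hz'] at this
      rw [← Scheme.Hom.toImage_imageι φ, Scheme.Hom.comp_preimage]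
      exact this
    rw [hr] at hx
    obtain ⟨r, rfl⟩ := hx
    refine ⟨z', hz'o, Spec.map (CommRingCat.ofHom j) r, ?_⟩
    apply (Limits.pullback.fst φ.imageι w).isOpenEmbedding.injective
    rw [hz', ← Scheme.Hom.comp_apply, ← Scheme.Hom.comp_apply, ← Scheme.Hom.comp_apply, hb'1, hjb]
  -- A surjective closed immersion onto a reduced scheme is an isomorphism.
  have hiso : IsIso b' := isIso_of_isClosedImmersion_of_surjective b'
  have hopen : IsOpenImmersion b := by rw [← hb'1]; infer_instance
  have hbr : b.opensRange = φ.imageι ⁻¹ᵁ w.opensRange := by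
    rw [← hrange, ← Scheme.Hom.opensRange_comp_of_isIso b']
    simp only [hb'1]
  refine ⟨b, hopen, hb, hbr, IsOpenImmersion.isPullback _ _ _ _ hjb.symm ?_⟩
  rw [hbr, ← hr, ← Scheme.Hom.comp_preimage, Scheme.Hom.toImage_imageι]

end Image

end SingularCurve

end

noncomputable section

namespace SingularCurve

/-! ### Properness of projective space -/

section Proper

attribute [local instance] MvPolynomial.gradedAlgebra

open MvPolynomial (homogeneousSubmodule)

variable (k : Type u) [Field k]

lemma surjective_algebraMap_homogeneousSubmodule_zero (n : ℕ) :
    Function.Surjective (algebraMap k (homogeneousSubmodule (Fin (n + 1)) k 0)) := by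
  rintro ⟨a, ha⟩
  rw [MvPolynomial.homogeneousSubmodule_zero, Submodule.mem_one] at ha
  obtain ⟨c, rfl⟩ := ha
  exact ⟨c, rfl⟩

instance isClosedImmersion_SpecMap_algebraMap_zero (n : ℕ) : IsClosedImmersion
    (Spec.map (CommRingCat.ofHom (algebraMap k (homogeneousSubmodule (Fin (n + 1)) k 0)))) :=
  IsClosedImmersion.spec_of_surjective _ (surjective_algebraMap_homogeneousSubmodule_zero k n)

instance isProper_projSpaceStr (n : ℕ) : IsProper (projSpaceStr k n) := by
  have : Algebra.FiniteType (homogeneousSubmodule (Fin (n + 1)) k 0)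
      (MvPolynomial (Fin (n + 1)) k) := by
    have : IsScalarTower k (homogeneousSubmodule (Fin (n + 1)) k 0)
      (MvPolynomial (Fin (n + 1)) k) :=
      ⟨fun a b c ↦ smul_mul_assoc a (b : MvPolynomial (Fin (n + 1)) k) c⟩
    exact Algebra.FiniteType.of_restrictScalars_finiteType k _ _
  rw [projSpaceStr]
  infer_instance

lemma IsProjective.isProper {C : Scheme.{u}} {f : C ⟶ Spec (.of k)} (hf : IsProjective f) :
    IsProper f := by
  obtain ⟨n, j, hj, rfl⟩ := hf
  infer_instance

/-- `π` is proper, since `ℙ¹` is proper and `f` separated, so its dense image is closed. -/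
lemma surjective_of_projLine {C : Scheme.{u}} {f : C ⟶ Spec (.of k)} [IsProper f]
    {π : projSpace k 1 ⟶ C} [IsDominant π] (h : π ≫ f = projSpaceStr k 1) : Surjective π := by
  have : IsProper (π ≫ f) := h ▸ inferInstance
  have : IsProper π := IsProper.of_comp π f
  refine ⟨?_⟩
  rw [← Set.range_eq_univ, ← π.denseRange.closure_range]
  exact (π.isClosedMap.isClosed_range.closure_eq).symm

end Proper

/-! ### The curve attached to a subalgebra of `k[x]` containing a nonzero ideal -/

section Construction

attribute [local instance] MvPolynomial.gradedAlgebra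

open MvPolynomial (homogeneousSubmodule)

variable {k : Type u} [Field k]

lemma opens_eq_of_pair {X U V : Scheme.{u}} (a : U ⟶ X) (b : V ⟶ X) [IsOpenImmersion a]
    [IsOpenImmersion b] (h : a.opensRange ⊔ b.opensRange = ⊤) {W W' : X.Opens}
    (ha : a ⁻¹ᵁ W = a ⁻¹ᵁ W') (hb : b ⁻¹ᵁ W = b ⁻¹ᵁ W') : W = W' := by
  ext x
  have hx : x ∈ a.opensRange ⊔ b.opensRange := h ▸ trivial
  rcases hx with ⟨y, rfl⟩ | ⟨y, rfl⟩
  · exact SetLike.ext_iff.mp ha y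
  · exact SetLike.ext_iff.mp hb y

lemma preimage_opensRange_self {X U : Scheme.{u}} (a : U ⟶ X) [IsOpenImmersion a] :
    a ⁻¹ᵁ a.opensRange = ⊤ := by
  ext x
  exact ⟨fun _ ↦ trivial, fun _ ↦ ⟨x, rfl⟩⟩

lemma C_mem_range_awayLift {n : ℕ} {T : Type u} [CommRing T]
    (g : MvPolynomial (Fin (n + 1)) k →+* T) (i : Fin (n + 1))
    (hi : IsUnit (g (MvPolynomial.X i))) (c : k) :
    g (MvPolynomial.C c) ∈ (awayLift g (MvPolynomial.X i) hi).range := by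
  have h := awayLift_mk g hi (X_mem_homogeneousSubmodule k i) 0 (MvPolynomial.C c) (by simp)
  rw [pow_zero, mul_one] at h
  exact ⟨_, h⟩

lemma X_mem_range_awayLift {n : ℕ} {T : Type u} [CommRing T]
    (g : MvPolynomial (Fin (n + 1)) k →+* T) (i j : Fin (n + 1))
    (hi : IsUnit (g (MvPolynomial.X i))) {t : T}
    (ht : t * g (MvPolynomial.X i) = g (MvPolynomial.X j)) :
    t ∈ (awayLift g (MvPolynomial.X i) hi).range := by
  have h := awayLift_mk g hi (X_mem_homogeneousSubmodule k i) 1 (MvPolynomial.X j)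
    (by simpa using X_mem_homogeneousSubmodule k j)
  rw [pow_one] at h
  exact ⟨_, hi.mul_right_cancel (h.trans ht.symm)⟩

/-- A subalgebra of `k[x]` containing the multiples of a polynomial `g` of degree `M` is generated
by its elements of degree at most `3M`. -/
lemma le_of_forall_natDegree_le {B S : Subalgebra k k[X]} {g : k[X]} (hg : g.Monic)
    (hM : 0 < g.natDegree) (hB : ∀ p, g * p ∈ B)
    (hS : ∀ p ∈ B, p.natDegree ≤ g.natDegree + g.natDegree + g.natDegree → p ∈ S) : B ≤ S := by
  have hgS : g ∈ S := hS g (by simpa using hB 1) (by omega)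
  -- Division by `g` gives `g * q = g * (q %ₘ g) + g * (g * (q /ₘ g))`. The first summand has degree
  -- below `2M`; the second is a product with `g` of a multiple of smaller degree. Generation needs
  -- no more than `2M`; the bound `3M` leaves room for the coordinate `g * g * X ^ M`.
  have key : ∀ n, ∀ q : k[X], q.natDegree ≤ n → g * q ∈ S := by
    intro n
    induction n using Nat.strong_induction_on with
    | _ n ih =>
      intro q hq
      have hmod : g * (q %ₘ g) ∈ S := by
        refine hS _ (hB _) ?_
        have h1 := Polynomial.natDegree_mul_le (p := g) (q := q %ₘ g)
        have h2 := Polynomial.natDegree_modByMonic_lt q hg (by rintro rfl; simp at hM)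
        omega
      by_cases hlt : q.natDegree < g.natDegree
      · refine hS _ (hB _) ?_
        have h1 := Polynomial.natDegree_mul_le (p := g) (q := q)
        omega
      · have hdiv := Polynomial.natDegree_divByMonic q hg
        have h1 := ih (q /ₘ g).natDegree (by omega) (q /ₘ g) le_rfl
        have h2 : g * q = g * (q %ₘ g) + g * (g * (q /ₘ g)) := by
          rw [← mul_add, Polynomial.modByMonic_add_div q g]
        rw [h2]
        exact add_mem hmod (mul_mem hgS h1)
  intro b hb
  have h1 : b %ₘ g + g * (b /ₘ g) = b := Polynomial.modByMonic_add_div b g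
  have h2 : b %ₘ g ∈ S := by
    refine hS _ ?_ ?_
    · rw [← eq_sub_iff_add_eq] at h1
      rw [h1]
      exact sub_mem hb (hB _)
    · have h2 := Polynomial.natDegree_modByMonic_lt b hg (by rintro rfl; simp at hM)
      omega
  rw [← h1]
  exact add_mem h2 (key _ _ le_rfl)

/-- The elements of degree at most `D` of a subalgebra of `k[x]` are spanned by a finite family
that contains any two prescribed elements. -/
lemma exists_spanning_family (B : Subalgebra k k[X]) (D : ℕ) {a b : k[X]} (ha : a ∈ B)
    (hb : b ∈ B) (haD : a.natDegree ≤ D) (hbD : b.natDegree ≤ D) :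
    ∃ (n : ℕ) (p : Fin (n + 1) → k[X]) (i j : Fin (n + 1)), p i = a ∧ p j = b ∧
      (∀ l, p l ∈ B ∧ (p l).natDegree ≤ D) ∧
      ∀ q ∈ B, q.natDegree ≤ D → q ∈ Submodule.span k (Set.range p) := by
  classical
  let W : Submodule k k[X] := Subalgebra.toSubmodule B ⊓ Polynomial.degreeLE k D
  have hW : ∀ q, q ∈ W ↔ q ∈ B ∧ q.natDegree ≤ D := fun q ↦ by
    rw [Submodule.mem_inf, Polynomial.mem_degreeLE, Subalgebra.mem_toSubmodule,
      Polynomial.natDegree_le_iff_degree_le]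
  have : FiniteDimensional k (Polynomial.degreeLE k D) := by
    rw [Polynomial.degreeLE_eq_span_X_pow]
    exact FiniteDimensional.span_finset k _
  have hfin : W.FG := by
    have : FiniteDimensional k W := Submodule.finiteDimensional_of_le inf_le_right
    exact Module.Finite.iff_fg.mp this
  obtain ⟨s, hs⟩ := hfin
  -- Adjoining `a` and `b` to the generators makes them coordinates; the index set is then nonempty,
  -- as needed for `Fin (n + 1)`.
  let t : Finset k[X] := insert a (insert b s)
  obtain ⟨n, hn⟩ : ∃ n, t.card = n + 1 :=
    Nat.exists_eq_succ_of_ne_zero (Finset.card_ne_zero_of_mem (Finset.mem_insert_self a _))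
  let e : Fin (n + 1) ≃ t := (finCongr hn.symm).trans t.equivFin.symm
  have ht : ∀ q ∈ t, q ∈ W := by
    intro q hq
    simp only [t, Finset.mem_insert] at hq
    rcases hq with rfl | rfl | hq
    · exact (hW _).mpr ⟨ha, haD⟩
    · exact (hW _).mpr ⟨hb, hbD⟩
    · rw [← hs]; exact Submodule.subset_span hq
  refine ⟨n, fun l ↦ e l, e.symm ⟨a, by simp [t]⟩, e.symm ⟨b, by simp [t]⟩, by simp, by simp,
    fun l ↦ (hW _).mp (ht _ (e l).2), fun q hq hqD ↦ ?_⟩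
  have hqW : q ∈ Submodule.span k (s : Set k[X]) := hs ▸ (hW q).mpr ⟨hq, hqD⟩
  refine Submodule.span_mono ?_ hqW
  intro r hr
  exact ⟨e.symm ⟨r, by simp [t, Finset.mem_coe.mp hr]⟩, by simp⟩

end Construction

end SingularCurve

end

noncomputable section

namespace SingularCurve

/-! ### The two charts of the scheme-theoretic image of the projective line -/

section Construction

attribute [local instance] MvPolynomial.gradedAlgebra

open MvPolynomial (homogeneousSubmodule)

variable {k : Type u} [Field k]

lemma range_snd_of_isPullback {X Y Z P : Scheme.{u}} {p : P ⟶ X} {q : P ⟶ Y} {a : X ⟶ Z}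
    {b : Y ⟶ Z} (h : IsPullback p q a b) : Set.range q = b ⁻¹' Set.range a := by
  rw [← h.isoPullback_hom_snd, Scheme.Hom.comp_base, TopCat.coe_comp, Set.range_comp,
    Set.range_eq_univ.mpr h.isoPullback.hom.surjective, Set.image_univ, Scheme.Pullback.range_snd]

lemma range_SpecMap_away {R : Type u} [CommRing R] (g : R) :
    Set.range (Spec.map (CommRingCat.ofHom (algebraMap R (Localization.Away g)))) =
      {x | g ∉ x.asIdeal} :=
  PrimeSpectrum.localization_away_comap_range _ _

lemma isIntegral_of_pair {X U V : Scheme.{u}} (a : U ⟶ X) (b : V ⟶ X) [IsOpenImmersion a]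
    [IsOpenImmersion b] [IsIntegral U] [IsIntegral V] (h : a.opensRange ⊔ b.opensRange = ⊤)
    (hab : (Set.range a ∩ Set.range b).Nonempty) : IsIntegral X := by
  have hred : ∀ i, IsReduced ((pairCover a b h).X i) := fun i ↦
    match i with
    | true => inferInstanceAs (IsReduced V)
    | false => inferInstanceAs (IsReduced U)
  have := IsReduced.of_openCover X (pairCover a b h)
  have : IsDominant a := by
    refine ⟨fun x ↦ mem_closure_iff.mpr fun o ho hx ↦ ?_⟩
    have hx' : x ∈ a.opensRange ⊔ b.opensRange := h ▸ trivial
    rcases hx' with hxa | ⟨v, rfl⟩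
    · exact ⟨x, hx, hxa⟩
    · obtain ⟨_, ⟨u, hu⟩, w, rfl⟩ := hab
      obtain ⟨z, hz, hz'⟩ := nonempty_preirreducible_inter (ho.preimage b.continuous)
        (a.isOpenEmbedding.isOpen_range.preimage b.continuous) ⟨v, hx⟩ ⟨w, u, hu⟩
      exact ⟨b z, hz, hz'⟩
  have := irreducibleSpace_of_isDominant a
  exact isIntegral_of_irreducibleSpace_of_isReduced X

instance isIntegral_projSpace_one : IsIntegral (projSpace k 1) := by
  refine isIntegral_of_pair (affineChart k) (infChart k)
    (opensRange_affineChart_sup_infChart k) ?_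
  obtain ⟨z⟩ : Nonempty (Spec (.of (Localization.Away (X : k[X])))) := by
    have : IsDomain (Localization.Away (X : k[X])) :=
      IsLocalization.isDomain_localization (powers_le_nonZeroDivisors_of_noZeroDivisors X_ne_zero)
    infer_instance
  exact ⟨_, ⟨_, rfl⟩, ⟨Spec.map (CommRingCat.ofHom (invCoord k).toRingHom) z, by
    rw [← Scheme.Hom.comp_apply, (isPullback_charts k).w, Scheme.Hom.comp_apply]⟩⟩

instance compactSpace_projSpace (n : ℕ) : CompactSpace (projSpace k n) :=
  QuasiCompact.compactSpace_of_compactSpace (projSpaceStr k n)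

lemma infChartAway_eq_projMap (h : k[X]) : infChartAway h =
    projMap (s := MvPolynomial.X 1) ((algebraMap k[X] (Localization.Away h)).comp (dehomogenizeInf k))
      (X_mem_homogeneousSubmodule k 1) one_pos (by simp [dehomogenizeInf]) :=
  SpecMap_comp_projMap _ _ _ _ _

/-- On the overlap, `g.reverse` evaluated at `x⁻¹` is a unit times `g`; the factor `X` records that
the overlap is `x ≠ 0`. -/
lemma affineChart_preimage_opensRange_infChartAway (g : k[X]) :
    affineChart k ⁻¹ᵁ (infChartAway g.reverse).opensRange =
      (PrimeSpectrum.basicOpen (g * X) : (Spec (.of k[X])).Opens) := by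
  apply TopologicalSpace.Opens.ext
  refine (range_snd_of_isPullback (isPullback_infChartAway g.reverse)).symm.trans ?_
  have hu : IsUnit (IsLocalization.Away.invSelf (X : k[X]) : Localization.Away (X : k[X])) :=
    IsUnit.of_mul_eq_one_right _ algebraMap_X_mul_invSelf
  have h1 (x : PrimeSpectrum (Localization.Away (X : k[X]))) :
      invCoord k g.reverse ∉ x.asIdeal ↔ algebraMap k[X] (Localization.Away (X : k[X])) g ∉
        x.asIdeal := by
    rw [Polynomial.reverse, invCoord_reflect le_rfl, Ideal.unit_mul_mem_iff_mem _ (hu.pow _)]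
  have h2 : Set.range (Spec.map (CommRingCat.ofHom (algebraMap (Localization.Away (X : k[X]))
      (Localization.Away (invCoord k g.reverse))))) =
      (Spec.map (CommRingCat.ofHom (algebraMap k[X] (Localization.Away (X : k[X]))))) ⁻¹'
        {x | g ∉ x.asIdeal} := by
    rw [range_SpecMap_away]
    exact Set.ext h1
  rw [Scheme.Hom.comp_base, TopCat.coe_comp, Set.range_comp, h2, Set.image_preimage_eq_inter_range,
    range_SpecMap_away, PrimeSpectrum.basicOpen_mul]
  rfl

/-- A projective curve `C` covered by `Spec B`, for a subalgebra `B` of `k[x]`, and a neighbourhood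
`Spec k[y][1 / h]` of `∞` in `ℙ¹`, together with the morphism from `ℙ¹`. -/
structure CurveModel (B : Subalgebra k k[X]) (h : k[X]) where
  /-- The curve. -/
  C : Scheme.{u}
  /-- The structure morphism of the curve. -/
  f : C ⟶ Spec (.of k)
  /-- The morphism from the projective line. -/
  π : projSpace k 1 ⟶ C
  /-- The chart at finite distance. -/
  b₀ : Spec (.of B) ⟶ C
  /-- The chart at infinity. -/
  b₁ : Spec (.of (Localization.Away h)) ⟶ C
  -- The value `1` at `y = 0` keeps infinity inside the chart. The identity in `isPullback_b₁` says
  -- that `π` is an isomorphism over that chart.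
  coeff_zero : h.coeff 0 = 1
  isProjective : IsProjective f
  isIntegral : IsIntegral C
  isSchemeTheoreticallyDominant : IsSchemeTheoreticallyDominant π
  isOpenImmersion_b₀ : IsOpenImmersion b₀
  isOpenImmersion_b₁ : IsOpenImmersion b₁
  b₀_comp : b₀ ≫ f = Spec.map (CommRingCat.ofHom (algebraMap k B))
  π_comp : π ≫ f = projSpaceStr k 1
  isPullback_b₀ :
    IsPullback (Spec.map (CommRingCat.ofHom B.val.toRingHom)) (affineChart k) b₀ π
  isPullback_b₁ : IsPullback (𝟙 _) (infChartAway h) b₁ π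

/-- The chart of the curve at finite distance is given by all of `B`. -/
lemma surjective_awayLift_zero {B : Subalgebra k k[X]} {g : k[X]} (hg : g.Monic)
    (hM : 0 < g.natDegree) (hB : ∀ p, g * p ∈ B) {n : ℕ} {p : Fin (n + 1) → B} {i : Fin (n + 1)}
    (hi : p i = 1)
    (hspan : ∀ q ∈ B, q.natDegree ≤ g.natDegree + g.natDegree + g.natDegree →
      q ∈ Submodule.span k (Set.range fun l ↦ (p l : k[X]))) (hu) :
    Function.Surjective (awayLift (MvPolynomial.aeval p : _ →ₐ[k] B).toRingHom
      (MvPolynomial.X i) hu) := by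
  -- The range is transported into `k[x]`, where the degree criterion `le_of_forall_natDegree_le`
  -- applies.
  let S₀ := ((awayLift (MvPolynomial.aeval p : _ →ₐ[k] B).toRingHom (MvPolynomial.X i) hu).range.map
    B.val.toRingHom)
  have hC (c : k) : algebraMap k k[X] c ∈ S₀ := by
    refine ⟨_, C_mem_range_awayLift _ i hu c, ?_⟩
    simp
  let S : Subalgebra k k[X] := { S₀ with algebraMap_mem' := hC }
  have hS : B ≤ S := by
    refine le_of_forall_natDegree_le hg hM hB fun q hq hqM ↦ ?_
    have hle : Submodule.span k (Set.range fun l ↦ (p l : k[X])) ≤ Subalgebra.toSubmodule S := by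
      rw [Submodule.span_le]
      rintro _ ⟨l, rfl⟩
      exact ⟨p l, X_mem_range_awayLift _ i l hu (by simp [hi]), rfl⟩
    exact hle (hspan q hq hqM)
  intro b
  obtain ⟨b', hb', h⟩ := hS b.2
  rw [← Subtype.ext h]
  exact hb'

/-- The chart of the curve at infinity is an open subscheme of the affine line. -/
lemma surjective_awayLift_inf {B : Subalgebra k k[X]} {g : k[X]}
    (hM : 0 < g.natDegree) (hB : ∀ p, g * p ∈ B) {n : ℕ} {p : Fin (n + 1) → k[X]} {i : Fin (n + 1)}
    (hi : p i = g * g * X ^ g.natDegree)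
    (hspan : ∀ q ∈ B, q.natDegree ≤ g.natDegree + g.natDegree + g.natDegree →
      q ∈ Submodule.span k (Set.range p)) (hu) :
    Function.Surjective (awayLift (MvPolynomial.aeval (fun l ↦
      algebraMap k[X] (Localization.Away g.reverse)
        ((p l).reflect (g.natDegree + g.natDegree + g.natDegree))) : _ →ₐ[k] _).toRingHom
      (MvPolynomial.X i) hu) := by
  set M := g.natDegree with hMdef
  set a := algebraMap k[X] (Localization.Away g.reverse) with ha
  set G : MvPolynomial (Fin (n + 1)) k →+* _ := (MvPolynomial.aeval (fun l ↦
      a ((p l).reflect (M + M + M))) : _ →ₐ[k] Localization.Away g.reverse).toRingHom with hG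
  let S := (awayLift G (MvPolynomial.X i) hu).range
  let v : Localization.Away g.reverse := IsLocalization.Away.invSelf g.reverse
  have hv : a g.reverse * v = 1 := IsLocalization.Away.mul_invSelf _
  have hXM : (X ^ M : k[X]).reflect M = 1 := by
    rw [Polynomial.reflect_monomial, Polynomial.revAt_le le_rfl, Nat.sub_self, pow_zero]
  have hgM : g.reflect M = g.reverse := rfl
  have hC (c : k) : a (C c) ∈ S := by
    convert C_mem_range_awayLift G i hu c
    simp only [hG, AlgHom.toRingHom_eq_coe, RingHom.coe_coe, MvPolynomial.aeval_C]
    rfl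
  have hgg : (g * g).natDegree ≤ M + M := Polynomial.natDegree_mul_le
  have hGi : G (MvPolynomial.X i) = a (g.reverse * g.reverse) := by
    simp only [hG, AlgHom.toRingHom_eq_coe, RingHom.coe_coe, MvPolynomial.aeval_X, hi]
    rw [Polynomial.reflect_mul _ _ hgg (Polynomial.natDegree_X_pow_le M),
      Polynomial.reflect_mul _ _ le_rfl le_rfl, hXM, mul_one, hgM]
  -- The distinguished coordinate reflects to `g.reverse ^ 2`, so this element is the ratio of the
  -- section `q` to that coordinate.
  have key (q : k[X]) (hq : q ∈ B) (hqD : q.natDegree ≤ M + M + M) :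
      v * v * a (q.reflect (M + M + M)) ∈ S := by
    have h := hspan q hq hqD
    clear hq hqD
    induction h using Submodule.span_induction with
    | mem q hq =>
      obtain ⟨l, rfl⟩ := hq
      refine X_mem_range_awayLift G i l hu ?_
      rw [hGi]
      simp only [hG, AlgHom.toRingHom_eq_coe, RingHom.coe_coe, MvPolynomial.aeval_X, map_mul]
      linear_combination (a ((p l).reflect (M + M + M))) * (a g.reverse * v + 1) * hv
    | zero => simp
    | add q r _ _ hq hr =>
      rw [Polynomial.reflect_add, map_add, mul_add]
      exact add_mem hq hr
    | smul c q _ hq =>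
      rw [Polynomial.smul_eq_C_mul, Polynomial.reflect_C_mul, map_mul, mul_left_comm]
      exact mul_mem (hC c) hq
  -- The section `g * g * x ^ (M - 1)` has ratio `x⁻¹ = y` to the coordinate `g * g * x ^ M`.
  have hX : a X ∈ S := by
    have h1 := key (g * g * X ^ (M - 1)) (by rw [mul_assoc]; exact hB _) (by
      refine Polynomial.natDegree_mul_le.trans (add_le_add hgg ?_)
      exact (Polynomial.natDegree_X_pow_le _).trans (Nat.sub_le _ _))
    rw [Polynomial.reflect_mul _ _ hgg ((Polynomial.natDegree_X_pow_le _).trans (Nat.sub_le M 1)),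
      Polynomial.reflect_mul _ _ le_rfl le_rfl, hgM, Polynomial.reflect_monomial,
      Polynomial.revAt_le (Nat.sub_le M 1), Nat.sub_sub_self hM, pow_one] at h1
    convert h1 using 1
    simp only [map_mul]
    linear_combination (- a X) * (a g.reverse * v + 1) * hv
  -- The section `g * x ^ (2M)` reflects to `g.reverse`, so its ratio is `v * v * g.reverse = v`.
  have hvS : v ∈ S := by
    have hgX : (g * X ^ M).natDegree ≤ M + M :=
      Polynomial.natDegree_mul_le.trans (add_le_add le_rfl (Polynomial.natDegree_X_pow_le M))
    have h1 := key (g * X ^ M * X ^ M) (by rw [mul_assoc]; exact hB _)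
      (Polynomial.natDegree_mul_le.trans (add_le_add hgX (Polynomial.natDegree_X_pow_le M)))
    rw [Polynomial.reflect_mul _ _ hgX (Polynomial.natDegree_X_pow_le M),
      Polynomial.reflect_mul _ _ le_rfl (Polynomial.natDegree_X_pow_le M), hXM, hgM, mul_one,
      mul_one] at h1
    convert h1 using 1
    linear_combination - v * hv
  have ha' (q : k[X]) : a q ∈ S := by
    induction q using Polynomial.induction_on' with
    | add q r hq hr => rw [map_add]; exact add_mem hq hr
    | monomial m c =>
      rw [← Polynomial.C_mul_X_pow_eq_monomial, map_mul, map_pow]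
      exact mul_mem (hC c) (pow_mem hX m)
  intro t
  obtain ⟨m, q, hq⟩ := IsLocalization.Away.surj g.reverse t
  have : t = a q * v ^ m := by
    rw [← ha] at hq
    rw [← hq, mul_assoc, ← mul_pow, hv, one_pow, mul_one]
  rw [this]
  exact mul_mem (ha' q) (pow_mem hvS m)

/-- The curve attached to a subalgebra of `k[x]` that contains a nonzero ideal. -/
theorem nonempty_curveModel {B : Subalgebra k k[X]} {g : k[X]} (hg : g.Monic)
    (hM : 0 < g.natDegree) (hB : ∀ p, g * p ∈ B) : Nonempty (CurveModel B g.reverse) := by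
  set M := g.natDegree with hMdef
  have hXM : (X ^ M : k[X]).reflect M = 1 := by
    rw [Polynomial.reflect_monomial, Polynomial.revAt_le le_rfl, Nat.sub_self, pow_zero]
  have hgg : (g * g).natDegree ≤ M + M := Polynomial.natDegree_mul_le
  have hrefl : (g * g * X ^ M).reflect (M + M + M) = g.reverse * g.reverse := by
    rw [Polynomial.reflect_mul _ _ hgg (Polynomial.natDegree_X_pow_le M),
      Polynomial.reflect_mul _ _ le_rfl le_rfl, hXM, mul_one, Polynomial.reverse]
  obtain ⟨n, p, i, j, hi, hj, hp, hspan⟩ := exists_spanning_family B (M + M + M) (one_mem B)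
    (show g * g * X ^ M ∈ B by rw [mul_assoc]; exact hB _) (by simp)
    (Polynomial.natDegree_mul_le.trans (add_le_add hgg (Polynomial.natDegree_X_pow_le M)))
  have h0 : g.reverse.coeff 0 = 1 := by rw [Polynomial.coeff_zero_reverse]; exact hg
  let a := algebraMap k[X] (Localization.Away g.reverse)
  have hau : IsUnit (a (g.reverse * g.reverse)) := by
    rw [map_mul]
    exact (IsLocalization.Away.algebraMap_isUnit _).mul (IsLocalization.Away.algebraMap_isUnit _)
  have hu₀ : IsUnit ((MvPolynomial.aeval p : _ →ₐ[k] k[X]).toRingHom (MvPolynomial.X i)) := by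
    simp [hi]
  have hu₁ : IsUnit ((MvPolynomial.aeval (fun i ↦
      algebraMap k[X] (Localization.Away g.reverse) ((p i).reflect (M + M + M))) :
        _ →ₐ[k] _).toRingHom (MvPolynomial.X j)) := by
    simpa [hj, hrefl] using hau
  obtain ⟨φ, hφ₀, hφ₁⟩ := exists_lineMap (fun l ↦ (hp l).2) h0 i j hu₀ hu₁
  have : QuasiCompact φ := quasiCompact_of_compactSpace φ
  let p' : Fin (n + 1) → B := fun l ↦ ⟨p l, (hp l).1⟩
  have hi' : p' i = 1 := Subtype.ext hi
  have hu₀' : IsUnit ((MvPolynomial.aeval p' : _ →ₐ[k] B).toRingHom (MvPolynomial.X i)) := by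
    simp [hi']
  have hcover := opensRange_affineChart_sup_infChartAway h0
  have hXi := X_mem_homogeneousSubmodule k i
  have hXj := X_mem_homogeneousSubmodule k j
  obtain ⟨b₀, hb₀, hb₀ι, hb₀r, hsq₀⟩ := exists_imageChart φ
    (Proj.awayι (homogeneousSubmodule (Fin (n + 1)) k) _ hXi one_pos) (affineChart k) _
    (surjective_awayLift_zero hg hM hB hi' hspan hu₀') B.val.toRingHom Subtype.val_injective
    (by
      refine hφ₀.trans (Eq.trans ?_ (SpecMap_comp_projMap _ hXi one_pos hu₀' _).symm)
      congr 1
      ext l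
      · simp
      · simp [p'])
    (by
      rw [Proj.opensRange_awayι]
      refine opens_eq_of_pair _ _ hcover ?_ ?_
      · rw [← Scheme.Hom.comp_preimage, hφ₀, projMap_preimage_basicOpen _ _ _ _ hXi one_pos,
          preimage_opensRange_self]
        simp [hi]
        rfl
      -- At infinity the coordinate `1` becomes `y ^ (3M)`; as `M > 0`, it is nonzero exactly where
      -- `y` is.
      · rw [← Scheme.Hom.comp_preimage, hφ₁, projMap_preimage_basicOpen _ _ _ _ hXi one_pos,
          opensRange_affineChart, infChartAway_eq_projMap, projMap_preimage_basicOpen _ _ _ _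
            (X_mem_homogeneousSubmodule k 0) one_pos]
        simp [hi, dehomogenizeInf, PrimeSpectrum.basicOpen_pow _ _ (show 0 < M + M + M by omega)]
        rfl)
  obtain ⟨b₁, hb₁, hb₁ι, hb₁r, hsq₁⟩ := exists_imageChart φ
    (Proj.awayι (homogeneousSubmodule (Fin (n + 1)) k) _ hXj one_pos) (infChartAway g.reverse) _
    (surjective_awayLift_inf hM hB hj hspan hu₁) (RingHom.id _) Function.injective_id
    (by rw [hφ₁]; simp [projMap])
    (by
      rw [Proj.opensRange_awayι]
      refine opens_eq_of_pair _ _ hcover ?_ ?_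
      -- `g * g * x ^ M` and `g * x` have the same nonvanishing locus because `M > 0`.
      · rw [← Scheme.Hom.comp_preimage, hφ₀, projMap_preimage_basicOpen _ _ _ _ hXj one_pos,
          affineChart_preimage_opensRange_infChartAway]
        simp [hj, PrimeSpectrum.basicOpen_mul, PrimeSpectrum.basicOpen_pow _ _ hM]
        rfl
      · rw [← Scheme.Hom.comp_preimage, hφ₁, projMap_preimage_basicOpen _ _ _ _ hXj one_pos,
          preimage_opensRange_self]
        exact eq_top_iff.mpr fun x _ h ↦ x.2.ne_top (Ideal.eq_top_of_isUnit_mem _ h hu₁))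
  have hdom := isSchemeTheoreticallyDominant_toImage φ
  refine ⟨⟨φ.image, φ.imageι ≫ projSpaceStr k n, φ.toImage, b₀, b₁, h0, ⟨n, φ.imageι, inferInstance,
    rfl⟩, isIntegral_of_isSchemeTheoreticallyDominant φ.toImage, hdom, hb₀, hb₁, ?_, ?_, hsq₀, ?_⟩⟩
  · rw [reassoc_of% hb₀ι]
    refine (projMap_comp_projSpaceStr _ hXi one_pos hu₀').trans ?_
    congr 2
    ext c
    simp
  · rw [Scheme.Hom.toImage_imageι_assoc]
    refine hom_ext_of_pair _ _ hcover ?_ ?_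
    · rw [reassoc_of% hφ₀, projMap_comp_projSpaceStr, affineChart_eq_projMap,
        projMap_comp_projSpaceStr]
      congr 2
      ext c
      simp [dehomogenize]
    · rw [reassoc_of% hφ₁, projMap_comp_projSpaceStr, infChartAway_eq_projMap,
        projMap_comp_projSpaceStr]
      congr 2
      ext c
      simp [dehomogenizeInf]
      rfl
  · simpa using hsq₁

end Construction

end SingularCurve

end

noncomputable section

namespace SingularCurve

/-! ### A criterion for being the normalization -/

section Normalization

open Limits

lemma of_pair_of_isZariskiLocalAtTarget {P : MorphismProperty Scheme.{u}}
    [IsZariskiLocalAtTarget P] {X Y U V : Scheme.{u}} {f : X ⟶ Y} (a : U ⟶ Y) (b : V ⟶ Y)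
    [IsOpenImmersion a] [IsOpenImmersion b] (h : a.opensRange ⊔ b.opensRange = ⊤)
    (ha : P (pullback.snd f a)) (hb : P (pullback.snd f b)) : P f :=
  IsZariskiLocalAtTarget.of_openCover (pairCover a b h) fun i ↦
    match i with
    | true => hb
    | false => ha

lemma of_pair_of_isPullback {P : MorphismProperty Scheme.{u}}
    [IsZariskiLocalAtTarget P] {X Y U V U' V' : Scheme.{u}} {f : X ⟶ Y} (a : U ⟶ Y) (b : V ⟶ Y)
    [IsOpenImmersion a] [IsOpenImmersion b] (h : a.opensRange ⊔ b.opensRange = ⊤)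
    {a' : U' ⟶ X} {b' : V' ⟶ X} {fU : U' ⟶ U} {fV : V' ⟶ V}
    (hU : IsPullback fU a' a f) (hV : IsPullback fV b' b f) (ha : P fU) (hb : P fV) : P f := by
  refine of_pair_of_isZariskiLocalAtTarget a b h ?_ ?_
  · rwa [← hU.flip.isoPullback_inv_snd, P.cancel_left_of_respectsIso]
  · rwa [← hV.flip.isoPullback_inv_snd, P.cancel_left_of_respectsIso]

lemma injective_of_isSchemeTheoreticallyDominant_SpecMap {R S : CommRingCat.{u}} (φ : R ⟶ S)
    [IsSchemeTheoreticallyDominant (Spec.map φ)] : Function.Injective φ.hom := by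
  have h := Scheme.ΓSpecIso_naturality φ
  have h1 := Scheme.Hom.app_injective (Spec.map φ) ⊤
  have hR := (ConcreteCategory.bijective_of_isIso (Scheme.ΓSpecIso R).inv).1
  have hS := (ConcreteCategory.bijective_of_isIso (Scheme.ΓSpecIso S).inv).1
  have h' := Scheme.ΓSpecIso_inv_naturality φ
  intro x y hxy
  refine hR (h1 ?_)
  have e := fun a ↦ congrArg (fun φ ↦ φ.hom a) h'
  simp only [CommRingCat.hom_comp, RingHom.comp_apply] at e
  exact ((e x).symm.trans (congrArg _ hxy)).trans (e y)

/-- `N` is affine, say `Spec S`, and dominance embeds `S` into `K` over `R`. As `S` is integral over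
`R` and `R` is integrally closed in `K`, the two coincide. -/
lemma isIso_of_isIntegralHom_of_isSchemeTheoreticallyDominant {R K : CommRingCat.{u}} (c : R ⟶ K)
    (hcinj : Function.Injective c.hom) (hc : ∀ t, c.hom.IsIntegralElem t → ∃ r, c.hom r = t)
    {N : Scheme.{u}} (d : N ⟶ Spec R) [IsIntegralHom d] (a : Spec K ⟶ N)
    [IsSchemeTheoreticallyDominant a] (h : a ≫ d = Spec.map c) : IsIso d := by
  have : IsAffine N := isAffine_of_isAffineHom d
  obtain ⟨φ, hφ⟩ := Spec.map_surjective (N.isoSpec.inv ≫ d)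
  obtain ⟨ψ, hψ⟩ := Spec.map_surjective (a ≫ N.isoSpec.hom)
  have : IsSchemeTheoreticallyDominant (Spec.map ψ) := by rw [hψ]; infer_instance
  have hψinj := injective_of_isSchemeTheoreticallyDominant_SpecMap ψ
  have hφint : φ.hom.IsIntegral := by
    rw [← IsIntegralHom.SpecMap_iff, hφ]
    infer_instance
  have hcomp : φ ≫ ψ = c := by
    apply Spec.map_injective
    rw [Spec.map_comp, hφ, hψ, Category.assoc, Iso.hom_inv_id_assoc, h]
  have hcomp' (r) : ψ.hom (φ.hom r) = c.hom r := by rw [← hcomp]; rfl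
  have hiso : IsIso φ := by
    refine (ConcreteCategory.isIso_iff_bijective _).mpr ⟨fun x y hxy ↦ hcinj ?_, fun s ↦ ?_⟩
    · rw [← hcomp', ← hcomp']
      exact congrArg ψ.hom hxy
    · obtain ⟨r, hr⟩ := hc (ψ.hom s) (by
        obtain ⟨p, hp, hps⟩ := hφint s
        refine ⟨p, hp, ?_⟩
        rw [← hcomp, CommRingCat.hom_comp, ← Polynomial.hom_eval₂, hps, map_zero])
      exact ⟨r, hψinj ((hcomp' r).trans hr)⟩
  have : IsIso (N.isoSpec.inv ≫ d) := by rw [← hφ]; infer_instance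
  exact IsIso.of_isIso_comp_left N.isoSpec.inv d

lemma exists_stalk_iso_of_isOpenImmersion {U Y : Scheme.{u}} (a : U ⟶ Y) [IsOpenImmersion a] (u : U)
    (y : Y) (h : a u = y) : ∃ θ : U.presheaf.stalk u ≅ Y.presheaf.stalk y,
      Y.fromSpecStalk y = Spec.map θ.hom ≫ U.fromSpecStalk u ≫ a := by
  subst h
  refine ⟨(asIso (a.stalkMap u)).symm, ?_⟩
  simp only [Iso.symm_hom, asIso_inv]
  rw [← Scheme.SpecMap_stalkMap_fromSpecStalk, ← Spec.map_comp_assoc, IsIso.hom_inv_id, Spec.map_id,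
    Category.id_comp]

/-- The function field of `Y` is the fraction field of `R`, so the integral closedness of `R`
transfers to any isomorphic copy `K`. -/
lemma exists_functionField_factor {R : CommRingCat.{u}} [IsDomain R] [IsIntegrallyClosed R]
    {Y : Scheme.{u}} [IsIntegral Y] (a : Spec R ⟶ Y) [IsOpenImmersion a] {K : CommRingCat.{u}}
    (θ : Y.functionField ≅ K) :
    ∃ c : R ⟶ K, Spec.map θ.hom ≫ Y.fromSpecStalk (genericPoint Y) = Spec.map c ≫ a ∧
      Function.Injective c.hom ∧ ∀ t, c.hom.IsIntegralElem t → ∃ r, c.hom r = t := by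
  obtain ⟨α, hα⟩ := exists_stalk_iso_of_isOpenImmersion a (genericPoint (Spec R)) (genericPoint Y)
    (genericPoint_eq_of_isOpenImmersion a)
  let τ : R ⟶ (Spec R).functionField := StructureSheaf.toStalk R _
  have hτ : τ.hom = algebraMap R (Spec R).functionField := rfl
  refine ⟨τ ≫ α.hom ≫ θ.hom, ?_, ?_, ?_⟩
  · rw [hα, Spec.fromSpecStalk_eq']
    simp only [Spec.map_comp, Category.assoc]
    rfl
  · simp only [CommRingCat.hom_comp]
    have h1 := (ConcreteCategory.bijective_of_isIso (α.hom ≫ θ.hom)).1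
    exact h1.comp (IsFractionRing.injective R (Spec R).functionField)
  · rintro t ⟨p, hp, hpt⟩
    let μ := (α ≪≫ θ).commRingCatIsoToRingEquiv
    have hμ (r : R) : μ (τ.hom r) = (τ ≫ α.hom ≫ θ.hom).hom r := rfl
    have key : _root_.IsIntegral R (μ.symm t) := by
      refine ⟨p, hp, ?_⟩
      apply μ.injective
      rw [map_zero, ← hpt, ← RingEquiv.coe_toRingHom, Polynomial.hom_eval₂, RingEquiv.coe_toRingHom,
        RingEquiv.apply_symm_apply]
      rfl
    obtain ⟨r, hr⟩ := IsIntegrallyClosed.isIntegral_iff.mp key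
    exact ⟨r, (hμ r).symm.trans ((congrArg μ hr).trans (μ.apply_symm_apply t))⟩

/-- An integral birational morphism from a normal scheme is the normalization. -/
theorem isNormalization_of_isIntegralHom {X Y W : Scheme.{u}} {π : Y ⟶ X} [IsIntegral X]
    [X.IsSeparated] [IsIntegral Y] [IsIntegral W] [IsIntegralHom π] (i : W ⟶ Y) [IsOpenImmersion i]
    [IsOpenImmersion (i ≫ π)] {R S : CommRingCat.{u}} [IsDomain R] [IsIntegrallyClosed R]
    [IsDomain S] [IsIntegrallyClosed S] (a : Spec R ⟶ Y) (b : Spec S ⟶ Y) [IsOpenImmersion a]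
    [IsOpenImmersion b] (h : a.opensRange ⊔ b.opensRange = ⊤) : IsNormalization π := by
  set ξ := X.fromSpecStalk (genericPoint X) with hξ
  obtain ⟨α, hα⟩ := exists_stalk_iso_of_isOpenImmersion (i ≫ π) (genericPoint W) (genericPoint X)
    (genericPoint_eq_of_isOpenImmersion _)
  obtain ⟨β, hβ⟩ := exists_stalk_iso_of_isOpenImmersion i (genericPoint W) (genericPoint Y)
    (genericPoint_eq_of_isOpenImmersion _)
  -- `W` is open in both `Y` and `X`, which identifies their function fields.
  let θ : Y.functionField ≅ X.functionField := β.symm ≪≫ α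
  let f₁ : Spec X.functionField ⟶ Y := Spec.map θ.hom ≫ Y.fromSpecStalk (genericPoint Y)
  have hf₁ : ξ = f₁ ≫ π := by
    simp only [f₁, θ, Iso.trans_hom, Iso.symm_hom, hβ, Category.assoc, Spec.map_comp]
    rw [← Spec.map_comp_assoc β.hom, Iso.hom_inv_id, Spec.map_id, Category.id_comp, hξ, hα]
  let d := ξ.normalizationDesc f₁ π hf₁
  have hd : d ≫ π = ξ.fromNormalization := ξ.normalizationDesc_comp f₁ π hf₁
  have hd' : ξ.toNormalization ≫ d = f₁ := ξ.toNormalization_normalizationDesc f₁ π hf₁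
  have : IsIntegralHom (d ≫ π) := hd ▸ inferInstance
  have : IsIntegralHom d := IsIntegralHom.of_comp d π
  -- The morphism `d` comes from the universal property of the relative normalization. Over a normal
  -- affine chart of `Y` it is integral, and its source is dominated by the generic point, so the
  -- previous criterion applies.
  have key {R : CommRingCat.{u}} [IsDomain R] [IsIntegrallyClosed R] (a : Spec R ⟶ Y)
      [IsOpenImmersion a] : IsIso (pullback.snd d a) := by
    obtain ⟨c, hc, hcinj, hcint⟩ := exists_functionField_factor a θ
    let t : Spec X.functionField ⟶ pullback d a :=
      pullback.lift ξ.toNormalization (Spec.map c) (hd'.trans hc)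
    have ht₁ : t ≫ pullback.fst d a = ξ.toNormalization := pullback.lift_fst _ _ _
    have : IsReduced (pullback d a) := isReduced_of_isOpenImmersion (pullback.fst d a)
    have : IsDominant t := by
      refine ⟨fun x ↦ mem_closure_iff.mpr fun o ho hx ↦ ?_⟩
      obtain ⟨_, ⟨y, hy, hyz⟩, z, rfl⟩ := ξ.toNormalization.denseRange.inter_open_nonempty _
        ((pullback.fst d a).isOpenEmbedding.isOpenMap o ho) ⟨_, x, hx, rfl⟩
      rw [← ht₁, Scheme.Hom.comp_apply] at hyz
      exact ⟨y, hy, z, ((pullback.fst d a).isOpenEmbedding.injective hyz).symm⟩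
    have := IsSchemeTheoreticallyDominant.of_isDominant t
    exact isIso_of_isIntegralHom_of_isSchemeTheoreticallyDominant c hcinj hcint _ t
      (pullback.lift_snd _ _ _)
  have hiso : IsIso d := of_pair_of_isZariskiLocalAtTarget (P := .isomorphisms _) a b h
    (key a) (key b)
  refine ⟨inferInstance, inferInstance, inferInstance, (asIso d).symm, ?_⟩
  rw [Iso.symm_hom, asIso_inv, IsIso.inv_comp_eq, hd]

end Normalization

end SingularCurve

end

noncomputable section

namespace SingularCurve

/-! ### Dimension and integral extensions -/

section Dimension

open TopologicalSpace

/-- Irreducible closed sets containing `Z` all meet the open set, so the coheight of `Z` can be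
computed there. Writing dimension as a supremum of coheights thus makes it local. -/
lemma coheight_le_of_isOpenEmbedding {X U : Type*} [TopologicalSpace X] [TopologicalSpace U]
    {a : U → X} (ha : Topology.IsOpenEmbedding a) (Z : IrreducibleCloseds X) {u : U}
    (hu : a u ∈ (Z : Set X)) : (Order.coheight Z : WithBot ℕ∞) ≤ topologicalKrullDim U := by
  let W := (IrreducibleCloseds.orderIsoOfIsOpenEmbedding a ha).symm ⟨Z, u, hu⟩
  have hW : IrreducibleCloseds.map a ha.continuous W = Z :=
    congrArg Subtype.val ((IrreducibleCloseds.orderIsoOfIsOpenEmbedding a ha).apply_symm_apply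
      ⟨Z, u, hu⟩)
  rw [← hW, ha.coheight_map]
  exact Order.coheight_le_krullDim W

lemma topologicalKrullDim_le_of_isOpenEmbedding {X U V : Type*} [TopologicalSpace X]
    [TopologicalSpace U] [TopologicalSpace V] {a : U → X} {b : V → X}
    (ha : Topology.IsOpenEmbedding a) (hb : Topology.IsOpenEmbedding b)
    (h : Set.range a ∪ Set.range b = Set.univ) {d : WithBot ℕ∞} (hU : topologicalKrullDim U ≤ d)
    (hV : topologicalKrullDim V ≤ d) : topologicalKrullDim X ≤ d := by
  rw [topologicalKrullDim, Order.krullDim_eq_iSup_coheight]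
  refine iSup_le fun Z ↦ ?_
  obtain ⟨z, hz⟩ := Z.isIrreducible.nonempty
  have hz' : z ∈ Set.range a ∪ Set.range b := h ▸ Set.mem_univ z
  rcases hz' with ⟨u, rfl⟩ | ⟨v, rfl⟩
  · exact (coheight_le_of_isOpenEmbedding ha Z hz).trans hU
  · exact (coheight_le_of_isOpenEmbedding hb Z hz).trans hV

/-- Lying over gives a nonzero prime of `S` above a nonzero prime of `R`; it is maximal, and
maximality descends along integral extensions. -/
lemma dimensionLEOne_of_isIntegral {R S : Type*} [CommRing R] [CommRing S] [IsDomain S]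
    [Algebra R S] [Algebra.IsIntegral R S] [Ring.DimensionLEOne S]
    (hinj : Function.Injective (algebraMap R S)) : Ring.DimensionLEOne R where
  maximalOfPrime {p} hp0 hp := by
    obtain ⟨Q, hQ, rfl⟩ := Ideal.exists_ideal_over_prime_of_isIntegral_of_isDomain (S := S) p
      (by rw [(RingHom.injective_iff_ker_eq_bot _).mp hinj]; exact bot_le)
    have hQ0 : Q ≠ ⊥ := by
      rintro rfl
      exact hp0 (by rw [← RingHom.ker_eq_comap_bot, (RingHom.injective_iff_ker_eq_bot _).mp hinj])
    have := hQ.isMaximal hQ0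
    exact Ideal.isMaximal_comap_of_isIntegral_of_isMaximal Q

lemma topologicalKrullDim_Spec_le_one (R : Type u) [CommRing R] [Ring.DimensionLEOne R] :
    topologicalKrullDim (Spec (.of R)) ≤ 1 := by
  have : topologicalKrullDim (PrimeSpectrum R) ≤ 1 := by
    rw [PrimeSpectrum.topologicalKrullDim_eq_ringKrullDim]
    exact Ring.krullDimLE_iff.mp inferInstance
  exact this

variable {k : Type u} [Field k] {B : Subalgebra k k[X]} {g : k[X]}

/-- `x` is a root of the polynomial `g(T) - g`, which is monic with coefficients in `B`. -/
lemma isIntegral_val (hg : g.Monic) (hM : 0 < g.natDegree) (hgB : g ∈ B) :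
    B.val.toRingHom.IsIntegral := by
  let φ : k[X] →+* B := Polynomial.eval₂RingHom (algebraMap k B) ⟨g, hgB⟩
  have hX : B.val.toRingHom.IsIntegralElem X := by
    refine ⟨g.map (algebraMap k B) - C ⟨g, hgB⟩, ?_, ?_⟩
    · refine Polynomial.Monic.sub_of_left (hg.map _) ?_
      rw [Polynomial.degree_map_eq_of_injective (algebraMap k B).injective]
      exact Polynomial.degree_C_le.trans_lt (Polynomial.natDegree_pos_iff_degree_pos.mp hM)
    · rw [Polynomial.eval₂_sub, Polynomial.eval₂_map, Polynomial.eval₂_C, sub_eq_zero]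
      exact (Polynomial.aeval_X_left_apply g)
  intro p
  induction p using Polynomial.induction_on' with
  | add p q hp hq => exact hp.add _ hq
  | monomial n c =>
    rw [← Polynomial.C_mul_X_pow_eq_monomial]
    refine RingHom.IsIntegralElem.mul _ ?_ (IsIntegral.pow (R := B) hX n)
    exact B.val.toRingHom.isIntegralElem_map (x := algebraMap k B c)

end Dimension

/-! ### Global geometry of the model -/

section Model

variable {k : Type u} [Field k] {B : Subalgebra k k[X]} {h : k[X]} (S : CurveModel B h)

namespace CurveModel

instance : IsIntegral S.C := S.isIntegral

instance : IsSchemeTheoreticallyDominant S.π := S.isSchemeTheoreticallyDominant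

instance : IsOpenImmersion S.b₀ := S.isOpenImmersion_b₀

instance : IsOpenImmersion S.b₁ := S.isOpenImmersion_b₁

instance : IsProper S.f := S.isProjective.isProper

instance : S.C.IsSeparated := ⟨by
  rw [← Limits.terminal.comp_from S.f]
  infer_instance⟩

instance : QuasiCompact S.π := quasiCompact_of_compactSpace _

instance : Surjective S.π := surjective_of_projLine k S.π_comp

lemma opensRange_b₀_sup_opensRange_b₁ : S.b₀.opensRange ⊔ S.b₁.opensRange = ⊤ := by
  rw [eq_top_iff]
  intro x _
  obtain ⟨z, rfl⟩ := S.π.surjective x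
  have hz : z ∈ (affineChart k).opensRange ⊔ (infChartAway h).opensRange :=
    opensRange_affineChart_sup_infChartAway S.coeff_zero ▸ trivial
  rcases hz with ⟨y, rfl⟩ | ⟨y, rfl⟩
  · exact Or.inl ⟨_, by rw [← Scheme.Hom.comp_apply, S.isPullback_b₀.w, Scheme.Hom.comp_apply]⟩
  · exact Or.inr ⟨_, by rw [← Scheme.Hom.comp_apply, S.isPullback_b₁.w, Scheme.Hom.comp_apply]⟩

lemma infChartAway_comp_π : infChartAway h ≫ S.π = S.b₁ := by
  rw [← S.isPullback_b₁.w, Category.id_comp]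

lemma isIntegralHom_π (hB : B.val.toRingHom.IsIntegral) : IsIntegralHom S.π :=
  have : IsZariskiLocalAtTarget @IsIntegralHom.{u} :=
    @HasAffineProperty.instIsZariskiLocalAtTarget _ _ IsIntegralHom.hasAffineProperty
  of_pair_of_isPullback S.b₀ S.b₁ S.opensRange_b₀_sup_opensRange_b₁ S.isPullback_b₀ S.isPullback_b₁
    (IsIntegralHom.SpecMap_iff.mpr hB) inferInstance

include S in
lemma ne_zero : h ≠ 0 := by
  rintro rfl
  simpa using S.coeff_zero

include S in
lemma isDomain_away : IsDomain (Localization.Away h) :=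
  IsLocalization.isDomain_localization (powers_le_nonZeroDivisors_of_noZeroDivisors S.ne_zero)

lemma isNormalization_π (hB : B.val.toRingHom.IsIntegral) : IsNormalization S.π := by
  have := S.isIntegralHom_π hB
  have := S.isDomain_away
  have : IsOpenImmersion (infChartAway h ≫ S.π) := by
    rw [S.infChartAway_comp_π]
    infer_instance
  exact isNormalization_of_isIntegralHom (infChartAway h) (affineChart k) (infChart k)
    (opensRange_affineChart_sup_infChart k)

lemma topologicalKrullDim_eq_one (hB : B.val.toRingHom.IsIntegral) :
    topologicalKrullDim S.C = 1 := by
  have := S.isDomain_away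
  have hcov : Set.range S.b₀ ∪ Set.range S.b₁ = Set.univ :=
    congrArg (fun U : S.C.Opens ↦ (U : Set S.C)) S.opensRange_b₀_sup_opensRange_b₁
  have : Algebra.IsIntegral B k[X] := ⟨hB⟩
  have := dimensionLEOne_of_isIntegral (R := B) (S := k[X]) Subtype.val_injective
  have := Ring.DimensionLEOne.localization (Localization.Away h)
    (powers_le_nonZeroDivisors_of_noZeroDivisors S.ne_zero)
  refine le_antisymm (topologicalKrullDim_le_of_isOpenEmbedding S.b₀.isOpenEmbedding
    S.b₁.isOpenEmbedding hcov (topologicalKrullDim_Spec_le_one _)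
      (topologicalKrullDim_Spec_le_one _)) ?_
  refine le_trans ?_ S.b₁.isOpenEmbedding.isInducing.topologicalKrullDim_le
  have key : 1 ≤ topologicalKrullDim (PrimeSpectrum (Localization.Away h)) := by
    rw [PrimeSpectrum.topologicalKrullDim_eq_ringKrullDim, ringKrullDim, Order.one_le_krullDim_iff]
    -- Evaluation at infinity, defined because `h` is `1` there. Its kernel contains `y`, so it is a
    -- prime strictly above the zero ideal.
    let φ : Localization.Away h →+* k := IsLocalization.Away.lift h (g := Polynomial.constantCoeff)
      (by rw [Polynomial.constantCoeff_apply, S.coeff_zero]; exact isUnit_one)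
    refine ⟨⟨⊥, Ideal.isPrime_bot⟩, ⟨RingHom.ker φ, RingHom.ker_isPrime φ⟩, ?_⟩
    rw [← PrimeSpectrum.asIdeal_lt_asIdeal, bot_lt_iff_ne_bot]
    intro hbot
    have hX : algebraMap k[X] (Localization.Away h) X ∈ RingHom.ker φ := by
      rw [RingHom.mem_ker, IsLocalization.Away.lift_eq, Polynomial.constantCoeff_apply,
        Polynomial.coeff_X_zero]
    have hX' : algebraMap k[X] (Localization.Away h) X ∈ (⊥ : Ideal _) := hbot ▸ hX
    rw [Ideal.mem_bot, map_eq_zero_iff _ (IsLocalization.injective _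
      (powers_le_nonZeroDivisors_of_noZeroDivisors S.ne_zero))] at hX'
    exact Polynomial.X_ne_zero hX'
  exact key

/-- The affine line maps to the curve. -/
lemma affineChart_comp_π_comp_f : (affineChart k ≫ S.π) ≫ S.f =
    Spec.map (CommRingCat.ofHom (algebraMap k k[X])) := by
  rw [← S.isPullback_b₀.w, Category.assoc, S.b₀_comp, ← Spec.map_comp]
  rfl

/-- The affine line dominates the curve scheme-theoretically, and flat base change preserves this
for quasi-compact morphisms. Over `K` the curve is thus dominated by the integral scheme `Spec
K[X]`. -/
instance : GeometricallyIntegral S.f := by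
  refine ⟨(geometrically_iff_of_commRing).mpr ?_⟩
  intro K _ _ Y fst snd hsq
  have hd : IsSchemeTheoreticallyDominant (affineChart k) := by
    have : IsDominant (affineChart k) := ⟨(affineChart k).isOpenEmbedding.isOpen_range.dense
      ⟨_, genericPoint _, rfl⟩⟩
    exact .of_isDominant _
  set m := affineChart k ≫ S.π with hmdef
  have hm : IsSchemeTheoreticallyDominant m := inferInstance
  have : QuasiCompact m := inferInstance
  have : Flat fst := MorphismProperty.of_isPullback hsq.flip
    (Flat.SpecMap_iff.mpr (RingHom.flat_algebraMap_iff.mpr inferInstance))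
  have hsq' := (IsPullback.of_hasPullback m fst).paste_vert hsq
  rw [S.affineChart_comp_π_comp_f] at hsq'
  let := Polynomial.algebra k K
  have hpoly := isPullback_SpecMap_of_isPushout _ _ _ _
    (CommRingCat.isPushout_of_isPushout k k[X] K K[X])
  have : IsIntegral (Limits.pullback m fst) :=
    IsIntegral.of_isIso (hsq'.isoIsPullback _ _ hpoly).inv
  have := IsSchemeTheoreticallyDominant.of_isPullback (IsPullback.of_hasPullback m fst)
  exact isIntegral_of_isSchemeTheoreticallyDominant (Limits.pullback.snd m fst)

end CurveModel

end Model

end SingularCurve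

end

noncomputable section

namespace SingularCurve

/-! ### The singular point and the gluing -/

section Point

variable {k : Type u} [Field k]

lemma mem_asIdeal_SpecMap_closedPoint {R : Type u} [CommRing R] (φ : R →+* k) (r : R) :
    r ∈ (Spec.map (CommRingCat.ofHom φ) (IsLocalRing.closedPoint k)).asIdeal ↔ φ r = 0 := by
  change φ r ∈ IsLocalRing.maximalIdeal k ↔ _
  rw [IsLocalRing.maximalIdeal_eq_bot, Ideal.mem_bot]

lemma eq_SpecMap_evalRingHom_of_mem {q : Spec (.of k[X])} {a : k} (h : X - C a ∈ q.asIdeal) :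
    Spec.map (CommRingCat.ofHom (Polynomial.evalRingHom a)) (IsLocalRing.closedPoint k) = q := by
  refine (PrimeSpectrum.ext ?_ : (_ : PrimeSpectrum k[X]) = q)
  refine le_antisymm (fun p hp ↦ ?_) (fun p hp ↦ ?_)
  · rw [mem_asIdeal_SpecMap_closedPoint] at hp
    obtain ⟨r, rfl⟩ := Polynomial.dvd_iff_isRoot.mpr hp
    exact q.asIdeal.mul_mem_right r h
  · rw [mem_asIdeal_SpecMap_closedPoint]
    by_contra hne
    have h1 := Polynomial.mul_divByMonic_eq_iff_isRoot (p := p - C (p.eval a)) (a := a)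
    have h2 : C (p.eval a) ∈ q.asIdeal := by
      have h3 : p - C (p.eval a) ∈ q.asIdeal := by
        obtain ⟨r, hr⟩ := Polynomial.X_sub_C_dvd_sub_C_eval (a := a) (p := p)
        rw [hr]
        exact q.asIdeal.mul_mem_right r h
      simpa using sub_mem hp h3
    exact q.2.ne_top (Ideal.eq_top_of_isUnit_mem _ h2
      (Polynomial.isUnit_C.mpr (isUnit_iff_ne_zero.mpr hne)))

lemma smooth_of_isOpenImmersion_affine {X : Scheme.{u}} (f : X ⟶ Spec (.of k)) {U V : Scheme.{u}}
    (a : U ⟶ X) (b : V ⟶ X) [IsOpenImmersion a] [IsOpenImmersion b]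
    (h : a.opensRange ⊔ b.opensRange = ⊤) (ha : Smooth (a ≫ f)) (hb : Smooth (b ≫ f)) :
    Smooth f :=
  have : IsZariskiLocalAtSource @Smooth.{u} :=
    @HasRingHomProperty.instIsZariskiLocalAtSource _ _ (inferInstance : HasRingHomProperty @Smooth.{u} _)
  IsZariskiLocalAtSource.of_openCover (P := @Smooth) (𝒰 := pairCover a b h) fun i ↦
    match i with
    | true => hb
    | false => ha

instance smooth_SpecMap_polynomial :
    Smooth (Spec.map (CommRingCat.ofHom (algebraMap k k[X]))) := by
  rw [HasRingHomProperty.Spec_iff (P := @Smooth)]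
  have : Algebra.Smooth k k[X] := ⟨inferInstance, inferInstance⟩
  exact RingHom.smooth_algebraMap.mpr this

instance smooth_projSpaceStr_one : Smooth (projSpaceStr k 1) := by
  refine smooth_of_isOpenImmersion_affine _ _ _ (opensRange_affineChart_sup_infChart k) ?_ ?_
  · rw [affineChart_eq_projMap, projMap_comp_projSpaceStr]
    convert smooth_SpecMap_polynomial (k := k)
    ext c
    simp [dehomogenize]
  · rw [infChart, projMap_comp_projSpaceStr]
    convert smooth_SpecMap_polynomial (k := k)
    ext c
    simp [dehomogenizeInf]

namespace CurveModel

variable {B : Subalgebra k k[X]} {h : k[X]} (S : CurveModel B h)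

/-- The image in the curve of the point of the affine line with coordinate `a`. -/
def point (a : k) : Spec (.of k) ⟶ S.C :=
  Spec.map (CommRingCat.ofHom ((Polynomial.evalRingHom a).comp B.val.toRingHom)) ≫ S.b₀

lemma SpecMap_evalRingHom_comp_π (a : k) :
    (Spec.map (CommRingCat.ofHom (Polynomial.evalRingHom a)) ≫ affineChart k) ≫ S.π =
      S.point a := by
  rw [Category.assoc, ← S.isPullback_b₀.w, ← Spec.map_comp_assoc, point, CommRingCat.ofHom_comp]

lemma π_affinePoint (a : k) : S.π (affinePoint a) = underlyingPoint (S.point a) := by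
  rw [underlyingPoint, ← SpecMap_evalRingHom_comp_π]
  rfl

lemma point_comp_f (a : k) : S.point a ≫ S.f = 𝟙 _ := by
  rw [point, Category.assoc, S.b₀_comp, ← Spec.map_comp, ← CommRingCat.ofHom_comp]
  rw [← Spec.map_id]
  congr 1
  ext c
  simp

/-- A section of a separated morphism is a closed immersion. -/
lemma isClosed_singleton_underlyingPoint (a : k) :
    IsClosed ({underlyingPoint (S.point a)} : Set S.C) := by
  have : IsClosedImmersion (S.point a ≫ S.f) := by
    rw [point_comp_f]
    infer_instance
  have := IsClosedImmersion.of_comp (S.point a) S.f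
  convert (S.point a).isClosedEmbedding.isClosed_range
  refine Set.Subset.antisymm ?_ ?_
  · rintro _ rfl
    exact ⟨_, rfl⟩
  · rintro _ ⟨x, rfl⟩
    have : x = IsLocalRing.closedPoint k := Subsingleton.elim (α := PrimeSpectrum k) _ _
    rw [this]
    rfl

/-- The complement of a rational point. -/
def complPoint (a : k) : S.C.Opens :=
  ⟨{underlyingPoint (S.point a)}ᶜ, (S.isClosed_singleton_underlyingPoint a).isOpen_compl⟩

variable {I : Type*} {ι : I → k} {g : k[X]} (hgι : ∀ i, g.eval (ι i) = 0)
  (hgB : ∀ p, g * p ∈ B) (hroot : ∀ q : Spec (.of k[X]), g ∈ q.asIdeal →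
    ∃ i, X - Polynomial.C (ι i) ∈ q.asIdeal)
  (hB : ∀ p ∈ B, ∀ i j, p.eval (ι i) = p.eval (ι j)) (i₀ : I)

include hB in
lemma point_eq (i j : I) : S.point (ι i) = S.point (ι j) := by
  rw [point, point]
  congr 3
  ext p
  exact hB p p.2 i j

include hgι hgB hroot in
-- `g` belongs to `B` and vanishes at the singular point, so it vanishes at every preimage.
lemma exists_of_π_affineChart_eq {q : Spec (.of k[X])}
    (hq : S.π (affineChart k q) = underlyingPoint (S.point (ι i₀))) : g ∈ q.asIdeal ∧
      ∃ i, affinePoint (ι i) = affineChart k q := by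
  rw [← Scheme.Hom.comp_apply, ← S.isPullback_b₀.w, Scheme.Hom.comp_apply] at hq
  have hq' := S.b₀.isOpenEmbedding.injective (hq.trans (Scheme.Hom.comp_apply _ S.b₀ _))
  have hg : g ∈ q.asIdeal := by
    have h1 := (mem_asIdeal_SpecMap_closedPoint
      ((Polynomial.evalRingHom (ι i₀)).comp B.val.toRingHom) ⟨g, by simpa using hgB 1⟩).mpr (hgι i₀)
    rw [← hq'] at h1
    exact h1
  obtain ⟨i, hi⟩ := hroot q hg
  refine ⟨hg, i, ?_⟩
  rw [← eq_SpecMap_evalRingHom_of_mem hi]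
  exact Scheme.Hom.comp_apply _ _ _

include hgι hgB hroot hB in
lemma preimage_underlyingPoint : S.π ⁻¹' {underlyingPoint (S.point (ι i₀))} =
    Set.range fun i ↦ affinePoint (ι i) := by
  refine Set.Subset.antisymm ?_ ?_
  · intro z hz
    have hz' : z ∈ Set.range (affineChart k) := by
      rw [range_snd_of_isPullback S.isPullback_b₀, Set.mem_preimage, Set.mem_singleton_iff.mp hz]
      exact ⟨_, rfl⟩
    obtain ⟨q, rfl⟩ := hz'
    exact (S.exists_of_π_affineChart_eq hgι hgB hroot i₀ hz).2
  · rintro _ ⟨i, rfl⟩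
    rw [Set.mem_preimage, Set.mem_singleton_iff, π_affinePoint, S.point_eq hB i i₀]

include hgι hgB hroot hB in
lemma affineChart_preimage_complPoint :
    affineChart k ⁻¹ᵁ (S.π ⁻¹ᵁ S.complPoint (ι i₀)) =
      (PrimeSpectrum.basicOpen g : (Spec (.of k[X])).Opens) := by
  ext q
  refine not_congr ⟨fun hq ↦ (S.exists_of_π_affineChart_eq hgι hgB hroot i₀ hq).1, fun hq ↦ ?_⟩
  obtain ⟨i, hi⟩ := hroot q hq
  have h1 := S.π_affinePoint (ι i)
  rw [S.point_eq hB i i₀] at h1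
  rw [← eq_SpecMap_evalRingHom_of_mem hi]
  exact (congrArg S.π (Scheme.Hom.comp_apply _ (affineChart k) _)).symm.trans h1

include hgB in
-- `B` and `k[x]` have the same localization at `g`: a fraction `p / g ^ n` equals `g * p / g ^ (n +
-- 1)`, whose numerator is in `B`.
lemma isOpenImmersion_SpecMap_away (hg0 : g ≠ 0) : IsOpenImmersion
    (Spec.map (CommRingCat.ofHom (algebraMap k[X] (Localization.Away g))) ≫
      Spec.map (CommRingCat.ofHom B.val.toRingHom)) := by
  let gB : B := ⟨g, by simpa using hgB 1⟩
  let := ((algebraMap k[X] (Localization.Away g)).comp B.val.toRingHom).toAlgebra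
  have hinj : Function.Injective (algebraMap k[X] (Localization.Away g)) :=
    IsLocalization.injective _ (powers_le_nonZeroDivisors_of_noZeroDivisors hg0)
  have hmap (b : B) : algebraMap B (Localization.Away g) b =
    algebraMap k[X] (Localization.Away g) b := rfl
  have : IsLocalization.Away gB (Localization.Away g) := by
    refine IsLocalization.Away.mk (S := Localization.Away g) gB ?_ ?_ ?_
    · exact IsLocalization.Away.algebraMap_isUnit g
    · intro t
      obtain ⟨n, p, hp⟩ := IsLocalization.Away.surj g t
      refine ⟨n + 1, ⟨g * p, hgB p⟩, ?_⟩
      rw [hmap, hmap, pow_succ, ← mul_assoc, hp, map_mul, mul_comm]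
    · intro a b hab
      exact ⟨0, by simpa using Subtype.ext (hinj hab)⟩
  rw [← Spec.map_comp, ← CommRingCat.ofHom_comp]
  exact IsOpenImmersion.of_isLocalization (S := Localization.Away g) gB

lemma isPullback_b₀_restrict (V : (projSpace k 1).Opens) : IsPullback
    ((affineChart k ⁻¹ᵁ V).ι ≫ Spec.map (CommRingCat.ofHom B.val.toRingHom)) (affineChart k ∣_ V)
    S.b₀ (V.ι ≫ S.π) :=
  (isPullback_morphismRestrict (affineChart k) V).flip.paste_horiz S.isPullback_b₀

lemma isPullback_b₁_restrict (V : (projSpace k 1).Opens) : IsPullback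
    ((infChartAway h ⁻¹ᵁ V).ι ≫ 𝟙 _) (infChartAway h ∣_ V) S.b₁ (V.ι ≫ S.π) :=
  (isPullback_morphismRestrict (infChartAway h) V).flip.paste_horiz S.isPullback_b₁

include hgι hgB hroot hB in
-- Checked on the two charts: at finite distance it is the common localization at `g`, and at
-- infinity `π` is already an isomorphism.
lemma isOpenImmersion_ι_comp_π (hg0 : g ≠ 0) :
    IsOpenImmersion ((S.π ⁻¹ᵁ S.complPoint (ι i₀)).ι ≫ S.π) := by
  refine of_pair_of_isPullback (P := @IsOpenImmersion) S.b₀ S.b₁ S.opensRange_b₀_sup_opensRange_b₁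
    (S.isPullback_b₀_restrict _) (S.isPullback_b₁_restrict _) ?_ inferInstance
  have := isOpenImmersion_SpecMap_away hgB hg0
  let s := Spec.map (CommRingCat.ofHom (algebraMap k[X] (Localization.Away g)))
  rw [S.affineChart_preimage_complPoint hgι hgB hroot hB i₀,
    ← Scheme.Hom.opensRange_localizationAway (R := .of k[X]) g]
  have h1 : s.opensRange.ι = s.isoOpensRange.inv ≫ s := by simp
  change IsOpenImmersion (s.opensRange.ι ≫ _)
  rw [h1, Category.assoc]
  infer_instance

include hgι hgB hroot hB in
/-- The curve is the gluing of `Spec B` and of the complement of finitely many points of `ℙ¹`. -/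
lemma isGluing (hg0 : g ≠ 0) : IsGluing S.f S.π B S.b₀ (S.π ⁻¹ᵁ S.complPoint (ι i₀)) where
  comp_str := S.b₀_comp
  chart := S.isPullback_b₀.w.symm
  isOpenImmersion_left := inferInstance
  isOpenImmersion_right := S.isOpenImmersion_ι_comp_π hgι hgB hroot hB i₀ hg0
  cover := by
    refine Set.eq_univ_of_forall fun x ↦ ?_
    by_cases hx : x = underlyingPoint (S.point (ι i₀))
    · left
      rw [hx]
      exact ⟨_, (Scheme.Hom.comp_apply _ S.b₀ _).symm⟩
    · right
      obtain ⟨z, rfl⟩ := S.π.surjective x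
      exact ⟨⟨z, hx⟩, Scheme.Hom.comp_apply _ S.π _⟩
  isPullback := S.isPullback_b₀_restrict _

include hgι hgB hroot hB in
-- Over the complement of the singular point, `π` is a surjective open immersion, so smoothness is
-- inherited from `ℙ¹`.
lemma smooth_complPoint (hg0 : g ≠ 0) : Smooth ((S.complPoint (ι i₀)).ι ≫ S.f) := by
  have hopen := S.isOpenImmersion_ι_comp_π hgι hgB hroot hB i₀ hg0
  rw [← morphismRestrict_ι] at hopen
  have := IsOpenImmersion.of_comp (S.π ∣_ S.complPoint (ι i₀)) (S.complPoint (ι i₀)).ι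
  have : Surjective (S.π ∣_ S.complPoint (ι i₀)) := MorphismProperty.of_isPullback
    (P := @Surjective) (isPullback_morphismRestrict _ _).flip inferInstance
  have hiso : IsIso (S.π ∣_ S.complPoint (ι i₀)) :=
    (isIso_iff_isOpenImmersion_and_surjective _).mpr ⟨inferInstance, inferInstance⟩
  have h1 : (S.complPoint (ι i₀)).ι ≫ S.f = inv (S.π ∣_ S.complPoint (ι i₀)) ≫
      (S.π ⁻¹ᵁ S.complPoint (ι i₀)).ι ≫ projSpaceStr k 1 := by
    rw [IsIso.eq_inv_comp, morphismRestrict_ι_assoc, S.π_comp]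
  rw [h1]
  infer_instance

end CurveModel

end Point

end SingularCurve

end

noncomputable section

namespace SingularCurve

/-! ### Completed local rings -/

section Completion

variable {L : Type u} {A : Type v} [CommRing L] [CommRing A]

section

variable (I : Ideal L) (φ : L →+* A) (W : ℕ → Ideal A)
  (hdense : ∀ a j, ∃ l, a - φ l ∈ W j)

include hdense in
-- An element of `A` is sent to the class of any `l` approximating it modulo `W j`; by `hJ` two
-- approximations differ by an element of `J`.
lemma exists_ringHom_quotient {J : Ideal L} {j : ℕ} (hJ : ∀ l, φ l ∈ W j → l ∈ J) :
    ∃ f : A →+* L ⧸ J, ∀ a l, a - φ l ∈ W j → f a = Ideal.Quotient.mk J l := by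
  choose s hs using fun a ↦ hdense a j
  have key : ∀ a l, a - φ l ∈ W j → Ideal.Quotient.mk J (s a) = Ideal.Quotient.mk J l := by
    intro a l h
    refine Ideal.Quotient.eq.mpr (hJ _ ?_)
    have := sub_mem h (hs a)
    rwa [sub_sub_sub_cancel_left, ← map_sub] at this
  refine ⟨{ toFun a := Ideal.Quotient.mk J (s a), map_one' := ?_, map_mul' := ?_, map_zero' := ?_,
            map_add' := ?_ }, key⟩
  · exact (key _ 1 (by simp)).trans (map_one _)
  · intro a b
    rw [← map_mul]
    refine key _ _ ?_
    have h : a * b - φ (s a * s b) = (a - φ (s a)) * b + φ (s a) * (b - φ (s b)) := by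
      rw [map_mul]; ring
    rw [h]
    exact add_mem (Ideal.mul_mem_right _ _ (hs a)) (Ideal.mul_mem_left _ _ (hs b))
  · exact (key _ 0 (by simp)).trans (map_zero _)
  · intro a b
    rw [← map_add]
    refine key _ _ ?_
    have h : a + b - φ (s a + s b) = (a - φ (s a)) + (b - φ (s b)) := by
      rw [map_add]; ring
    rw [h]
    exact add_mem (hs a) (hs b)

include hdense in
/-- A ring that is complete for a filtration by ideals is the adic completion of a dense subring
on which the filtration induces the adic topology. -/
theorem exists_adicCompletion_ringEquiv (hanti : Antitone W)
    (hle : ∀ j l, l ∈ I ^ j → φ l ∈ W j) (hge : ∀ j, ∃ m, ∀ l, φ l ∈ W m → l ∈ I ^ j)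
    (hsep : ∀ a, (∀ j, a ∈ W j) → a = 0)
    (hlim : ∀ a : ℕ → A, (∀ j, a (j + 1) - a j ∈ W j) → ∃ b, ∀ j, b - a j ∈ W j) :
    ∃ e : AdicCompletion I L ≃+* A, ∀ l, e (algebraMap L _ l) = φ l := by
  -- Requiring `j ≤ m` makes an approximation modulo `W (m j)` also one modulo `W j`, as injectivity
  -- needs; surjectivity uses it to compare the lifts at levels `m j` and `j`.
  have hge' : ∀ j, ∃ m, j ≤ m ∧ ∀ l, φ l ∈ W m → l ∈ I ^ j := fun j ↦ by
    obtain ⟨m, hm⟩ := hge j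
    exact ⟨max j m, le_max_left _ _, fun l hl ↦ hm l (hanti (le_max_right _ _) hl)⟩
  choose m hjm hm using hge'
  choose f hf using fun j ↦ exists_ringHom_quotient φ W hdense (hm j)
  have hcompat : ∀ {i j : ℕ} (hij : i ≤ j),
      (Ideal.Quotient.factorPow I hij).comp (f j) = f i := by
    intro i j hij
    ext a
    obtain ⟨l, hl⟩ := hdense a (max (m i) (m j))
    rw [RingHom.comp_apply, hf j a l (hanti (le_max_right _ _) hl),
      hf i a l (hanti (le_max_left _ _) hl)]
    rfl
  let Φ : A →+* AdicCompletion I L := AdicCompletion.liftRingHom I f hcompat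
  have hΦ : ∀ j a, AdicCompletion.evalₐ I j (Φ a) = f j a := fun j a ↦
    AdicCompletion.evalₐ_liftRingHom I f hcompat j a
  have hinj : Function.Injective Φ := by
    rw [injective_iff_map_eq_zero]
    intro a ha
    refine hsep a fun j ↦ ?_
    obtain ⟨l, hl⟩ := hdense a (m j)
    have h1 : f j a = 0 := by rw [← hΦ, ha, map_zero]
    rw [hf j a l hl, Ideal.Quotient.eq_zero_iff_mem] at h1
    simpa using add_mem (hanti (hjm j) hl) (hle j l h1)
  have hsurj : Function.Surjective Φ := by
    intro y
    -- Lifts of the components of `y` form a Cauchy sequence in `A` under `φ`; its limit is the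
    -- preimage of `y`.
    choose l hl using fun j ↦ Ideal.Quotient.mk_surjective (AdicCompletion.evalₐ I j y)
    have hstep : ∀ i j, i ≤ j → Ideal.Quotient.mk (I ^ i) (l j) = Ideal.Quotient.mk (I ^ i) (l i) := by
      intro i j hij
      obtain ⟨s, rfl⟩ := AdicCompletion.mk_surjective I L y
      have h1 := hl j
      have h2 := hl i
      rw [AdicCompletion.evalₐ_mk] at h1 h2
      rw [h2, ← AdicCompletion.Ideal.mk_eq_mk I hij s]
      exact Ideal.Quotient.eq.mpr (Ideal.pow_le_pow_right hij (Ideal.Quotient.eq.mp h1))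
    obtain ⟨a, ha⟩ := hlim (fun j ↦ φ (l j)) fun j ↦ by
      rw [← map_sub]
      exact hle _ _ (Ideal.Quotient.eq.mp (hstep j (j + 1) j.le_succ))
    refine ⟨a, AdicCompletion.ext_evalₐ fun j ↦ ?_⟩
    rw [hΦ, hf j a _ (ha (m j)), hstep _ _ (hjm j), hl]
  refine ⟨(RingEquiv.ofBijective Φ ⟨hinj, hsurj⟩).symm, fun l ↦ ?_⟩
  rw [RingEquiv.symm_apply_eq]
  refine AdicCompletion.ext_evalₐ fun j ↦ ?_
  refine Eq.trans ?_ (hΦ j (φ l)).symm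
  rw [hf j (φ l) l (by simp)]
  exact AdicCompletion.evalₐ_of I j l

end

/-- The adic completion of the localization of `B` at a prime `𝔫`, for `B` dense in a complete
ring `A` in which the elements outside `𝔫` are invertible. -/
theorem exists_adicCompletion_localization_ringEquiv {B : Type w} [CommRing B] [Algebra B L]
    (𝔫 : Ideal B) [𝔫.IsPrime] [IsLocalization.AtPrime L 𝔫] [IsLocalRing L] (ψ : B →+* A)
    (W : ℕ → Ideal A) (hdense : ∀ a j, ∃ b, a - ψ b ∈ W j) (hanti : Antitone W)
    (hunit : ∀ b, b ∉ 𝔫 → IsUnit (ψ b))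
    (hle : ∀ j b, b ∈ 𝔫 ^ j → ψ b ∈ W j) (hge : ∀ j, ∃ m, ∀ b, ψ b ∈ W m → b ∈ 𝔫 ^ j)
    (hsep : ∀ a, (∀ j, a ∈ W j) → a = 0)
    (hlim : ∀ a : ℕ → A, (∀ j, a (j + 1) - a j ∈ W j) → ∃ b, ∀ j, b - a j ∈ W j) :
    ∃ e : AdicCompletion (IsLocalRing.maximalIdeal L) L ≃+* A,
      ∀ b, e (algebraMap L _ (algebraMap B L b)) = ψ b := by
  let φ : L →+* A := IsLocalization.lift (M := 𝔫.primeCompl) (g := ψ) fun y ↦ hunit y y.2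
  have hφ : ∀ b, φ (algebraMap B L b) = ψ b := fun b ↦ IsLocalization.lift_eq _ b
  have hmax : ∀ j, IsLocalRing.maximalIdeal L ^ j = (𝔫 ^ j).map (algebraMap B L) := fun j ↦ by
    rw [← IsLocalization.AtPrime.map_eq_maximalIdeal 𝔫 L, Ideal.map_pow]
  obtain ⟨e, he⟩ := exists_adicCompletion_ringEquiv (IsLocalRing.maximalIdeal L) φ W
    (fun a j ↦ by
      obtain ⟨b, hb⟩ := hdense a j
      exact ⟨algebraMap B L b, by rwa [hφ]⟩) hanti
    (fun j l hl ↦ by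
      rw [hmax, ← Ideal.mem_comap (f := φ)] at *
      have : (𝔫 ^ j).map (algebraMap B L) ≤ (W j).comap φ := Ideal.map_le_iff_le_comap.mpr
        fun b hb ↦ by simpa [hφ] using hle j b hb
      exact this hl)
    (fun j ↦ by
      obtain ⟨m, hm⟩ := hge j
      refine ⟨m, fun l hl ↦ ?_⟩
      obtain ⟨⟨b, s⟩, hbs⟩ := IsLocalization.surj 𝔫.primeCompl l
      have h1 : ψ b ∈ W m := by
        rw [← hφ, ← hbs, map_mul]
        exact Ideal.mul_mem_right _ _ hl
      -- Denominators are units in `L`, so membership may be tested on numerators in `B`.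
      have h2 : l * algebraMap B L s ∈ IsLocalRing.maximalIdeal L ^ j := by
        rw [hbs, hmax]
        exact Ideal.mem_map_of_mem _ (hm b h1)
      exact (Ideal.mul_unit_mem_iff_mem _ (IsLocalization.map_units L s)).mp h2)
    hsep hlim
  exact ⟨e, fun b ↦ by rw [he, hφ]⟩

end Completion

/-! ### Local rings of a scheme at a point of an affine open subscheme -/

section Stalk

variable {k : Type u} [Field k] {R : Type u} [CommRing R] [Algebra k R]

lemma scalarsToStalk_stalkMap {C : Scheme.{u}} (f : C ⟶ Spec (.of k)) (b : Spec (.of R) ⟶ C)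
    (hb : b ≫ f = Spec.map (CommRingCat.ofHom (algebraMap k R))) (x : Spec (.of R)) (c : k) :
    (b.stalkMap x).hom (scalarsToStalk f (b x) c) =
      ((Scheme.ΓSpecIso (.of R)).inv ≫ (Spec (.of R)).presheaf.germ ⊤ x trivial).hom
        (algebraMap k R c) := by
  have key : ((Scheme.ΓSpecIso (.of k)).inv ≫ f.appTop ≫ C.presheaf.germ ⊤ (b x) trivial) ≫
      b.stalkMap x = CommRingCat.ofHom (algebraMap k R) ≫ (Scheme.ΓSpecIso (.of R)).inv ≫
        (Spec (.of R)).presheaf.germ ⊤ x trivial := by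
    have h0 : C.presheaf.germ ⊤ (b x) trivial ≫ b.stalkMap x =
      b.appTop ≫ (Spec (.of R)).presheaf.germ ⊤ x trivial := Scheme.Hom.germ_stalkMap b ⊤ x trivial
    rw [Category.assoc, Category.assoc, h0, ← Scheme.Hom.comp_appTop_assoc, hb,
      ← Scheme.ΓSpecIso_inv_naturality_assoc]
  exact congr($(key).hom c)

lemma exists_isLocalization_stalk {C : Scheme.{u}} (f : C ⟶ Spec (.of k)) (b : Spec (.of R) ⟶ C)
    [IsOpenImmersion b] (hb : b ≫ f = Spec.map (CommRingCat.ofHom (algebraMap k R)))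
    (x : PrimeSpectrum R) (y : C) (h : b (x : Spec (.of R)) = y) :
    ∃ θ : R →+* C.presheaf.stalk y,
      (letI := θ.toAlgebra; IsLocalization.AtPrime (C.presheaf.stalk y) x.asIdeal) ∧
      ∀ c : k, θ (algebraMap k R c) = scalarsToStalk f y c := by
  subst h
  let x' : Spec (.of R) := x
  let e : (Spec (.of R)).presheaf.stalk x' ≃+* C.presheaf.stalk (b x') :=
    (asIso (b.stalkMap x')).commRingCatIsoToRingEquiv.symm
  let θ₀ : R →+* (Spec (.of R)).presheaf.stalk x' := (StructureSheaf.toStalk R x).hom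
  refine ⟨e.toRingHom.comp θ₀, ?_, fun c ↦ ?_⟩
  · let := θ₀.toAlgebra
    let : Algebra R (C.presheaf.stalk (b x')) := (e.toRingHom.comp θ₀).toAlgebra
    have : IsLocalization.AtPrime ((Spec (.of R)).presheaf.stalk x') x.asIdeal :=
      StructureSheaf.IsLocalization.to_stalk R x
    exact IsLocalization.isLocalization_of_algEquiv x.asIdeal.primeCompl
      (AlgEquiv.ofRingEquiv (f := e) fun r ↦ rfl)
  · change e (θ₀ (algebraMap k R c)) = _
    rw [← RingEquiv.eq_symm_apply]
    exact (scalarsToStalk_stalkMap f b hb x' c).symm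

/-- The completed local ring at a point of an affine open subscheme `Spec R`, for `R` dense in a
complete ring `A` in which the functions not vanishing at the point are invertible. -/
theorem completedLocalRingIso_of_dense {C : Scheme.{u}} (f : C ⟶ Spec (.of k))
    (b : Spec (.of R) ⟶ C) [IsOpenImmersion b]
    (hb : b ≫ f = Spec.map (CommRingCat.ofHom (algebraMap k R)))
    (x : PrimeSpectrum R) (y : C) (h : b (x : Spec (.of R)) = y)
    {A : Type v} [CommRing A] [Algebra k A] (ψ : R →ₐ[k] A)
    (W : ℕ → Ideal A) (hdense : ∀ a j, ∃ b, a - ψ b ∈ W j) (hanti : Antitone W)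
    (hunit : ∀ b, b ∉ x.asIdeal → IsUnit (ψ b))
    (hle : ∀ j b, b ∈ x.asIdeal ^ j → ψ b ∈ W j)
    (hge : ∀ j, ∃ m, ∀ b, ψ b ∈ W m → b ∈ x.asIdeal ^ j)
    (hsep : ∀ a, (∀ j, a ∈ W j) → a = 0)
    (hlim : ∀ a : ℕ → A, (∀ j, a (j + 1) - a j ∈ W j) → ∃ b, ∀ j, b - a j ∈ W j) :
    CompletedLocalRingIso f y A := by
  obtain ⟨θ, hθ, hc⟩ := exists_isLocalization_stalk f b hb x y h
  let := θ.toAlgebra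
  obtain ⟨e, he⟩ := exists_adicCompletion_localization_ringEquiv (L := C.presheaf.stalk y)
    x.asIdeal ψ.toRingHom W hdense hanti hunit hle hge hsep hlim
  refine ⟨e, fun c ↦ ?_⟩
  rw [← hc]
  exact (he _).trans (ψ.commutes c)

end Stalk

end SingularCurve

end

noncomputable section

namespace SingularCurve

open WithZero (exp log)

/-! ### Complete discretely valued fields and totally ramified extensions -/

section Valuation

lemma lt_exp_add_one_iff {x : ℤᵐ⁰} {m : ℤ} : x < exp (m + 1) ↔ x ≤ exp m := by
  rw [WithZero.exp_add, WithZero.lt_mul_exp_iff_le WithZero.exp_ne_zero]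

lemma lt_one_iff_le_exp {x : ℤᵐ⁰} : x < 1 ↔ x ≤ exp (-1) := by
  rw [← lt_exp_add_one_iff, neg_add_cancel, WithZero.exp_zero]

lemma exp_pow (m : ℤ) (n : ℕ) : (exp m : ℤᵐ⁰) ^ n = exp (n * m) := by
  rw [← WithZero.exp_nsmul, nsmul_eq_mul]

lemma ne_zero_of_map_eq_exp {K : Type v} [Field K] {vK : Valuation K ℤᵐ⁰} {a : K} {m : ℤ}
    (h : vK a = exp m) : a ≠ 0 :=
  (Valuation.ne_zero_iff vK).mp (h ▸ WithZero.exp_ne_zero)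

/-- A discretely valued field over `k` whose residue field is `k` and in which Cauchy sequences
converge. -/
structure IsCompleteOver (k : Type u) {K : Type v} [Field k] [Field K] [Algebra k K]
    (vK : Valuation K ℤᵐ⁰) : Prop where
  map_algebraMap_le_one : ∀ a : k, vK (algebraMap k K a) ≤ 1
  residue : ∀ y : K, vK y ≤ 1 → ∃ a : k, vK (y - algebraMap k K a) < 1
  exists_limit : ∀ x : ℕ → K, (∀ m : ℕ, vK (x (m + 1) - x m) ≤ exp (-m : ℤ)) →
    ∃ y, ∀ m : ℕ, vK (y - x m) ≤ exp (-m : ℤ)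

lemma IsCompleteOver.map_algebraMap {k : Type u} {K : Type v} [Field k] [Field K] [Algebra k K]
    {vK : Valuation K ℤᵐ⁰} (h : IsCompleteOver k vK) {a : k} (ha : a ≠ 0) :
    vK (algebraMap k K a) = 1 := by
  refine le_antisymm (h.map_algebraMap_le_one a) ?_
  have h1 := h.map_algebraMap_le_one a⁻¹
  rw [map_inv₀, map_inv₀] at h1
  exact (inv_le_one₀ (zero_lt_iff.mpr (by simpa using ha))).mp h1

lemma map_sub_le_of_step {K : Type v} [Field K] (vK : Valuation K ℤᵐ⁰) {x : ℕ → K}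
    (h : ∀ m : ℕ, vK (x (m + 1) - x m) ≤ exp (-m : ℤ)) {i j : ℕ} (hij : i ≤ j) :
    vK (x j - x i) ≤ exp (-i : ℤ) := by
  induction j, hij using Nat.le_induction with
  | base => simp
  | succ j hij ih =>
    have h1 : x (j + 1) - x i = (x (j + 1) - x j) + (x j - x i) := by ring
    rw [h1]
    refine vK.map_add_le ((h j).trans ?_) ih
    rw [WithZero.exp_le_exp]
    omega

end Valuation

/-! ### Adic completeness of a local field in terms of Cauchy sequences -/

section LocalField

variable {k : Type u} {F : Type v} [Field k] [Field F] [Algebra k F]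
  {vF : Valuation F ℤᵐ⁰}

lemma mem_maximalIdeal_pow_iff (hF : Function.Surjective vF) (m : ℕ) (a : vF.valuationSubring) :
    a ∈ IsLocalRing.maximalIdeal vF.valuationSubring ^ m ↔ vF a ≤ exp (-m : ℤ) := by
  have hmax : ∀ a : vF.valuationSubring,
      a ∈ IsLocalRing.maximalIdeal vF.valuationSubring ↔ vF a ≤ exp (-1) := fun a ↦ by
    rw [← lt_one_iff_le_exp]
    exact Valuation.mem_maximalIdeal_iff F vF
  constructor
  · intro h
    induction m generalizing a with
    | zero =>
      rw [Nat.cast_zero, neg_zero, WithZero.exp_zero]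
      exact a.2
    | succ m ih =>
      rw [pow_succ] at h
      induction h using Submodule.mul_induction_on' with
      | mem_mul_mem x hx y hy =>
        have h1 := mul_le_mul' (ih x hx) ((hmax y).mp hy)
        rw [← WithZero.exp_add] at h1
        simpa [neg_add, add_comm] using h1
      | add x _ y _ hx hy => exact vF.map_add_le hx hy
  · intro h
    obtain ⟨π, hπ⟩ := hF (exp (-1))
    have hπ0 : π ≠ 0 := ne_zero_of_map_eq_exp hπ
    let π' : vF.valuationSubring := ⟨π, by
      change vF π ≤ 1
      exact hπ.le.trans (lt_one_iff_le_exp.mpr le_rfl).le⟩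
    have hπm : vF (π ^ m) = exp (-m : ℤ) := by rw [map_pow, hπ, exp_pow]; simp
    have hb : vF ((a : F) / π ^ m) ≤ 1 := by
      rw [map_div₀, hπm]
      exact (div_le_one₀ WithZero.exp_pos).mpr h
    have h1 : a = π' ^ m * ⟨(a : F) / π ^ m, hb⟩ := by
      ext
      push_cast
      change (a : F) = π ^ m * _
      field_simp
    rw [h1]
    exact Ideal.mul_mem_right _ _ (Ideal.pow_mem_pow ((hmax π').mpr hπ.le) _)

lemma IsLocalField.isCompleteOver (hF : IsLocalField k vF) : IsCompleteOver k vF where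
  map_algebraMap_le_one := hF.algebraMap_le_one
  residue := hF.residue
  exists_limit x hx := by
    -- `x 0` need not be integral; subtracting it moves the sequence into the valuation ring.
    have hle : ∀ m, vF (x m - x 0) ≤ 1 := fun m ↦ by
      simpa using map_sub_le_of_step vF hx m.zero_le
    have := hF.complete.toIsPrecomplete
    obtain ⟨y, hy⟩ := IsPrecomplete.prec this (f := fun m ↦ ⟨x m - x 0, hle m⟩) fun {m n} hmn ↦ by
      rw [SModEq.sub_mem, smul_eq_mul, Ideal.mul_top, mem_maximalIdeal_pow_iff hF.surjective]
      have h1 := map_sub_le_of_step vF hx hmn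
      rw [Valuation.map_sub_swap] at h1
      simpa using h1
    refine ⟨y + x 0, fun m ↦ ?_⟩
    have h1 := hy m
    rw [SModEq.sub_mem, smul_eq_mul, Ideal.mul_top, mem_maximalIdeal_pow_iff hF.surjective,
      ← Valuation.map_neg] at h1
    refine Eq.trans_le (congrArg vF ?_) h1
    push_cast
    ring

end LocalField

/-! ### Expansions in powers of a uniformizer -/

section TotallyRamified

variable {F : Type v} {E : Type w} [Field F] [Field E] [Algebra F E]
  {vF : Valuation F ℤᵐ⁰} {vE : Valuation E ℤᵐ⁰} (hE : IsTotallyRamified vF vE)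
  {ϖ : E} (hϖ : vE ϖ = exp (-1))

include hE hϖ

lemma IsTotallyRamified.map_mul_pow {a : F} (ha : a ≠ 0) (j : ℕ) :
    vE (algebraMap F E a * ϖ ^ j) = exp (Module.finrank F E * log (vF a) - j) := by
  have h1 : vF a = exp (log (vF a)) := (WithZero.exp_log (by simpa using ha)).symm
  rw [map_mul, hE.map_algebraMap, map_pow, hϖ, exp_pow, sub_eq_add_neg, WithZero.exp_add]
  conv_lhs => rw [h1]
  rw [exp_pow]
  simp

/-- The orders of the nonzero terms are distinct modulo `[E : F]`, so no cancellation occurs and the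
sum has the valuation of its largest term. -/
lemma IsTotallyRamified.map_term_le (a : Fin (Module.finrank F E) → F)
    (i : Fin (Module.finrank F E)) :
    vE (algebraMap F E (a i) * ϖ ^ (i : ℕ)) ≤ vE (∑ j, algebraMap F E (a j) * ϖ ^ (j : ℕ)) := by
  have : Nonempty (Fin (Module.finrank F E)) := ⟨i⟩
  set t : Fin (Module.finrank F E) → E := fun j ↦ algebraMap F E (a j) * ϖ ^ (j : ℕ) with ht
  obtain ⟨m, hm⟩ := Finite.exists_max fun j ↦ vE (t j)
  by_cases h0 : vE (t m) = 0
  · have := (hm i).trans h0.le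
    exact this.trans zero_le
  refine (hm i).trans ?_
  have hϖ0 : ϖ ≠ 0 := ne_zero_of_map_eq_exp hϖ
  have hlt : ∀ j ∈ Finset.univ.erase m, vE (t j) < vE (t m) := fun j hj ↦ by
    refine lt_of_le_of_ne (hm j) fun heq ↦ (Finset.mem_erase.mp hj).1 ?_
    have ham : a m ≠ 0 := fun h ↦ h0 (by simp [ht, h])
    have haj : a j ≠ 0 := fun h ↦ h0 (by rw [← heq]; simp [ht, h])
    simp only [ht] at heq
    rw [hE.map_mul_pow hϖ ham, hE.map_mul_pow hϖ haj] at heq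
    have h1 := congrArg log heq
    simp only [WithZero.log_exp] at h1
    have hjlt : (j : ℤ) < Module.finrank F E := by exact_mod_cast j.2
    have hmlt : (m : ℤ) < Module.finrank F E := by exact_mod_cast m.2
    have h2 : (Module.finrank F E : ℤ) ∣ (j : ℤ) - m :=
      ⟨log (vF (a j)) - log (vF (a m)), by linear_combination -h1⟩
    have h3 : (j : ℤ) - m = 0 := Int.eq_zero_of_abs_lt_dvd h2 (by rw [abs_lt]; omega)
    exact Fin.ext (by omega)
  rw [← Finset.add_sum_erase _ _ (Finset.mem_univ m),
    Valuation.map_add_eq_of_lt_left _ (Valuation.map_sum_lt vE h0 hlt)]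

/-- Absence of cancellation makes the powers linearly independent, and their number is the degree.
-/
lemma IsTotallyRamified.exists_eq_sum [FiniteDimensional F E] (z : E) :
    ∃ a : Fin (Module.finrank F E) → F, ∑ j, algebraMap F E (a j) * ϖ ^ (j : ℕ) = z := by
  have hϖ0 : ϖ ≠ 0 := ne_zero_of_map_eq_exp hϖ
  have hli : LinearIndependent F fun j : Fin (Module.finrank F E) ↦ ϖ ^ (j : ℕ) := by
    rw [Fintype.linearIndependent_iff]
    intro a ha i
    simp only [Algebra.smul_def] at ha
    have h1 := hE.map_term_le hϖ a i
    rw [ha, map_zero, le_zero_iff, map_eq_zero] at h1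
    simpa [hϖ0] using h1
  have hspan := hli.span_eq_top_of_card_eq_finrank' (by simp)
  have hz : z ∈ Submodule.span F (Set.range fun j : Fin (Module.finrank F E) ↦ ϖ ^ (j : ℕ)) := by
    rw [hspan]; trivial
  rw [Submodule.mem_span_range_iff_exists_fun] at hz
  obtain ⟨a, ha⟩ := hz
  exact ⟨a, by simpa only [Algebra.smul_def] using ha⟩

/-- Each term satisfies `n * log (vF (a i)) - i ≤ n * D` with `i < n = [E : F]`, and integrality
removes the `i`. -/
lemma IsTotallyRamified.map_coeff_le {a : Fin (Module.finrank F E) → F} {D : ℤ}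
    (h : vE (∑ j, algebraMap F E (a j) * ϖ ^ (j : ℕ)) ≤ exp (Module.finrank F E * D))
    (i : Fin (Module.finrank F E)) : vF (a i) ≤ exp D := by
  by_cases ha : a i = 0
  · simp [ha]
  have h1 := (hE.map_term_le hϖ a i).trans h
  rw [hE.map_mul_pow hϖ ha, WithZero.exp_le_exp] at h1
  rw [← WithZero.log_le_iff_le_exp (by simpa using ha)]
  have hi : (i : ℤ) < Module.finrank F E := by exact_mod_cast i.2
  by_contra! hc
  have : (Module.finrank F E : ℤ) * (D + 1) ≤ Module.finrank F E * log (vF (a i)) :=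
    mul_le_mul_of_nonneg_left hc (by positivity)
  linarith

lemma IsTotallyRamified.isCompleteOver [FiniteDimensional F E] {k : Type u} [Field k] [Algebra k F]
    [Algebra k E] [IsScalarTower k F E] (hF : IsCompleteOver k vF) : IsCompleteOver k vE := by
  have hn : 0 < Module.finrank F E := Module.finrank_pos
  have hϖ1 : ∀ j : ℕ, vE (ϖ ^ j) ≤ 1 := fun j ↦ by
    rw [map_pow, hϖ]
    exact pow_le_one' (lt_one_iff_le_exp.mpr le_rfl).le j
  refine ⟨fun c ↦ ?_, fun z hz ↦ ?_, fun z hz ↦ ?_⟩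
  · rw [IsScalarTower.algebraMap_apply k F E, hE.map_algebraMap]
    exact pow_le_one' (hF.map_algebraMap_le_one c) _
  · obtain ⟨a, rfl⟩ := hE.exists_eq_sum hϖ z
    have ha := hE.map_coeff_le hϖ (a := a) (D := 0) (by simpa using hz)
    -- Only the term `j = 0` contributes to the residue; the others have positive order.
    have key : ∀ j, ∃ c : k,
        vE (algebraMap F E (a j) * ϖ ^ (j : ℕ) - algebraMap k E c) < 1 := fun j ↦ by
      by_cases hj : (j : ℕ) = 0
      · obtain ⟨c, hc⟩ := hF.residue (a j) (by simpa using ha j)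
        refine ⟨c, ?_⟩
        rw [hj, pow_zero, mul_one, IsScalarTower.algebraMap_apply k F E, ← map_sub,
          hE.map_algebraMap]
        exact pow_lt_one' hc hn.ne'
      · refine ⟨0, ?_⟩
        rw [map_zero, sub_zero, map_mul, hE.map_algebraMap, map_pow, hϖ]
        exact (mul_le_of_le_one_left' (pow_le_one' (by simpa using ha j) _)).trans_lt
          (pow_lt_one' (lt_one_iff_le_exp.mpr le_rfl) hj)
    choose c hc using key
    refine ⟨∑ j, c j, ?_⟩
    rw [map_sum, ← Finset.sum_sub_distrib]
    exact Valuation.map_sum_lt vE one_ne_zero fun j _ ↦ hc j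
  · choose a ha using fun m ↦ hE.exists_eq_sum hϖ (z m)
    -- Precision `n * m` in `E` is precision `m` for coefficients in `F`, so the sequence is sampled
    -- at multiples of `n = [E : F]`.
    have hstep : ∀ j (m : ℕ), vF (a (Module.finrank F E * (m + 1)) j -
        a (Module.finrank F E * m) j) ≤ exp (-m : ℤ) := fun j m ↦ by
      refine hE.map_coeff_le hϖ (a := a (Module.finrank F E * (m + 1)) -
        a (Module.finrank F E * m)) ?_ j
      have h1 := map_sub_le_of_step vE hz
        (Nat.mul_le_mul_left (Module.finrank F E) (Nat.le_succ m))
      rw [← ha, ← ha, ← Finset.sum_sub_distrib] at h1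
      simpa [sub_mul] using h1
    choose y hy using fun j ↦ hF.exists_limit (fun m ↦ a (Module.finrank F E * m) j) (hstep j)
    refine ⟨∑ j, algebraMap F E (y j) * ϖ ^ (j : ℕ), fun m ↦ ?_⟩
    have h1 : vE (∑ j, algebraMap F E (y j) * ϖ ^ (j : ℕ) - z (Module.finrank F E * m)) ≤
        exp (-m : ℤ) := by
      rw [← ha, ← Finset.sum_sub_distrib]
      refine Valuation.map_sum_le vE fun j _ ↦ ?_
      rw [← sub_mul, ← map_sub, map_mul, hE.map_algebraMap]
      refine (mul_le_of_le_one_right' (hϖ1 j)).trans ((pow_le_pow_left' (hy j m) _).trans ?_)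
      rw [exp_pow, WithZero.exp_le_exp]
      nlinarith
    have h2 := map_sub_le_of_step vE hz (Nat.le_mul_of_pos_left m hn)
    have h3 := vE.map_add_le h1 h2
    simpa using h3

end TotallyRamified

end SingularCurve

end

noncomputable section

namespace SingularCurve

open WithZero (exp log)

/-! ### Expansions of polynomials at finitely many points -/

section Ball

variable {I : Type x} {E : I → Type w} [∀ i, Field (E i)] (v : ∀ i, Valuation (E i) ℤᵐ⁰)

/-- The families in `∏ E_i` all of whose entries have valuation at most `exp (-m)`. -/
def ball (m : ℕ) : AddSubgroup (∀ i, E i) where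
  carrier := {z | ∀ i, v i (z i) ≤ exp (-m : ℤ)}
  add_mem' ha hb i := (v i).map_add_le (ha i) (hb i)
  zero_mem' i := by simp
  neg_mem' ha i := by simpa using ha i

variable {v}

lemma mul_mem_ball {m n : ℕ} {y z : ∀ i, E i} (hy : y ∈ ball v m) (hz : z ∈ ball v n) :
    y * z ∈ ball v (m + n) := fun i ↦ by
  rw [Pi.mul_apply, map_mul]
  refine (mul_le_mul' (hy i) (hz i)).trans_eq ?_
  rw [← WithZero.exp_add]
  congr 1
  push_cast
  ring

lemma ball_anti {m n : ℕ} (h : m ≤ n) : ball v n ≤ ball v m := fun z hz i ↦ by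
  refine (hz i).trans ?_
  rw [WithZero.exp_le_exp]
  omega

lemma pow_mem_ball {z : ∀ i, E i} (hz : z ∈ ball v 1) (m : ℕ) : z ^ m ∈ ball v m := by
  induction m with
  | zero => intro i; simp
  | succ m ih => exact pow_succ z m ▸ mul_mem_ball ih hz

lemma eq_zero_of_forall_mem_ball {z : ∀ i, E i} (h : ∀ m, z ∈ ball v m) : z = 0 := by
  funext i
  by_contra h0
  obtain ⟨m, hm⟩ := WithZero.exists_exp_neg_natCast_lt ((Valuation.ne_zero_iff (v i)).mpr h0)
  exact absurd (h m i) (not_le.mpr hm)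

variable {k : Type u} [Field k] [∀ i, Algebra k (E i)]

lemma exists_limit_of_forall_isCompleteOver (hv : ∀ i, IsCompleteOver k (v i))
    (z : ℕ → ∀ i, E i) (hz : ∀ m, z (m + 1) - z m ∈ ball v m) : ∃ y, ∀ m, y - z m ∈ ball v m := by
  choose y hy using fun i ↦ (hv i).exists_limit (fun m ↦ z m i) fun m ↦ hz m i
  exact ⟨y, fun m i ↦ hy i m⟩

end Ball

/-! ### Order of vanishing and polynomial approximation -/

section Expansion

variable {k : Type u} [Field k] {K : Type w} [Field K] [Algebra k K] {vK : Valuation K ℤᵐ⁰}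

lemma IsCompleteOver.map_aeval_le_one (h : IsCompleteOver k vK) {z : K} (hz : vK z ≤ 1)
    (p : k[X]) : vK (aeval z p) ≤ 1 := by
  induction p using Polynomial.induction_on' with
  | add p q hp hq => rw [map_add]; exact vK.map_add_le hp hq
  | monomial n a =>
    rw [aeval_monomial, map_mul, map_pow]
    exact mul_le_one' (h.map_algebraMap_le_one a) (pow_le_one' hz n)

lemma IsCompleteOver.map_algebraMap_add_le_one (h : IsCompleteOver k vK) {ϖ : K}
    (hϖ : vK ϖ = exp (-1)) (a : k) : vK (algebraMap k K a + ϖ) ≤ 1 :=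
  vK.map_add_le (h.map_algebraMap_le_one a) (hϖ.trans_le (lt_one_iff_le_exp.mpr le_rfl).le)

lemma IsCompleteOver.map_aeval_sub_lt_one (h : IsCompleteOver k vK) {ϖ : K} (hϖ : vK ϖ = exp (-1))
    (a : k) (p : k[X]) :
    vK (aeval (algebraMap k K a + ϖ) p - algebraMap k K (p.eval a)) < 1 := by
  obtain ⟨q, hq⟩ := Polynomial.X_sub_C_dvd_sub_C_eval (a := a) (p := p)
  have h1 := congrArg (aeval (algebraMap k K a + ϖ)) hq
  simp only [map_sub, map_mul, aeval_C, aeval_X, add_sub_cancel_left] at h1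
  rw [h1, map_mul, hϖ]
  exact (mul_le_of_le_one_right' (h.map_aeval_le_one (h.map_algebraMap_add_le_one hϖ a) q)).trans_lt
    (lt_one_iff_le_exp.mpr le_rfl)

lemma IsCompleteOver.map_aeval_eq_one (h : IsCompleteOver k vK) {ϖ : K} (hϖ : vK ϖ = exp (-1))
    {a : k} {p : k[X]} (hp : p.eval a ≠ 0) : vK (aeval (algebraMap k K a + ϖ) p) = 1 := by
  have h1 := h.map_aeval_sub_lt_one hϖ a p
  rw [← h.map_algebraMap hp] at h1
  have h2 := Valuation.map_add_eq_of_lt_left vK h1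
  rwa [add_sub_cancel, h.map_algebraMap hp] at h2

/-- Write `p = (X - a) ^ r * q` with `q(a) ≠ 0`. Then `q(a + ϖ)` is a unit, so the expansion of `p`
has order exactly `r`. -/
lemma IsCompleteOver.X_sub_C_pow_dvd_iff (h : IsCompleteOver k vK) {ϖ : K} (hϖ : vK ϖ = exp (-1))
    {a : k} {p : k[X]} {m : ℕ} :
    (X - C a) ^ m ∣ p ↔ vK (aeval (algebraMap k K a + ϖ) p) ≤ exp (-m : ℤ) := by
  by_cases hp : p = 0
  · simp [hp]
  obtain ⟨q, hq, hdvd⟩ := Polynomial.exists_eq_pow_rootMultiplicity_mul_and_not_dvd p hp a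
  rw [← Polynomial.le_rootMultiplicity_iff hp]
  conv_rhs => rw [hq]
  have hqa : q.eval a ≠ 0 := fun h0 ↦ hdvd (Polynomial.dvd_iff_isRoot.mpr h0)
  rw [map_mul, map_mul, h.map_aeval_eq_one hϖ hqa, mul_one, map_pow, map_sub, aeval_X, aeval_C,
    add_sub_cancel_left, map_pow, hϖ, exp_pow, WithZero.exp_le_exp]
  omega

variable {I : Type x} {E : I → Type w} [∀ i, Field (E i)] [∀ i, Algebra k (E i)]
  {v : ∀ i, Valuation (E i) ℤᵐ⁰} {ι : I → k} {ϖ : ∀ i, E i}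

lemma expansion_apply (p : k[X]) (i : I) :
    expansion ι ϖ p i = aeval (algebraMap k (E i) (ι i) + ϖ i) p := by
  have := Polynomial.aeval_algHom_apply (Pi.evalAlgHom k E i)
    (fun i ↦ algebraMap k (E i) (ι i) + ϖ i) p
  exact this.symm

variable (hv : ∀ i, IsCompleteOver k (v i)) (hϖ : ∀ i, v i (ϖ i) = exp (-1))
  (hι : Function.Injective ι)

include hv hϖ

lemma expansion_sub_mem_ball_one (p : k[X]) {c : k} (h : ∀ i, p.eval (ι i) = c) :
    expansion ι ϖ p - algebraMap k _ c ∈ ball v 1 := fun i ↦ by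
  have := (hv i).map_aeval_sub_lt_one (hϖ i) (ι i) p
  rw [lt_one_iff_le_exp, h i] at this
  simpa [expansion_apply] using this

variable [Fintype I]

include hι

lemma expansion_mem_ball_iff {p : k[X]} {m : ℕ} :
    expansion ι ϖ p ∈ ball v m ↔ (∏ i, (X - C (ι i))) ^ m ∣ p := by
  have h1 : expansion ι ϖ p ∈ ball v m ↔ ∀ i, (X - C (ι i)) ^ m ∣ p :=
    forall_congr' fun i ↦ by rw [expansion_apply, (hv i).X_sub_C_pow_dvd_iff (hϖ i)]
  rw [h1, ← Finset.prod_pow]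
  refine ⟨fun h ↦ Fintype.prod_dvd_of_coprime (fun i j hij ↦ ?_) h,
    fun h i ↦ (Finset.dvd_prod_of_mem (fun i ↦ (X - C (ι i)) ^ m) (Finset.mem_univ i)).trans h⟩
  exact (Polynomial.isCoprime_X_sub_C_of_isUnit_sub
    (sub_ne_zero.mpr fun h ↦ hij (hι h)).isUnit).pow

lemma map_expansion_prod_pow (m : ℕ) (i : I) :
    v i (expansion ι ϖ ((∏ i, (X - C (ι i))) ^ m) i) = exp (-m : ℤ) := by
  classical
  have h1 : v i (expansion ι ϖ (∏ i, (X - C (ι i))) i) = exp (-1) := by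
    have h2 : (∏ j ∈ Finset.univ.erase i, (X - C (ι j))).eval (ι i) ≠ 0 := by
      rw [Polynomial.eval_prod]
      refine Finset.prod_ne_zero_iff.mpr fun j hj ↦ ?_
      rw [eval_sub, eval_X, eval_C, sub_ne_zero]
      exact fun h ↦ (Finset.mem_erase.mp hj).1 (hι h.symm)
    rw [expansion_apply, ← Finset.mul_prod_erase _ _ (Finset.mem_univ i), map_mul, map_mul,
      (hv i).map_aeval_eq_one (hϖ i) h2, mul_one, map_sub, aeval_X, aeval_C, add_sub_cancel_left,
      hϖ]
  rw [map_pow, Pi.pow_apply, map_pow, h1, exp_pow]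
  simp

/-- Approximation digit by digit: `∏ (X - ι i) ^ m` expands to order exactly `m` at every `i`, and a
Lagrange polynomial times it corrects all leading coefficients at once. -/
lemma exists_sub_expansion_mem_ball {z : ∀ i, E i} (hz : z ∈ ball v 0) (m : ℕ) :
    ∃ p : k[X], z - expansion ι ϖ p ∈ ball v m := by
  classical
  induction m with
  | zero => exact ⟨0, by simpa using hz⟩
  | succ m ih =>
    obtain ⟨p, hp⟩ := ih
    set g : k[X] := (∏ i, (X - C (ι i))) ^ m with hg
    have hgv : ∀ i, v i (expansion ι ϖ g i) = exp (-m : ℤ) := map_expansion_prod_pow hv hϖ hι m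
    have hg0 : ∀ i, expansion ι ϖ g i ≠ 0 := fun i ↦ ne_zero_of_map_eq_exp (hgv i)
    choose c hc using fun i ↦ (hv i).residue ((z - expansion ι ϖ p) i / expansion ι ϖ g i) (by
      rw [map_div₀, hgv]
      exact (div_le_one₀ WithZero.exp_pos).mpr (hp i))
    set q : k[X] := Lagrange.interpolate Finset.univ ι c with hq
    have hqc : ∀ i, q.eval (ι i) = c i := fun i ↦
      Lagrange.eval_interpolate_at_node c hι.injOn (Finset.mem_univ i)
    refine ⟨p + g * q, fun i ↦ ?_⟩
    have h1 := (hv i).map_aeval_sub_lt_one (hϖ i) (ι i) q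
    rw [hqc, ← expansion_apply, Valuation.map_sub_swap] at h1
    have h2 := (v i).map_add_lt (hc i) h1
    rw [sub_add_sub_cancel, lt_one_iff_le_exp] at h2
    have h3 : (z - expansion ι ϖ (p + g * q)) i = expansion ι ϖ g i *
        ((z - expansion ι ϖ p) i / expansion ι ϖ g i - expansion ι ϖ q i) := by
      rw [mul_sub, mul_div_cancel₀ _ (hg0 i)]
      simp only [map_add, map_mul, Pi.sub_apply, Pi.add_apply, Pi.mul_apply]
      ring
    rw [h3, map_mul, hgv]
    refine (mul_le_mul_right h2 _).trans_eq ?_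
    rw [← WithZero.exp_add]
    congr 1
    push_cast
    ring

end Expansion

end SingularCurve

end

noncomputable section

namespace SingularCurve

/-! ### Subalgebras of a product of complete fields with a conductor -/

section Conductor

variable {k : Type u} [Field k] {I : Type x} {E : I → Type w} [∀ i, Field (E i)]
  [∀ i, Algebra k (E i)] {v : ∀ i, Valuation (E i) ℤᵐ⁰}

/-- The subalgebra `A` contains all elements of large valuation, and consists of elements which are
congruent to a constant modulo elements of positive valuation. -/
structure IsUnibranchOrder (v : ∀ i, Valuation (E i) ℤᵐ⁰) (A : Subalgebra k (∀ i, E i)) (N : ℕ) :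
    Prop where
  pos : 0 < N
  mem_of_mem_ball : ∀ z ∈ ball v N, z ∈ A
  exists_sub_mem_ball : ∀ z ∈ A, ∃ c : k, z - algebraMap k _ c ∈ ball v 1

variable {A : Subalgebra k (∀ i, E i)} {N : ℕ} (hv : ∀ i, IsCompleteOver k (v i))
  (hA : IsUnibranchOrder v A N)

section

include hv

lemma algebraMap_mem_ball_zero (c : k) : algebraMap k (∀ i, E i) c ∈ ball v 0 := fun i ↦ by
  simpa using (hv i).map_algebraMap_le_one c

include hA

lemma IsUnibranchOrder.mem_ball_zero {z : ∀ i, E i} (hz : z ∈ A) : z ∈ ball v 0 := by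
  obtain ⟨c, hc⟩ := hA.exists_sub_mem_ball z hz
  simpa using add_mem (ball_anti zero_le_one hc) (algebraMap_mem_ball_zero hv c)

/-- Write `z = c * (1 - t)` with `t` of positive order and expand `1 / (1 - t)` geometrically; the
remainder `t ^ N * z⁻¹` has order at least `N`, hence is in `A`. -/
lemma IsUnibranchOrder.inv_mem {z : ∀ i, E i} (hz : z ∈ A) {c : k} (hc : c ≠ 0)
    (h : z - algebraMap k _ c ∈ ball v 1) : z⁻¹ ∈ A ∧ z * z⁻¹ = 1 := by
  have hz1 : ∀ i, v i (z i) = 1 := fun i ↦ by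
    have h1 : v i (z i - algebraMap k (E i) c) < v i (algebraMap k (E i) c) := by
      rw [(hv i).map_algebraMap hc, lt_one_iff_le_exp]
      exact h i
    have h2 := Valuation.map_add_eq_of_lt_left _ h1
    rwa [add_sub_cancel, (hv i).map_algebraMap hc] at h2
  have hz0 : ∀ i, z i ≠ 0 := fun i h0 ↦ by simpa [h0] using hz1 i
  have hmul : z * z⁻¹ = 1 := funext fun i ↦ mul_inv_cancel₀ (hz0 i)
  refine ⟨?_, hmul⟩
  set t : ∀ i, E i := 1 - algebraMap k _ c⁻¹ * z with ht
  have hcc : algebraMap k (∀ i, E i) c⁻¹ * algebraMap k _ c = 1 := by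
    rw [← map_mul, inv_mul_cancel₀ hc, map_one]
  have htA : t ∈ A := sub_mem (one_mem _) (mul_mem (algebraMap_mem _ _) hz)
  have htb : t ∈ ball v 1 := by
    have h1 : t = -(algebraMap k _ c⁻¹ * (z - algebraMap k _ c)) := by
      rw [ht, mul_sub, hcc]; ring
    rw [h1]
    simpa using neg_mem (mul_mem_ball (algebraMap_mem_ball_zero hv c⁻¹) h)
  have hzb : z⁻¹ ∈ ball v 0 := fun i ↦ by simp [hz1]
  have h2 : t ^ N * z⁻¹ ∈ A := hA.mem_of_mem_ball _ (by
    simpa using mul_mem_ball (pow_mem_ball htb N) hzb)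
  have h3 := mul_neg_geom_sum t N
  have h4 : z⁻¹ = algebraMap k _ c⁻¹ * ∑ j ∈ Finset.range N, t ^ j + t ^ N * z⁻¹ := by
    have h5 : 1 - t = algebraMap k _ c⁻¹ * z := by rw [ht]; ring
    rw [h5] at h3
    linear_combination (-z⁻¹) * h3 + (algebraMap k _ c⁻¹ * ∑ j ∈ Finset.range N, t ^ j) * hmul
  rw [h4]
  exact add_mem (mul_mem (algebraMap_mem _ _) (sum_mem fun j _ ↦ pow_mem htA j)) h2

end

/-- The filtration of `A` by the ideals of elements of valuation at least `m`. -/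
def filtration (h : ∀ z ∈ A, z ∈ ball v 0) (m : ℕ) : Ideal A where
  carrier := {a | a.1 ∈ ball v m}
  add_mem' ha hb := (ball v m).add_mem ha hb
  zero_mem' := (ball v m).zero_mem
  smul_mem' a b hb := by
    have := mul_mem_ball (h _ a.2) hb
    rwa [zero_add] at this

include hv hA

/-- The limit taken in the product of fields differs from `a N` by an element of `ball v N`, so it
stays in `A`. -/
lemma IsUnibranchOrder.exists_limit (h : ∀ z ∈ A, z ∈ ball v 0) (a : ℕ → A)
    (ha : ∀ j, a (j + 1) - a j ∈ filtration h j) : ∃ b, ∀ j, b - a j ∈ filtration h j := by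
  obtain ⟨y, hy⟩ := exists_limit_of_forall_isCompleteOver hv (fun j ↦ (a j).1) ha
  refine ⟨⟨y, ?_⟩, hy⟩
  simpa using add_mem (hA.mem_of_mem_ball _ (hy N)) (a N).2

variable {ι : I → k} {ϖ : ∀ i, E i} (hϖ : ∀ i, v i (ϖ i) = WithZero.exp (-1))
  (hι : Function.Injective ι)

include hϖ

/-- `p.eval (ι i)` is the residue of the `i`-th entry of the expansion, and an element of `A` has
the same residue in every entry. -/
lemma IsUnibranchOrder.eval_eq_eval {p : k[X]} (hp : expansion ι ϖ p ∈ A) (i j : I) :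
    p.eval (ι i) = p.eval (ι j) := by
  obtain ⟨c, hc⟩ := hA.exists_sub_mem_ball _ hp
  suffices h : ∀ i, p.eval (ι i) = c from (h i).trans (h j).symm
  intro i
  by_contra hne
  have h1 := (hv i).map_aeval_sub_lt_one (hϖ i) (ι i) p
  have h2 := hc i
  rw [Pi.sub_apply, Nat.cast_one, ← lt_one_iff_le_exp, expansion_apply, Valuation.map_sub_swap] at h2
  have h3 := (v i).map_add_lt h2 h1
  rw [Pi.algebraMap_apply, sub_add_sub_cancel, ← map_sub,
    (hv i).map_algebraMap (sub_ne_zero.mpr (Ne.symm hne))] at h3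
  exact lt_irrefl _ h3

variable [Fintype I]

include hι

lemma IsUnibranchOrder.mul_mem_comap (p : k[X]) :
    (∏ i, (X - C (ι i))) ^ N * p ∈ A.comap (expansion ι ϖ) :=
  hA.mem_of_mem_ball _ ((expansion_mem_ball_iff hv hϖ hι).mpr (dvd_mul_right _ _))

/-- The completion of the fibre product of `k[x]` and `A` at the singular point is `A`. -/
theorem IsUnibranchOrder.completedLocalRingIso {C : Scheme.{u}} (f : C ⟶ Spec (.of k))
    (b : Spec (.of (A.comap (expansion ι ϖ))) ⟶ C) [IsOpenImmersion b]
    (hb : b ≫ f = Spec.map (CommRingCat.ofHom (algebraMap k (A.comap (expansion ι ϖ)))))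
    (x : PrimeSpectrum (A.comap (expansion ι ϖ))) (y : C)
    (h : b (x : Spec (.of (A.comap (expansion ι ϖ)))) = y) (i₀ : I)
    (hx : ∀ p, p ∈ x.asIdeal ↔ p.1.eval (ι i₀) = 0) : CompletedLocalRingIso f y A := by
  have h0 : ∀ z ∈ A, z ∈ ball v 0 := fun z ↦ hA.mem_ball_zero hv
  set g : k[X] := ∏ i, (X - Polynomial.C (ι i)) with hg
  let ψ : A.comap (expansion ι ϖ) →ₐ[k] A :=
    ((expansion ι ϖ).comp (A.comap (expansion ι ϖ)).val).codRestrict A fun p ↦ p.2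
  have hgeval : ∀ i, g.eval (ι i) = 0 := fun i ↦ by
    rw [hg, Polynomial.eval_prod]
    exact Finset.prod_eq_zero (Finset.mem_univ i) (by simp)
  have hle : ∀ p, p ∈ x.asIdeal → ψ p ∈ filtration h0 1 := fun p hp ↦ by
    have h1 := expansion_sub_mem_ball_one (c := 0) hv hϖ p.1 fun i ↦
      (hA.eval_eq_eval hv hϖ p.2 i i₀).trans ((hx p).mp hp)
    rw [map_zero, sub_zero] at h1
    exact h1
  refine completedLocalRingIso_of_dense f b hb x y h ψ (filtration h0) ?_ ?_ ?_ ?_ ?_ ?_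
    (hA.exists_limit hv h0)
  · intro a j
    -- The extra `N` in the precision forces the approximating polynomial to lie in the fibre
    -- product.
    obtain ⟨p, hp⟩ := exists_sub_expansion_mem_ball hv hϖ hι (hA.mem_ball_zero hv a.2) (j + N)
    have hpA : expansion ι ϖ p ∈ A := by
      have := sub_mem a.2 (hA.mem_of_mem_ball _ (ball_anti (Nat.le_add_left N j) hp))
      rwa [sub_sub_cancel] at this
    exact ⟨⟨p, hpA⟩, ball_anti (Nat.le_add_right j N) hp⟩
  · exact fun m n hmn a ha ↦ ball_anti hmn ha
  · intro p hp
    rw [hx] at hp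
    have h1 := expansion_sub_mem_ball_one (c := p.1.eval (ι i₀)) hv hϖ p.1 fun i ↦
      hA.eval_eq_eval hv hϖ p.2 i i₀
    obtain ⟨h2, h3⟩ := hA.inv_mem hv p.2 hp h1
    exact IsUnit.of_mul_eq_one ⟨_, h2⟩ (Subtype.ext h3)
  · intro j
    induction j with
    | zero => exact fun p _ ↦ hA.mem_ball_zero hv p.2
    | succ j ih =>
      intro p hp
      rw [pow_succ] at hp
      induction hp using Submodule.mul_induction_on' with
      | mem_mul_mem p hp q hq =>
        rw [map_mul]
        exact mul_mem_ball (ih p hp) (hle q hq)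
      | add p _ q _ hp hq =>
        rw [map_add]
        exact add_mem hp hq
  · intro j
    -- Order `N * j` means divisibility by `(g ^ N) ^ j`. Each factor `g ^ N` lies in the maximal
    -- ideal; the cofactor `q` need not lie in the fibre product and is absorbed into the last
    -- factor.
    refine ⟨N * j, fun p hp ↦ ?_⟩
    obtain ⟨q, hq⟩ := (expansion_mem_ball_iff hv hϖ hι).mp hp
    cases j with
    | zero => simp
    | succ j =>
      have h1 : ∀ r : k[X], (⟨g ^ N * r, hA.mul_mem_comap hv hϖ hι r⟩ : A.comap (expansion ι ϖ)) ∈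
          x.asIdeal := fun r ↦ by
        rw [hx, eval_mul, eval_pow, hgeval, zero_pow hA.pos.ne', zero_mul]
      have h2 : p = ⟨g ^ N * 1, hA.mul_mem_comap hv hϖ hι 1⟩ ^ j *
          ⟨g ^ N * q, hA.mul_mem_comap hv hϖ hι q⟩ := by
        ext1
        push_cast
        refine hq.trans ?_
        rw [← hg, mul_one, pow_mul, pow_succ]
        ring
      rw [h2, pow_succ]
      exact Ideal.mul_mem_mul (Ideal.pow_mem_pow (h1 1) j) (h1 q)
  · exact fun a ha ↦ Subtype.ext (eq_zero_of_forall_mem_ball ha)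

end Conductor

end SingularCurve

end

noncomputable section

namespace SingularCurve

open WithZero (exp log)

/-! ### The conductor of `𝒪_F[γ_I]` -/

section Generation

variable {F : Type v} [Field F] {I : Type x} {E : I → Type w} [∀ i, Field (E i)]
  [∀ i, Algebra F (E i)] {γ : ∀ i, E i}

lemma aeval_pi_apply (p : F[X]) (i : I) : aeval γ p i = aeval (γ i) p :=
  (Polynomial.aeval_algHom_apply (Pi.evalAlgHom F E i) γ p).symm

variable [Fintype I] [∀ i, FiniteDimensional F (E i)]

/-- Chinese remainder theorem: primitive elements with distinct minimal polynomials generate the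
product of the fields that they generate. -/
lemma exists_aeval_eq (hgen : ∀ i, Algebra.adjoin F {γ i} = ⊤)
    (hP : Function.Injective fun i ↦ minpoly F (γ i)) (z : ∀ i, E i) :
    ∃ p : F[X], aeval γ p = z := by
  classical
  have hint : ∀ i, IsIntegral F (γ i) := fun i ↦ Algebra.IsIntegral.isIntegral _
  have hcop : ∀ i j, i ≠ j → IsCoprime (minpoly F (γ i)) (minpoly F (γ j)) := fun i j hij ↦ by
    refine (minpoly.irreducible (hint i)).isCoprime_or_dvd _ |>.resolve_right fun hdvd ↦ ?_
    exact hij (hP (Polynomial.eq_of_monic_of_associated (minpoly.monic (hint i))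
      (minpoly.monic (hint j)) ((minpoly.irreducible (hint i)).associated_of_dvd
        (minpoly.irreducible (hint j)) hdvd)))
  -- A Bézout relation between one minimal polynomial and the product of the others yields the
  -- idempotent of that factor.
  have hidem : ∀ i, ∃ q : F[X], aeval γ q = Pi.single i 1 := fun i ↦ by
    obtain ⟨a, b, hab⟩ : IsCoprime (minpoly F (γ i)) (∏ j ∈ Finset.univ.erase i, minpoly F (γ j)) :=
      IsCoprime.prod_right fun j hj ↦ hcop i j (Finset.mem_erase.mp hj).1.symm
    refine ⟨b * ∏ j ∈ Finset.univ.erase i, minpoly F (γ j), funext fun j ↦ ?_⟩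
    rw [aeval_pi_apply]
    obtain rfl | hij := eq_or_ne j i
    · rw [Pi.single_eq_same, eq_sub_of_add_eq' hab]
      simp
    · rw [Pi.single_eq_of_ne hij, ← Finset.mul_prod_erase _ _
        (Finset.mem_erase.mpr ⟨hij, Finset.mem_univ j⟩)]
      simp
  choose q hq using hidem
  have hz : ∀ i, ∃ p : F[X], aeval (γ i) p = z i := fun i ↦ by
    have h1 : z i ∈ Algebra.adjoin F {γ i} := by rw [hgen]; trivial
    rw [Algebra.adjoin_singleton_eq_range_aeval] at h1
    exact h1
  choose p hp using hz
  refine ⟨∑ i, p i * q i, ?_⟩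
  simp only [map_sum, map_mul, hq]
  funext j
  rw [Finset.sum_apply, Finset.sum_eq_single j]
  · rw [Pi.mul_apply, Pi.single_eq_same, mul_one, aeval_pi_apply, hp]
  · intro i _ hij
    rw [Pi.mul_apply, Pi.single_eq_of_ne hij.symm, mul_zero]
  · exact fun h ↦ absurd (Finset.mem_univ j) h

end Generation

/-! ### Conductor and residues of the order generated by `γ` -/

section RingA

variable {k : Type u} {F : Type v} {I : Type x} {E : I → Type w} [Field k] [Field F]
  [∀ i, Field (E i)] [∀ i, Algebra k (E i)] [∀ i, Algebra F (E i)] {vF : Valuation F ℤᵐ⁰}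
  {vE : ∀ i, Valuation (E i) ℤᵐ⁰} {γ : ∀ i, E i}

lemma algebraMap_mem_ringA {y : F} (hy : vF y ≤ 1) :
    algebraMap F (∀ i, E i) y ∈ ringA k vF γ :=
  Algebra.subset_adjoin (Or.inl ⟨y, hy, rfl⟩)

lemma self_mem_ringA : γ ∈ ringA k vF γ := Algebra.subset_adjoin (Or.inr rfl)

variable [∀ i, FiniteDimensional F (E i)]

/-- Write `z` as a polynomial in `γ` over `F`; a scalar of large order makes all its coefficients
integral. -/
lemma exists_smul_mem_ringA [Fintype I] (hgen : ∀ i, Algebra.adjoin F {γ i} = ⊤)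
    (hP : Function.Injective fun i ↦ minpoly F (γ i)) (z : ∀ i, E i) :
    ∃ D : ℕ, ∀ a : F, vF a ≤ exp (-D : ℤ) → a • z ∈ ringA k vF γ := by
  obtain ⟨p, rfl⟩ := exists_aeval_eq hgen hP z
  induction p using Polynomial.induction_on' with
  | add p q hp hq =>
    obtain ⟨D₁, h₁⟩ := hp
    obtain ⟨D₂, h₂⟩ := hq
    refine ⟨max D₁ D₂, fun a ha ↦ ?_⟩
    rw [map_add, smul_add]
    refine add_mem (h₁ a (ha.trans ?_)) (h₂ a (ha.trans ?_)) <;>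
    · rw [WithZero.exp_le_exp]
      omega
  | monomial n c =>
    refine ⟨(log (vF c)).toNat, fun a ha ↦ ?_⟩
    rw [aeval_monomial, Algebra.smul_def, ← mul_assoc, ← map_mul]
    refine mul_mem (algebraMap_mem_ringA ?_) (pow_mem self_mem_ringA n)
    rw [map_mul]
    have hc : vF c ≤ exp ((log (vF c)).toNat : ℤ) :=
      WithZero.le_exp_of_log_le (Int.self_le_toNat _)
    refine (mul_le_mul' ha hc).trans_eq ?_
    rw [← WithZero.exp_add, neg_add_cancel, WithZero.exp_zero]

variable [Algebra k F] [∀ i, IsScalarTower k F (E i)]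

/-- The generators have this property, `γ` with constant `0`, and it passes to sums and products
because such elements are integral. -/
lemma exists_sub_algebraMap_mem_ball_of_mem_ringA (hF : IsCompleteOver k vF)
    (hE : ∀ i, IsTotallyRamified vF (vE i)) (hv : ∀ i, IsCompleteOver k (vE i))
    (hγ : ∀ i, vE i (γ i) < 1) {z : ∀ i, E i} (hz : z ∈ ringA k vF γ) :
    ∃ c : k, z - algebraMap k _ c ∈ ball vE 1 := by
  induction hz using Algebra.adjoin_induction with
  | mem z hz =>
    obtain ⟨y, hy, rfl⟩ | rfl := hz
    · obtain ⟨c, hc⟩ := hF.residue y hy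
      refine ⟨c, fun i ↦ ?_⟩
      rw [Pi.sub_apply, Pi.algebraMap_apply, Pi.algebraMap_apply,
        IsScalarTower.algebraMap_apply k F (E i), ← map_sub, (hE i).map_algebraMap, Nat.cast_one,
        ← lt_one_iff_le_exp]
      exact pow_lt_one' hc Module.finrank_pos.ne'
    · refine ⟨0, fun i ↦ ?_⟩
      rw [map_zero, sub_zero, Nat.cast_one, ← lt_one_iff_le_exp]
      exact hγ i
  | algebraMap c => exact ⟨c, by rw [sub_self]; exact zero_mem _⟩
  | add y z _ _ hy hz =>
    obtain ⟨c, hc⟩ := hy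
    obtain ⟨d, hd⟩ := hz
    refine ⟨c + d, ?_⟩
    rw [map_add, add_sub_add_comm]
    exact add_mem hc hd
  | mul y z _ _ hy hz =>
    obtain ⟨c, hc⟩ := hy
    obtain ⟨d, hd⟩ := hz
    refine ⟨c * d, ?_⟩
    have h0 : z ∈ ball vE 0 := by
      simpa using add_mem (ball_anti zero_le_one hd) (algebraMap_mem_ball_zero hv d)
    have h1 : y * z - algebraMap k _ (c * d) =
        (y - algebraMap k _ c) * z + algebraMap k _ c * (z - algebraMap k _ d) := by
      rw [map_mul]; ring
    rw [h1]
    refine add_mem (mul_mem_ball hc h0) ?_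
    simpa using mul_mem_ball (algebraMap_mem_ball_zero hv c) hd

/-- The powers of the uniformizers, placed in single factors, form a finite `F`-basis of the
product. A family of large order has coefficients small enough to carry every basis vector into the
order. -/
lemma exists_isUnibranchOrder_ringA [Fintype I] (hF : IsCompleteOver k vF)
    (hE : ∀ i, IsTotallyRamified vF (vE i)) (hv : ∀ i, IsCompleteOver k (vE i))
    (hγ : ∀ i, vE i (γ i) < 1) (hgen : ∀ i, Algebra.adjoin F {γ i} = ⊤)
    (hP : Function.Injective fun i ↦ minpoly F (γ i)) {ϖ : ∀ i, E i}
    (hϖ : ∀ i, vE i (ϖ i) = exp (-1)) : ∃ N, IsUnibranchOrder vE (ringA k vF γ) N := by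
  classical
  choose D hD using fun j : (Σ i, Fin (Module.finrank F (E i))) ↦
    exists_smul_mem_ringA (k := k) (vF := vF) hgen hP (Pi.single j.1 (ϖ j.1 ^ (j.2 : ℕ)))
  let D₀ : ℕ := Finset.univ.sup D
  let n₀ : ℕ := Finset.univ.sup fun i ↦ Module.finrank F (E i)
  -- `D₀` serves all basis vectors, and the maximal degree `n₀` converts it to a bound in every `E
  -- i`. The `+ 1` only ensures positivity.
  refine ⟨n₀ * D₀ + 1, Nat.succ_pos _, fun z hz ↦ ?_, fun z hz ↦
    exists_sub_algebraMap_mem_ball_of_mem_ringA hF hE hv hγ hz⟩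
  choose a ha using fun i ↦ (hE i).exists_eq_sum (hϖ i) (z i)
  have hle : ∀ i j, vF (a i j) ≤ exp (-D₀ : ℤ) := fun i j ↦ by
    refine (hE i).map_coeff_le (hϖ i) ?_ j
    rw [ha]
    refine (hz i).trans ?_
    rw [WithZero.exp_le_exp]
    have h1 : Module.finrank F (E i) ≤ n₀ :=
      Finset.le_sup (f := fun i ↦ Module.finrank F (E i)) (Finset.mem_univ i)
    have h2 : (Module.finrank F (E i) * D₀ : ℤ) ≤ n₀ * D₀ := by
      exact_mod_cast Nat.mul_le_mul_right D₀ h1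
    push_cast
    linarith
  have hsum : z = ∑ i, ∑ j : Fin (Module.finrank F (E i)),
      a i j • (Pi.single i (ϖ i ^ (j : ℕ)) : ∀ i, E i) := by
    rw [← Finset.univ_sum_single z]
    refine Finset.sum_congr rfl fun i _ ↦ ?_
    rw [← ha i]
    refine (map_sum (AddMonoidHom.single E i) _ _).trans (Finset.sum_congr rfl fun j _ ↦ ?_)
    rw [← Algebra.smul_def]
    exact Pi.single_smul i (a i j) _
  rw [hsum]
  refine sum_mem fun i _ ↦ sum_mem fun j _ ↦ hD ⟨i, j⟩ _ ((hle i j).trans ?_)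
  rw [WithZero.exp_le_exp]
  have : D ⟨i, j⟩ ≤ D₀ := Finset.le_sup (Finset.mem_univ _)
  omega

end RingA

end SingularCurve

end

/-! ### Assembly of the theorem -/

theorem proposition2p1p1
    {k : Type u} [Field k] [PerfectField k]
    {F : Type v} [Field F] [Algebra k F]
    (vF : Valuation F ℤᵐ⁰) (hF : SingularCurve.IsLocalField k vF)
    {I : Type x} [Finite I] [Nonempty I]
    {E : I → Type w} [∀ i, Field (E i)] [∀ i, Algebra k (E i)] [∀ i, Algebra F (E i)]
    [∀ i, IsScalarTower k F (E i)] [∀ i, FiniteDimensional F (E i)]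
    [∀ i, Algebra.IsSeparable F (E i)]
    (vE : ∀ i, Valuation (E i) ℤᵐ⁰) (hE : ∀ i, SingularCurve.IsTotallyRamified vF (vE i))
    (γ : ∀ i, E i) (hγ : ∀ i, vE i (γ i) < 1)
    (hgen : ∀ i, Algebra.adjoin F {γ i} = ⊤)
    (hP : Function.Injective fun i => minpoly F (γ i))
    (hcard : Cardinal.lift.{u} (Cardinal.mk I) ≤ Cardinal.lift.{x} (Cardinal.mk k)) :
    ∃ (C : Scheme.{u}) (f : C ⟶ Spec (.of k)) (c : Spec (.of k) ⟶ C)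
      (π : SingularCurve.projSpace k 1 ⟶ C),
      -- `C` is a geometrically integral projective curve over `k` and `c` is a `k`-point
      SingularCurve.IsProjective f ∧ GeometricallyIntegral f ∧ topologicalKrullDim C = 1 ∧
      c ≫ f = 𝟙 _ ∧
      -- `C` is smooth away from `c`
      (∃ U : C.Opens, (U : Set C) = {SingularCurve.underlyingPoint c}ᶜ ∧ Smooth (U.ι ≫ f)) ∧
      -- the completed local ring at `c` is `A_I`
      SingularCurve.CompletedLocalRingIso f (SingularCurve.underlyingPoint c)
        (SingularCurve.ringA k vF γ) ∧
      -- the normalization is the projective line over `k`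
      π ≫ f = SingularCurve.projSpaceStr k 1 ∧ SingularCurve.IsNormalization π ∧
      -- `C` is the gluing of `Spec B_I` and `ℙ¹ ∖ ι(I)`
      ∃ (ι : I → k) (ϖ : ∀ i, E i) (b : Spec (.of (SingularCurve.ringB vF γ ι ϖ)) ⟶ C)
        (V : (SingularCurve.projSpace k 1).Opens),
        Function.Injective ι ∧ (∀ i, vE i (ϖ i) = WithZero.exp (-1)) ∧
        (V : Set (SingularCurve.projSpace k 1)) =
          (Set.range fun i => SingularCurve.affinePoint (ι i))ᶜ ∧
        π ⁻¹' {SingularCurve.underlyingPoint c} =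
          (Set.range fun i => SingularCurve.affinePoint (ι i)) ∧
        SingularCurve.IsGluing f π (SingularCurve.ringB vF γ ι ϖ) b V := by
  classical
  have := Fintype.ofFinite I
  obtain ⟨e⟩ := Cardinal.lift_mk_le'.mp hcard
  let ι : I → k := e
  have hι : Function.Injective ι := e.injective
  choose ϖ hϖ using fun i ↦ (hE i).surjective (WithZero.exp (-1))
  have hF' := hF.isCompleteOver
  have hv := fun i ↦ (hE i).isCompleteOver (hϖ i) (k := k) hF'
  obtain ⟨N, hA⟩ := SingularCurve.exists_isUnibranchOrder_ringA hF' hE hv hγ hgen hP hϖ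
  let i₀ : I := Classical.arbitrary I
  -- The conductor polynomial is `f₀ ^ N`; its zeros are exactly the points `ι i`, and it has
  -- positive degree because `I` is nonempty and `0 < N`.
  set f₀ : k[X] := ∏ i, (X - C (ι i)) with hf₀
  have hmonic : f₀.Monic := monic_prod_X_sub_C ι Finset.univ
  have hdeg : 0 < (f₀ ^ N).natDegree := by
    rw [hmonic.natDegree_pow, natDegree_finsetProd_X_sub_C_eq_card]
    exact Nat.mul_pos hA.pos (Finset.card_pos.mpr ⟨i₀, Finset.mem_univ _⟩)
  have hgB : ∀ p, f₀ ^ N * p ∈ SingularCurve.ringB vF γ ι ϖ := hA.mul_mem_comap hv hϖ hι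
  have hB : ∀ p ∈ SingularCurve.ringB vF γ ι ϖ, ∀ i j, p.eval (ι i) = p.eval (ι j) :=
    fun p hp ↦ hA.eval_eq_eval hv hϖ hp
  have hgι : ∀ i, (f₀ ^ N).eval (ι i) = 0 := fun i ↦ by
    rw [eval_pow, hf₀, eval_prod, Finset.prod_eq_zero (Finset.mem_univ i) (by simp),
      zero_pow hA.pos.ne']
  have hroot : ∀ q : Spec (.of k[X]), f₀ ^ N ∈ q.asIdeal → ∃ i, X - C (ι i) ∈ q.asIdeal :=
    fun q hq ↦ by
      have hp : q.asIdeal.IsPrime := PrimeSpectrum.isPrime q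
      obtain ⟨i, -, hi⟩ := hp.prod_mem_iff.mp (hp.mem_of_pow_mem N hq)
      exact ⟨i, hi⟩
  have hint := SingularCurve.isIntegral_val (hmonic.pow N) hdeg (by simpa using hgB 1)
  obtain ⟨S⟩ := SingularCurve.nonempty_curveModel (hmonic.pow N) hdeg hgB
  have hg0 := (hmonic.pow N).ne_zero
  have hpre := S.preimage_underlyingPoint hgι hgB hroot hB i₀
  refine ⟨S.C, S.f, S.point (ι i₀), S.π, S.isProjective, inferInstance,
    S.topologicalKrullDim_eq_one hint, S.point_comp_f _, ⟨S.complPoint (ι i₀), rfl,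
      S.smooth_complPoint hgι hgB hroot hB i₀ hg0⟩, ?_, S.π_comp, S.isNormalization_π hint,
    ι, ϖ, S.b₀, S.π ⁻¹ᵁ S.complPoint (ι i₀), hι, hϖ, ?_, hpre,
    S.isGluing hgι hgB hroot hB i₀ hg0⟩
  · have : @IsOpenImmersion (Spec (.of ((SingularCurve.ringA k vF γ).comap
        (SingularCurve.expansion ι ϖ)))) S.C S.b₀ := S.isOpenImmersion_b₀
    exact hA.completedLocalRingIso hv hϖ hι S.f S.b₀ S.b₀_comp _ _
      (Scheme.Hom.comp_apply _ S.b₀ _).symm i₀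
      (SingularCurve.mem_asIdeal_SpecMap_closedPoint
        ((Polynomial.evalRingHom (ι i₀)).comp (SingularCurve.ringB vF γ ι ϖ).val.toRingHom))
  · rw [← hpre]
    rfl
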